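/- Notation. $\mathbb S^1=\{z\in\mathbb C:|z|=1\}$; $C[-\infty,+\infty]$ is the algebra of continuous functions on the two-point compactification of $\mathbb R$; $\mathfrak A$ is the C$^*$-algebra of bounded operators on $L^2(\mathbb R)$ generated by the multiplications $a(M)$ with $a\in C[-\infty,+\infty]$, the multiplications by continuous $2\pi$-periodic functions, and the Fourier multipliers $b(D)=F^{-1}b(M)F$ with $b\in C[-\infty,+\infty]$, where $(Fu)(\xi)=(2\pi)^{-1/2}\int e^{-ix\xi}u(x)\,dx$. Let $\mathfrak B$ be the algebra of bounded operators on $\ell^2(\mathbb Z)$, let $\mathfrak K_{\mathbb Z}\subset\mathfrak B$ and $\mathfrak K_{\mathbb R}\subset\mathfrak A$ be the ideals of compact operators, and $S^*\mathbb S^1=\mathbb S^1\times\{-1,+1\}$. For $\varphi\in\mathbb R$ let $Y_\varphi\in\mathfrak B$ be the conjugate, by the discrete Fourier transform $L^2(\mathbb S^1)\to\ell^2(\mathbb Z)$, of multiplication by $z^{-\varphi}$ (principal branch), and let $M^b_\varphi((a_j)_j)=(b(j-\varphi)a_j)_j$. Let $X$ be the set of all $(x,e^{i\theta})\in[-\infty,+\infty]\times\mathbb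 S^1$ with $|x|=\infty$ or $x=\theta\in\mathbb R$. Proposition. There are unital $*$-homomorphisms $\sigma:\mathfrak A\to C(X\times\{-\infty,+\infty\})$ and $\gamma:\mathfrak A\to C(S^*\mathbb S^1,\mathfrak B)$ (each is unique) such that (a) for $m=(x,e^{i\theta})\in X$: $\sigma_{a(M)}(m,\pm\infty)=a(x)$ if $a\in C[-\infty,+\infty]$; $\sigma_{p}(m,\pm\infty)=p(\theta)$ if $p$ is (multiplication by) a continuous $2\pi$-periodic function; $\sigma_{b(D)}(m,\pm\infty)=b(\pm\infty)$ if $b\in C[-\infty,+\infty]$; (b) for $v=(e^{2\pi i\varphi},\pm1)\in S^*\mathbb S^1$: $\gamma_{a(M)}(v)=a(\pm\infty)I$; $\gamma_{e_k(M)}(v)=Y_{-k}$ for $e_k(x)=e^{ikx}$, $k\in\mathbb Z$; $\gamma_{b(D)}(v)=Y_\varphi M^b_\varphi Y_{-\varphi}$. Let $\mathfrak E=\ker\sigma$. Then $\sigma$ and $\gamma$ vanish on $\mathfrak K_{\mathbb R}$, and $\gamma_A(v)\in\mathfrak K_{\mathbb Z}$ for all $A\in\mathfrak E$ and $v\in S^*\mathbb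 S^1$. So $\gamma$ induces a homomorphism $\bar\gamma:\mathfrak E/\mathfrak K_{\mathbb R}\to C(S^*\mathbb S^1,\mathfrak K_{\mathbb Z})$. Let $$\delta_1:K_1(\mathfrak A/\mathfrak E)\to K_0(\mathfrak E/\mathfrak K_{\mathbb R})\xrightarrow{\ \bar\gamma_*\ }K_0(C(S^*\mathbb S^1,\mathfrak K_{\mathbb Z}))\xrightarrow{\ \nu_*\ }K_0(\mathfrak K_{\mathbb Z})\oplus K_0(\mathfrak K_{\mathbb Z})$$ be the composition of the index map of $0\to\mathfrak E/\mathfrak K_{\mathbb R}\to\mathfrak A/\mathfrak K_{\mathbb R}\to\mathfrak A/\mathfrak E\to0$ (the class of an invertible matrix $u$ goes to $[wpw^{-1}]_0-[p]_0$, where $p=\mathrm{diag}(1,0)$ and $w$ is an invertible lift of $\mathrm{diag}(u,u^{-1})$) with the maps induced by $\bar\gamma$ and by $\nu(f)=(f(1,-1),f(1,+1))$. Suppose that $A\in\mathfrak A$ and that the class $[A]_{\mathfrak E}$ is invertible in $\mathfrak A/\mathfrak E$. Then $\gamma_A(z,-1)$ and $\gamma_A(z,+1)$ are Fredholm operators on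 $\ell^2(\mathbb Z)$ for every $z\in\mathbb S^1$, and for every rank-one orthogonal projection $E$ on $\ell^2(\mathbb Z)$ $$\delta_1([[A]_{\mathfrak E}]_1)=\bigl(\mathrm{ind}(\gamma_A(1,-1))\,[E]_0,\ \mathrm{ind}(\gamma_A(1,+1))\,[E]_0\bigr)\in K_0(\mathfrak K_{\mathbb Z})\oplus K_0(\mathfrak K_{\mathbb Z}),$$ where $\mathrm{ind}\,T=\dim\ker T-\dim\mathrm{coker}\,T$ is the Fredholm index. -/

import Mathlib

namespace KTheory

section KZero

variable {R S T : Type} [Ring R] [Ring S] [Ring T]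

/-- Algebraic (Murray-von Neumann) equivalence of square matrices, possibly of different sizes. -/
def Equivalent {ι κ : Type} [Fintype ι] [Fintype κ] (e : Matrix ι ι R) (f : Matrix κ κ R) : Prop :=
  ∃ (x : Matrix ι κ R) (y : Matrix κ ι R), x * y = e ∧ y * x = f

theorem Equivalent.refl {ι : Type} [Fintype ι] {e : Matrix ι ι R} (he : e * e = e) :
    Equivalent e e := ⟨e, e, he, he⟩

theorem Equivalent.symm {ι κ : Type} [Fintype ι] [Fintype κ] {e : Matrix ι ι R}
    {f : Matrix κ κ R} (h : Equivalent e f) : Equivalent f e := by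
  obtain ⟨x, y, h1, h2⟩ := h
  exact ⟨y, x, h2, h1⟩

theorem Equivalent.trans {ι κ μ : Type} [Fintype ι] [Fintype κ] [Fintype μ] {e : Matrix ι ι R}
    {f : Matrix κ κ R} {g : Matrix μ μ R} (he : e * e = e) (hg : g * g = g)
    (h : Equivalent e f) (h' : Equivalent f g) : Equivalent e g := by
  obtain ⟨x, y, h1, h2⟩ := h
  obtain ⟨x', y', h3, h4⟩ := h'
  refine ⟨x * x', y' * y, ?_, ?_⟩
  · calc x * x' * (y' * y) = x * (x' * y') * y := by simp only [Matrix.mul_assoc]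
      _ = (x * y) * (x * y) := by rw [h3, ← h2]; simp only [Matrix.mul_assoc]
      _ = e := by rw [h1, he]
  · calc y' * y * (x * x') = y' * (y * x) * x' := by simp only [Matrix.mul_assoc]
      _ = (y' * x') * (y' * x') := by rw [h2, ← h3]; simp only [Matrix.mul_assoc]
      _ = g := by rw [h4, hg]

theorem Equivalent.map {ι κ : Type} [Fintype ι] [Fintype κ] {e : Matrix ι ι R}
    {f : Matrix κ κ R} (h : Equivalent e f) (φ : R →+* S) : Equivalent (e.map φ) (f.map φ) := by
  obtain ⟨x, y, h1, h2⟩ := h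
  exact ⟨x.map φ, y.map φ, by rw [← Matrix.map_mul, h1], by rw [← Matrix.map_mul, h2]⟩

theorem Equivalent.submatrix {ι κ : Type} [Fintype ι] [Fintype κ] {e : Matrix ι ι R}
    (he : e * e = e) (s : κ ≃ ι) : Equivalent e (e.submatrix s s) := by
  refine ⟨e.submatrix id s, e.submatrix s id, ?_, ?_⟩
  · rw [Matrix.submatrix_mul_equiv, he, Matrix.submatrix_id_id]
  · have := Matrix.submatrix_mul_equiv e e s (Equiv.refl ι) s
    simp only [Equiv.coe_refl] at this
    rw [this, he]

theorem Equivalent.fromBlocks {ι κ ι' κ' : Type} [Fintype ι] [Fintype κ] [Fintype ι'] [Fintype κ']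
    {e : Matrix ι ι R} {f : Matrix κ κ R} {e' : Matrix ι' ι' R} {f' : Matrix κ' κ' R}
    (h : Equivalent e f) (h' : Equivalent e' f') :
    Equivalent (Matrix.fromBlocks e 0 0 e') (Matrix.fromBlocks f 0 0 f') := by
  obtain ⟨x, y, h1, h2⟩ := h
  obtain ⟨x', y', h3, h4⟩ := h'
  exact ⟨Matrix.fromBlocks x 0 0 x', Matrix.fromBlocks y 0 0 y',
    by simp [Matrix.fromBlocks_multiply, h1, h3], by simp [Matrix.fromBlocks_multiply, h2, h4]⟩

variable (R) in
/-- An idempotent square matrix over `R`, of arbitrary finite size. -/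
structure IdemMatrix where
  size : ℕ
  mat : Matrix (Fin size) (Fin size) R
  idem : mat * mat = mat

variable (R) in
instance idemSetoid : Setoid (IdemMatrix R) where
  r e f := Equivalent e.mat f.mat
  iseqv :=
    { refl := fun e => Equivalent.refl e.idem
      symm := fun h => Equivalent.symm h
      trans := fun {e _ g} h h' => Equivalent.trans e.idem g.idem h h' }

variable (R) in
/-- The set `V(R)` of equivalence classes of idempotent matrices over `R`. -/
def V : Type := Quotient (idemSetoid R)

/-- The class in `V(R)` of an idempotent matrix indexed by any finite type. -/
noncomputable def V.mk {ι : Type} [Fintype ι] (e : Matrix ι ι R) (he : e * e = e) : V R :=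
  Quotient.mk (idemSetoid R) ⟨Fintype.card ι,
    e.submatrix (Fintype.equivFin ι).symm (Fintype.equivFin ι).symm,
    by rw [Matrix.submatrix_mul_equiv, he]⟩

theorem V.mk_eq_mk {ι κ : Type} [Fintype ι] [Fintype κ] {e : Matrix ι ι R} {f : Matrix κ κ R}
    (he : e * e = e) (hf : f * f = f) : V.mk e he = V.mk f hf ↔ Equivalent e f := by
  have h1 := Equivalent.submatrix he (Fintype.equivFin ι).symm
  have h2 := Equivalent.submatrix hf (Fintype.equivFin κ).symm
  refine Iff.trans (Quotient.eq (r := idemSetoid R)) ?_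
  constructor
  · intro h
    change Equivalent (e.submatrix _ _) (f.submatrix _ _) at h
    have i1 : (e.submatrix (Fintype.equivFin ι).symm (Fintype.equivFin ι).symm) *
      (e.submatrix (Fintype.equivFin ι).symm (Fintype.equivFin ι).symm) =
      (e.submatrix (Fintype.equivFin ι).symm (Fintype.equivFin ι).symm) := by
        rw [Matrix.submatrix_mul_equiv, he]
    have i2 : (f.submatrix (Fintype.equivFin κ).symm (Fintype.equivFin κ).symm) *
      (f.submatrix (Fintype.equivFin κ).symm (Fintype.equivFin κ).symm) =
      (f.submatrix (Fintype.equivFin κ).symm (Fintype.equivFin κ).symm) := by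
        rw [Matrix.submatrix_mul_equiv, hf]
    exact (h1.trans he i2 h).trans he hf h2.symm
  · intro h
    change Equivalent (e.submatrix _ _) (f.submatrix _ _)
    have i1 : (e.submatrix (Fintype.equivFin ι).symm (Fintype.equivFin ι).symm) *
      (e.submatrix (Fintype.equivFin ι).symm (Fintype.equivFin ι).symm) =
      (e.submatrix (Fintype.equivFin ι).symm (Fintype.equivFin ι).symm) := by
        rw [Matrix.submatrix_mul_equiv, he]
    have i2 : (f.submatrix (Fintype.equivFin κ).symm (Fintype.equivFin κ).symm) *
      (f.submatrix (Fintype.equivFin κ).symm (Fintype.equivFin κ).symm) =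
      (f.submatrix (Fintype.equivFin κ).symm (Fintype.equivFin κ).symm) := by
        rw [Matrix.submatrix_mul_equiv, hf]
    exact (h1.symm.trans i1 hf h).trans i1 i2 h2

theorem V.exists_mk (v : V R) : ∃ (n : ℕ) (e : Matrix (Fin n) (Fin n) R) (he : e * e = e),
    v = V.mk e he := by
  obtain ⟨⟨n, e, he⟩, rfl⟩ := Quotient.exists_rep v
  refine ⟨n, e, he, Quotient.sound ?_⟩
  exact Equivalent.submatrix he _

theorem idem_fromBlocks {ι κ : Type} [Fintype ι] [Fintype κ] {e : Matrix ι ι R} {f : Matrix κ κ R}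
    (he : e * e = e) (hf : f * f = f) :
    Matrix.fromBlocks e 0 0 f * Matrix.fromBlocks e 0 0 f = Matrix.fromBlocks e 0 0 f := by
  simp [Matrix.fromBlocks_multiply, he, hf]

/-- Direct sum of idempotent matrices. -/
noncomputable instance : Add (V R) where
  add := Quotient.lift₂
    (fun e f : IdemMatrix R => V.mk (Matrix.fromBlocks e.mat 0 0 f.mat) (idem_fromBlocks e.idem f.idem))
    (fun _ _ _ _ h h' => (V.mk_eq_mk _ _).2 (Equivalent.fromBlocks h h'))

noncomputable instance : Zero (V R) where
  zero := V.mk (0 : Matrix (Fin 0) (Fin 0) R) (by simp)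

theorem V.mk_add_mk {ι κ : Type} [Fintype ι] [Fintype κ] {e : Matrix ι ι R} {f : Matrix κ κ R}
    (he : e * e = e) (hf : f * f = f) :
    V.mk e he + V.mk f hf = V.mk (Matrix.fromBlocks e 0 0 f) (idem_fromBlocks he hf) := by
  refine (V.mk_eq_mk (idem_fromBlocks ?_ ?_) _).2 (Equivalent.fromBlocks ?_ ?_)
  · rw [Matrix.submatrix_mul_equiv, he]
  · rw [Matrix.submatrix_mul_equiv, hf]
  · exact (Equivalent.submatrix he _).symm
  · exact (Equivalent.submatrix hf _).symm

theorem V.mk_eq_submatrix {ι κ : Type} [Fintype ι] [Fintype κ] {e : Matrix ι ι R} (he : e * e = e)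
    {f : Matrix κ κ R} (hf : f * f = f) (s : κ ≃ ι) (h : f = e.submatrix s s) :
    V.mk e he = V.mk f hf := by
  subst h
  exact (V.mk_eq_mk _ _).2 (Equivalent.submatrix he s)

noncomputable instance : AddCommMonoid (V R) where
  add_assoc a b c := by
    obtain ⟨n, e, he, rfl⟩ := V.exists_mk a
    obtain ⟨m, f, hf, rfl⟩ := V.exists_mk b
    obtain ⟨k, g, hg, rfl⟩ := V.exists_mk c
    simp only [V.mk_add_mk]
    refine V.mk_eq_submatrix _ _ (Equiv.sumAssoc _ _ _).symm ?_
    ext i j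
    rcases i with i | i | i <;> rcases j with j | j | j <;> simp
  zero_add a := by
    obtain ⟨n, e, he, rfl⟩ := V.exists_mk a
    change V.mk (0 : Matrix (Fin 0) (Fin 0) R) (by simp) + _ = _
    rw [V.mk_add_mk]
    refine V.mk_eq_submatrix _ _ (Equiv.emptySum _ _).symm ?_
    ext i j
    simp
  add_zero a := by
    obtain ⟨n, e, he, rfl⟩ := V.exists_mk a
    change _ + V.mk (0 : Matrix (Fin 0) (Fin 0) R) (by simp) = _
    rw [V.mk_add_mk]
    refine V.mk_eq_submatrix _ _ (Equiv.sumEmpty _ _).symm ?_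
    ext i j
    simp
  add_comm a b := by
    obtain ⟨n, e, he, rfl⟩ := V.exists_mk a
    obtain ⟨m, f, hf, rfl⟩ := V.exists_mk b
    simp only [V.mk_add_mk]
    refine V.mk_eq_submatrix _ _ (Equiv.sumComm _ _) ?_
    ext i j
    rcases i with i | i <;> rcases j with j | j <;> simp
  nsmul := nsmulRec

theorem idem_map {ι : Type} [Fintype ι] {e : Matrix ι ι R} (he : e * e = e) (φ : R →+* S) :
    e.map φ * e.map φ = e.map φ := by
  rw [← Matrix.map_mul, he]

/-- Functoriality of `V`. -/
noncomputable def V.map (φ : R →+* S) : V R →+ V S where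
  toFun := Quotient.lift (fun e : IdemMatrix R => V.mk (e.mat.map φ) (idem_map e.idem φ))
    (fun _ _ h => (V.mk_eq_mk _ _).2 (Equivalent.map h φ))
  map_zero' := by
    refine (V.mk_eq_mk _ _).2 ?_
    refine Equivalent.map (f := (0 : Matrix (Fin 0) (Fin 0) R)) ?_ φ |>.trans ?_ ?_ ?_
    · exact (Equivalent.submatrix (by simp) _).symm
    · exact idem_map (by ext i; exact (Fintype.equivFin (Fin 0)).symm i |>.elim0) _
    · simp
    · exact ⟨0, 0, by ext i; exact i.elim0, by ext i; exact i.elim0⟩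
  map_add' a b := by
    obtain ⟨⟨n, e, he⟩, rfl⟩ := Quotient.exists_rep a
    obtain ⟨⟨m, f, hf⟩, rfl⟩ := Quotient.exists_rep b
    change _ = V.mk (e.map φ) (idem_map he φ) + V.mk (f.map φ) (idem_map hf φ)
    rw [V.mk_add_mk]
    refine (V.mk_eq_mk _ _).2 ?_
    have h := (Equivalent.submatrix (idem_fromBlocks he hf) (Fintype.equivFin (Fin n ⊕ Fin m)).symm).symm.map φ
    rw [Matrix.fromBlocks_map] at h
    simpa using h

theorem V.map_mk (φ : R →+* S) {ι : Type} [Fintype ι] {e : Matrix ι ι R} (he : e * e = e) :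
    V.map φ (V.mk e he) = V.mk (e.map φ) (idem_map he φ) :=
  (V.mk_eq_mk (idem_map (by rw [Matrix.submatrix_mul_equiv, he]) φ) _).2
    (Equivalent.map (Equivalent.submatrix he _).symm φ)

variable (R) in
/-- `K₀` of a unital ring: the group of formal differences of elements of `V(R)`. -/
abbrev K₀ : Type := Algebra.GrothendieckAddGroup (V R)

/-- The class `[e]₀` in `K₀(R)` of an idempotent matrix. -/
noncomputable def K₀.mk {ι : Type} [Fintype ι] (e : Matrix ι ι R) (he : e * e = e) : K₀ R :=
  Algebra.GrothendieckAddGroup.of (V.mk e he)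

/-- Functoriality of `K₀` for unital rings. -/
noncomputable def K₀.map (φ : R →+* S) : K₀ R →+ K₀ S :=
  Algebra.GrothendieckAddGroup.lift (Algebra.GrothendieckAddGroup.of.comp (V.map φ))

theorem K₀.map_mk (φ : R →+* S) {ι : Type} [Fintype ι] {e : Matrix ι ι R} (he : e * e = e) :
    K₀.map φ (K₀.mk e he) = K₀.mk (e.map φ) (idem_map he φ) := by
  unfold K₀.map K₀.mk
  rw [← V.map_mk φ he]
  exact DFunLike.congr_fun (Algebra.GrothendieckAddGroup.lift.symm_apply_apply
    (Algebra.GrothendieckAddGroup.of.comp (V.map φ))) (V.mk e he)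

theorem K₀.mk_eq {ι κ : Type} [Fintype ι] [Fintype κ] {e : Matrix ι ι R} {f : Matrix κ κ R}
    (he : e * e = e) (hf : f * f = f) (h : Equivalent e f) : K₀.mk e he = K₀.mk f hf :=
  congrArg _ ((V.mk_eq_mk he hf).2 h)

theorem K₀.mk_fromBlocks {ι κ : Type} [Fintype ι] [Fintype κ] {e : Matrix ι ι R} {f : Matrix κ κ R}
    (he : e * e = e) (hf : f * f = f) :
    K₀.mk (Matrix.fromBlocks e 0 0 f) (idem_fromBlocks he hf) = K₀.mk e he + K₀.mk f hf := by
  unfold K₀.mk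
  rw [← V.mk_add_mk he hf, map_add]

theorem K₀.map_map (φ : R →+* S) (ψ : S →+* T) (x : K₀ R) :
    K₀.map ψ (K₀.map φ x) = K₀.map (ψ.comp φ) x := by
  have : (K₀.map ψ).comp (K₀.map φ) = K₀.map (ψ.comp φ) := by
    apply (Algebra.GrothendieckAddGroup.lift (M := V R)).symm.injective
    ext v
    obtain ⟨n, e, he, rfl⟩ := V.exists_mk v
    change K₀.map ψ (K₀.map φ (K₀.mk e he)) = K₀.map (ψ.comp φ) (K₀.mk e he)
    simp only [K₀.map_mk, Matrix.map_map]
    rfl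
  exact DFunLike.congr_fun this x

end KZero

section KZeroNonunital

variable (J J' : Type) [NonUnitalRing J] [Module ℂ J] [IsScalarTower ℂ J J] [SMulCommClass ℂ J J]
  [NonUnitalRing J'] [Module ℂ J'] [IsScalarTower ℂ J' J'] [SMulCommClass ℂ J' J']

/-- `K₀(J)` of a possibly non-unital complex algebra `J`: the kernel of the map
`K₀(J⁺) → K₀(ℂ)` induced by the canonical projection of the unitization `J⁺ = ℂ ⊕ J`. -/
noncomputable def KZero : AddSubgroup (K₀ (Unitization ℂ J)) :=
  (K₀.map (Unitization.fstHom ℂ J : Unitization ℂ J →+* ℂ)).ker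

variable {J J'}

/-- The unital extension `J⁺ → J'⁺` of an algebra homomorphism `J → J'`. -/
noncomputable def unitizationMap (φ : J →ₙₐ[ℂ] J') : Unitization ℂ J →ₐ[ℂ] Unitization ℂ J' :=
  Unitization.lift ((Unitization.inrNonUnitalAlgHom ℂ J').comp φ)

theorem fst_unitizationMap (φ : J →ₙₐ[ℂ] J') (x : Unitization ℂ J) :
    (unitizationMap φ x).fst = x.fst := by
  induction x with
  | inl_add_inr r a => simp [unitizationMap, Unitization.algebraMap_eq_inl]

/-- Functoriality of `K₀` for algebra homomorphisms, not necessarily unital. -/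
noncomputable def KZero.map (φ : J →ₙₐ[ℂ] J') : KZero J →+ KZero J' :=
  AddMonoidHom.codRestrict ((K₀.map (unitizationMap φ : Unitization ℂ J →+* Unitization ℂ J')).comp
    (KZero J).subtype) (KZero J') (fun x => by
      have hx : K₀.map (Unitization.fstHom ℂ J : Unitization ℂ J →+* ℂ) x = 0 := x.2
      change K₀.map (Unitization.fstHom ℂ J' : Unitization ℂ J' →+* ℂ) (K₀.map _ x.1) = 0
      rw [K₀.map_map]
      convert hx using 2
      congr 1
      ext y
      exact fst_unitizationMap φ y)

/-- The class `[e]₀` in `K₀(J)` of an idempotent `e ∈ J`. -/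
noncomputable def KZero.mk (e : J) (he : e * e = e) : KZero J :=
  ⟨K₀.mk (Matrix.of fun _ _ : Unit => (e : Unitization ℂ J)) (by
      refine Matrix.ext fun i j => ?_
      simp [Matrix.mul_apply, ← Unitization.inr_mul, he]), by
    change K₀.map _ _ = 0
    rw [K₀.map_mk]
    have h0 : K₀.mk (0 : Matrix Unit Unit ℂ) (by simp) = 0 := by
      have := K₀.mk_eq (e := Matrix.fromBlocks (0 : Matrix Unit Unit ℂ) 0 0 (0 : Matrix Unit Unit ℂ))
        (f := (0 : Matrix Unit Unit ℂ)) (idem_fromBlocks (by simp) (by simp)) (by simp)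
        ⟨0, 0, by ext i j; rcases i with i | i <;> rcases j with j | j <;> simp, by simp⟩
      rw [K₀.mk_fromBlocks (by simp) (by simp)] at this
      simpa using this
    rw [← h0]
    congr 1⟩

end KZeroNonunital

section KOne

/-- The group `GL_n(B)`. -/
abbrev InvMatrix (n : ℕ) (B : Type) [Ring B] : Type := (Matrix (Fin n) (Fin n) B)ˣ

/-- The inclusion matrix `Bⁿ → B^N` onto the first `n` coordinates. -/
def incl (B : Type) [Ring B] (n N : ℕ) : Matrix (Fin N) (Fin n) B :=
  Matrix.of fun i j => if (i : ℕ) = j then 1 else 0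

/-- The projection matrix `B^N → Bⁿ` onto the first `n` coordinates. -/
def proj (B : Type) [Ring B] (n N : ℕ) : Matrix (Fin n) (Fin N) B :=
  Matrix.of fun i j => if (i : ℕ) = j then 1 else 0

variable {A B : Type} [Ring A] [Ring B]

theorem proj_mul_incl {n N : ℕ} (h : n ≤ N) : proj B n N * incl B n N = 1 := by
  ext i j
  simp only [proj, incl, Matrix.mul_apply, Matrix.of_apply, Matrix.one_apply]
  rw [Finset.sum_eq_single (Fin.castLE h i)]
  · simp [Fin.ext_iff]
  · intro b _ hb
    rw [if_neg, zero_mul]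
    intro h'
    exact hb (Fin.ext h'.symm)
  · simp

theorem incl_mul_incl {n m N : ℕ} (h : n ≤ m) :
    incl B m N * incl B n m = incl B n N := by
  ext i j
  simp only [incl, Matrix.mul_apply, Matrix.of_apply]
  rw [Finset.sum_eq_single (Fin.castLE h j)]
  · simp
  · intro b _ hb
    have : ¬ (b : ℕ) = j := fun h' => hb (Fin.ext h')
    rw [if_neg this, mul_zero]
  · simp

theorem proj_mul_proj {n m N : ℕ} (h : n ≤ m) :
    proj B n m * proj B m N = proj B n N := by
  ext i j
  simp only [proj, Matrix.mul_apply, Matrix.of_apply]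
  rw [Finset.sum_eq_single (Fin.castLE h i)]
  · simp
  · intro b _ hb
    rw [if_neg, zero_mul]
    intro h'
    exact hb (Fin.ext h'.symm)
  · simp

theorem incl_self (n : ℕ) : incl B n n = 1 := by
  ext i j
  simp [incl, Matrix.one_apply, Fin.ext_iff]

theorem proj_self (n : ℕ) : proj B n n = 1 := by
  ext i j
  simp [proj, Matrix.one_apply, Fin.ext_iff]

theorem incl_map (φ : A →+* B) (n N : ℕ) : (incl A n N).map φ = incl B n N := by
  ext i j
  simp only [incl, Matrix.map_apply, Matrix.of_apply]
  split_ifs <;> simp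

theorem proj_map (φ : A →+* B) (n N : ℕ) : (proj A n N).map φ = proj B n N := by
  ext i j
  simp only [proj, Matrix.map_apply, Matrix.of_apply]
  split_ifs <;> simp

/-- If `P' P = 1`, the map `x ↦ 1 + P (x - 1) P'` is multiplicative. -/
theorem corner_mul {ι κ : Type} [Fintype ι] [Fintype κ] [DecidableEq ι] [DecidableEq κ]
    {P : Matrix κ ι B} {P' : Matrix ι κ B} (h : P' * P = 1) (x y : Matrix ι ι B) :
    (1 + P * (x - 1) * P') * (1 + P * (y - 1) * P') = 1 + P * (x * y - 1) * P' := by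
  have e : P * (x - 1) * P' * (P * (y - 1) * P') = P * ((x - 1) * (y - 1)) * P' := by
    calc P * (x - 1) * P' * (P * (y - 1) * P') = P * (x - 1) * (P' * P) * (y - 1) * P' := by
          simp only [Matrix.mul_assoc]
      _ = _ := by rw [h]; simp only [Matrix.mul_assoc, Matrix.one_mul]
  have e2 : x * y - 1 = (x - 1) + (y - 1) + (x - 1) * (y - 1) := by noncomm_ring
  rw [e2, add_mul, mul_add, mul_add, e, Matrix.mul_add, Matrix.mul_add, Matrix.add_mul,
    Matrix.add_mul, one_mul, mul_one, one_mul]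
  abel

/-- The stabilization map `u ↦ diag(u, 1)` from `GL_n(B)` to `GL_N(B)`, for `n ≤ N`. -/
def pad {n N : ℕ} (h : n ≤ N) : InvMatrix n B →* InvMatrix N B :=
  Units.map
    { toFun := fun x => 1 + incl B n N * (x - 1) * proj B n N
      map_one' := by simp
      map_mul' := fun x y => (corner_mul (proj_mul_incl h) x y).symm }

theorem pad_val {n N : ℕ} (h : n ≤ N) (u : InvMatrix n B) :
    (pad h u).val = 1 + incl B n N * (u.val - 1) * proj B n N :=
  rfl

theorem pad_pad {n m N : ℕ} (h : n ≤ m) (h' : m ≤ N) (u : InvMatrix n B) :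
    pad h' (pad h u) = pad (h.trans h') u := by
  ext1
  simp only [pad_val, add_sub_cancel_left]
  rw [← incl_mul_incl (N := N) h, ← proj_mul_proj (N := N) h]
  simp only [Matrix.mul_assoc]

theorem pad_self {n : ℕ} (u : InvMatrix n B) : pad le_rfl u = u := by
  ext1
  simp [pad_val, incl_self, proj_self]

variable [TopologicalSpace B] [IsTopologicalRing B]

theorem continuous_pad {n N : ℕ} (h : n ≤ N) : Continuous (pad h : InvMatrix n B → InvMatrix N B) := by
  refine Continuous.units_map _ ?_
  change Continuous fun x : Matrix (Fin n) (Fin n) B => 1 + incl B n N * (x - 1) * proj B n N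
  fun_prop

variable (B) in
/-- The connected component `GL_n(B)₀` of the identity in `GL_n(B)`. -/
abbrev IdComp (n : ℕ) : Subgroup (InvMatrix n B) := Subgroup.connectedComponentOfOne (InvMatrix n B)

instance (n : ℕ) : (IdComp B n).Normal where
  conj_mem u hu g := by
    have hc : Continuous fun x : InvMatrix n B => g * x * g⁻¹ := by fun_prop
    have := hc.image_connectedComponent_subset 1
    simp only [mul_one, mul_inv_cancel] at this
    exact this ⟨u, hu, rfl⟩

theorem pad_mem {n N : ℕ} (h : n ≤ N) {u : InvMatrix n B} (hu : u ∈ IdComp B n) :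
    pad h u ∈ IdComp B N := by
  have := (continuous_pad (B := B) h).image_connectedComponent_subset 1
  rw [map_one] at this
  exact this ⟨u, hu, rfl⟩

variable (B) in
/-- The group `GL_n(B) / GL_n(B)₀`. -/
abbrev CompGroup (n : ℕ) : Type := InvMatrix n B ⧸ IdComp B n

variable (B) in
/-- The maps `GL_n(B) / GL_n(B)₀ → GL_N(B) / GL_N(B)₀` induced by `u ↦ diag(u, 1)`. -/
def padQuot (n N : ℕ) (h : n ≤ N) : CompGroup B n →* CompGroup B N :=
  QuotientGroup.map (IdComp B n) (IdComp B N) (pad h) (fun _ hu => pad_mem h hu)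

instance : DirectedSystem (CompGroup B) (fun n N h => padQuot B n N h) where
  map_self n x := by
    obtain ⟨u, rfl⟩ := QuotientGroup.mk_surjective x
    exact congrArg QuotientGroup.mk (pad_self u)
  map_map n m N h h' x := by
    obtain ⟨u, rfl⟩ := QuotientGroup.mk_surjective x
    exact congrArg QuotientGroup.mk (pad_pad _ _ u)

variable (B) in
/-- `K₁` of a unital topological (in particular, Banach) algebra `B`: the direct limit of the groups
`GL_n(B) / GL_n(B)₀` with respect to the maps `u ↦ diag(u, 1)`, written additively. -/
abbrev KOne : Type := Additive (DirectLimit (CompGroup B) (padQuot B))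

/-- The class `[u]₁` in `K₁(B)` of an element of `GL_n(B)`. -/
def KOne.mk {n : ℕ} (u : InvMatrix n B) : KOne B :=
  Additive.ofMul (Quotient.mk _ ⟨n, (QuotientGroup.mk u : CompGroup B n)⟩)

/-- The class `[u]₁` in `K₁(B)` of an invertible element of `B`. -/
def KOne.ofUnit (u : Bˣ) : KOne B :=
  KOne.mk (n := 1) (Units.map (Matrix.scalar (Fin 1) : B →+* _).toMonoidHom u)

end KOne

section IndexMap

variable {A B : Type} [Ring A] [Ring B] [Algebra ℂ A] [Algebra ℂ B]

/-- The kernel of an algebra homomorphism, as a (non-unital) algebra. -/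
def kerAlg (π : A →ₐ[ℂ] B) : NonUnitalSubalgebra ℂ A where
  carrier := {a | π a = 0}
  add_mem' := fun {a b} ha hb => by
    change π (a + b) = 0
    rw [map_add, show π a = 0 from ha, show π b = 0 from hb, add_zero]
  zero_mem' := map_zero π
  mul_mem' := fun {a b} ha _ => by
    change π (a * b) = 0
    rw [map_mul, show π a = 0 from ha, zero_mul]
  smul_mem' := fun c a ha => by
    change π (c • a) = 0
    rw [map_smul, show π a = 0 from ha, smul_zero]

theorem mem_kerAlg {π : A →ₐ[ℂ] B} {a : A} : a ∈ kerAlg π ↔ π a = 0 := Iff.rfl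

/-- The scalar matrix with entries `s i j`, over the algebra `A`. -/
abbrev scalarMat (A : Type) [Ring A] [Algebra ℂ A] {ι κ : Type} (s : Matrix ι κ ℂ) : Matrix ι κ A :=
  s.map (algebraMap ℂ A)

/-- A matrix `M` over `A` whose image under `π` is the scalar matrix `s`, seen as a matrix over the
unitization `J⁺` of `J = ker π`: the entries are `s i j + (M i j - s i j)`. -/
noncomputable def unitizationMat (π : A →ₐ[ℂ] B) {ι κ : Type} (M : Matrix ι κ A) (s : Matrix ι κ ℂ)
    (h : M.map π = scalarMat B s) : Matrix ι κ (Unitization ℂ (kerAlg π)) :=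
  Matrix.of fun i j => Unitization.inl (s i j) + Unitization.inr
    (⟨M i j - algebraMap ℂ A (s i j), by
      rw [mem_kerAlg, map_sub, AlgHom.commutes, sub_eq_zero]
      exact congrFun (congrFun h i) j⟩ : kerAlg π)

/-- The inclusion `J⁺ → A`. -/
noncomputable def toA (π : A →ₐ[ℂ] B) : Unitization ℂ (kerAlg π) →ₐ[ℂ] A :=
  Unitization.lift (NonUnitalSubalgebraClass.subtype (kerAlg π))

theorem unitizationMat_map_toA (π : A →ₐ[ℂ] B) {ι κ : Type} (M : Matrix ι κ A) (s : Matrix ι κ ℂ)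
    (h : M.map π = scalarMat B s) : (unitizationMat π M s h).map (toA π) = M := by
  ext i j
  simp [unitizationMat, toA]

theorem unitizationMat_map_fst (π : A →ₐ[ℂ] B) {ι κ : Type} (M : Matrix ι κ A) (s : Matrix ι κ ℂ)
    (h : M.map π = scalarMat B s) :
    (unitizationMat π M s h).map (Unitization.fstHom ℂ (kerAlg π)) = s := by
  ext i j
  simp [unitizationMat]

theorem matrix_ext_unitization (π : A →ₐ[ℂ] B) {ι κ : Type}
    {X Y : Matrix ι κ (Unitization ℂ (kerAlg π))} (h1 : X.map (toA π) = Y.map (toA π))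
    (h2 : X.map (Unitization.fstHom ℂ (kerAlg π)) = Y.map (Unitization.fstHom ℂ (kerAlg π))) :
    X = Y := by
  refine Matrix.ext fun i j => ?_
  have e1 := congrFun (congrFun h1 i) j
  have e2 := congrFun (congrFun h2 i) j
  simp only [Matrix.map_apply] at e1 e2
  generalize X i j = x at *
  generalize Y i j = y at *
  induction x with
  | inl_add_inr r a =>
    induction y with
    | inl_add_inr r' a' =>
      simp only [Unitization.fstHom_apply, Unitization.fst_add, Unitization.fst_inl,
        Unitization.fst_inr, add_zero] at e2
      subst e2
      simp [toA] at e1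
      subst e1
      rfl

theorem map_mul_eq (π : A →ₐ[ℂ] B) {ι κ μ : Type} [Fintype κ] {M : Matrix ι κ A} {N : Matrix κ μ A}
    {s : Matrix ι κ ℂ} {t : Matrix κ μ ℂ} (h : M.map π = scalarMat B s)
    (h' : N.map π = scalarMat B t) : (M * N).map π = scalarMat B (s * t) := by
  have := Matrix.map_mul (L := M) (M := N) (f := (π : A →+* B))
  simp only [RingHom.coe_coe] at this
  rw [this, h, h', scalarMat, scalarMat, scalarMat, Matrix.map_mul]

theorem unitizationMat_mul (π : A →ₐ[ℂ] B) {ι κ μ : Type} [Fintype κ] {M : Matrix ι κ A}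
    {N : Matrix κ μ A} {s : Matrix ι κ ℂ} {t : Matrix κ μ ℂ} (h : M.map π = scalarMat B s)
    (h' : N.map π = scalarMat B t) :
    unitizationMat π M s h * unitizationMat π N t h' =
      unitizationMat π (M * N) (s * t) (map_mul_eq π h h') := by
  apply matrix_ext_unitization π
  · have := Matrix.map_mul (L := unitizationMat π M s h) (M := unitizationMat π N t h')
      (f := (toA π : _ →+* A))
    simp only [RingHom.coe_coe] at this
    rw [this, unitizationMat_map_toA, unitizationMat_map_toA, unitizationMat_map_toA]
  · have := Matrix.map_mul (L := unitizationMat π M s h) (M := unitizationMat π N t h')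
      (f := (Unitization.fstHom ℂ (kerAlg π) : _ →+* ℂ))
    simp only [RingHom.coe_coe] at this
    rw [this, unitizationMat_map_fst, unitizationMat_map_fst, unitizationMat_map_fst]

theorem unitizationMat_idem (π : A →ₐ[ℂ] B) {ι : Type} [Fintype ι] {q : Matrix ι ι A}
    {s : Matrix ι ι ℂ} (h : q.map π = scalarMat B s) (hq : q * q = q) (hs : s * s = s) :
    unitizationMat π q s h * unitizationMat π q s h = unitizationMat π q s h := by
  rw [unitizationMat_mul]
  congr 1

/-- The class `[q]₀ - [s]₀` in `K₀(J)`, `J = ker π`, of an idempotent matrix `q` over `A` whose image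
under `π` is the scalar idempotent matrix `s`. -/
noncomputable def relClass (π : A →ₐ[ℂ] B) {ι : Type} [Fintype ι] (q : Matrix ι ι A)
    (s : Matrix ι ι ℂ) (h : q.map π = scalarMat B s) (hq : q * q = q) (hs : s * s = s) :
    KZero (kerAlg π) :=
  ⟨K₀.mk (unitizationMat π q s h) (unitizationMat_idem π h hq hs) -
    K₀.mk (scalarMat (Unitization ℂ (kerAlg π)) s) (idem_map hs (algebraMap ℂ _)), by
    change K₀.map _ _ = 0
    rw [map_sub, K₀.map_mk, K₀.map_mk, sub_eq_zero]
    congr 1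
    rw [Matrix.map_map]
    have := unitizationMat_map_fst π q s h
    rw [RingHom.coe_coe, this]
    ext i j
    simp⟩

theorem relClass_eq (π : A →ₐ[ℂ] B) {ι κ : Type} [Fintype ι] [Fintype κ] {q : Matrix ι ι A}
    {s : Matrix ι ι ℂ} (h : q.map π = scalarMat B s) (hq : q * q = q) (hs : s * s = s)
    {q' : Matrix κ κ A} {s' : Matrix κ κ ℂ} (h' : q'.map π = scalarMat B s') (hq' : q' * q' = q')
    (hs' : s' * s' = s') (x : Matrix ι κ A) (y : Matrix κ ι A) (a : Matrix ι κ ℂ) (b : Matrix κ ι ℂ)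
    (hx : x.map π = scalarMat B a) (hy : y.map π = scalarMat B b)
    (hxy : x * y = q) (hyx : y * x = q') (hab : a * b = s) (hba : b * a = s') :
    relClass π q s h hq hs = relClass π q' s' h' hq' hs' := by
  apply Subtype.ext
  change K₀.mk _ _ - K₀.mk _ _ = K₀.mk _ _ - K₀.mk _ _
  congr 1
  · apply K₀.mk_eq
    refine ⟨unitizationMat π x a hx, unitizationMat π y b hy, ?_, ?_⟩
    · rw [unitizationMat_mul]
      congr 1
    · rw [unitizationMat_mul]
      congr 1
  · apply K₀.mk_eq
    exact Equivalent.map ⟨a, b, hab, hba⟩ (algebraMap ℂ _)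

theorem relClass_fromBlocks (π : A →ₐ[ℂ] B) {ι κ : Type} [Fintype ι] [Fintype κ] {q : Matrix ι ι A}
    {s : Matrix ι ι ℂ} (h : q.map π = scalarMat B s) (hq : q * q = q) (hs : s * s = s)
    {q' : Matrix κ κ A} {s' : Matrix κ κ ℂ} (h' : q'.map π = scalarMat B s') (hq' : q' * q' = q')
    (hs' : s' * s' = s')
    (h'' : (Matrix.fromBlocks q 0 0 q').map π = scalarMat B (Matrix.fromBlocks s 0 0 s')) :
    relClass π (Matrix.fromBlocks q 0 0 q') (Matrix.fromBlocks s 0 0 s') h''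
      (idem_fromBlocks hq hq') (idem_fromBlocks hs hs') =
    relClass π q s h hq hs + relClass π q' s' h' hq' hs' := by
  apply Subtype.ext
  change K₀.mk _ _ - K₀.mk _ _ = (K₀.mk _ _ - K₀.mk _ _) + (K₀.mk _ _ - K₀.mk _ _)
  have e1 : unitizationMat π (Matrix.fromBlocks q 0 0 q') (Matrix.fromBlocks s 0 0 s') h'' =
      Matrix.fromBlocks (unitizationMat π q s h) 0 0 (unitizationMat π q' s' h') := by
    refine Matrix.ext fun i j => ?_
    rcases i with i | i <;> rcases j with j | j <;> simp [unitizationMat] <;> rfl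
  have e2 : scalarMat (Unitization ℂ (kerAlg π)) (Matrix.fromBlocks s 0 0 s') =
      Matrix.fromBlocks (scalarMat (Unitization ℂ (kerAlg π)) s) 0 0
        (scalarMat (Unitization ℂ (kerAlg π)) s') := by
    rw [scalarMat, Matrix.fromBlocks_map]
    simp
  simp only [e1, e2]
  rw [K₀.mk_fromBlocks (unitizationMat_idem π h hq hs) (unitizationMat_idem π h' hq' hs'),
    K₀.mk_fromBlocks (idem_map hs (algebraMap ℂ _)) (idem_map hs' (algebraMap ℂ _))]
  abel

end IndexMap

section IndexMap

variable {A B : Type} [Ring A] [Ring B] [Algebra ℂ A] [Algebra ℂ B]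

theorem map_scalarMat (π : A →ₐ[ℂ] B) {ι κ : Type} (s : Matrix ι κ ℂ) :
    (scalarMat A s).map π = scalarMat B s := by
  ext i j
  simp

theorem idem_scalarMat {ι : Type} [Fintype ι] {s : Matrix ι ι ℂ} (hs : s * s = s) :
    scalarMat A s * scalarMat A s = scalarMat A s := idem_map hs (algebraMap ℂ A)

theorem relClass_scalarMat (π : A →ₐ[ℂ] B) {ι : Type} [Fintype ι] {s : Matrix ι ι ℂ}
    (hs : s * s = s) :
    relClass π (scalarMat A s) s (map_scalarMat π s) (idem_scalarMat hs) hs = 0 := by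
  apply Subtype.ext
  change K₀.mk _ _ - K₀.mk _ _ = 0
  rw [sub_eq_zero]
  congr 1
  refine Matrix.ext fun i j => ?_
  simp [unitizationMat, Unitization.algebraMap_eq_inl]
  rfl

theorem relClass_congr (π : A →ₐ[ℂ] B) {ι : Type} [Fintype ι] {q q' : Matrix ι ι A}
    {s s' : Matrix ι ι ℂ} (h : q.map π = scalarMat B s) (hq : q * q = q) (hs : s * s = s)
    (e : q = q') (e' : s = s') :
    relClass π q s h hq hs = relClass π q' s' (e ▸ e' ▸ h) (e ▸ hq) (e' ▸ hs) := by
  subst e e'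
  rfl

theorem relClass_submatrix (π : A →ₐ[ℂ] B) {ι κ : Type} [Fintype ι] [Fintype κ] {q : Matrix ι ι A}
    {s : Matrix ι ι ℂ} (h : q.map π = scalarMat B s) (hq : q * q = q) (hs : s * s = s) (t : κ ≃ ι)
    (h' : (q.submatrix t t).map π = scalarMat B (s.submatrix t t))
    (hq' : q.submatrix t t * q.submatrix t t = q.submatrix t t)
    (hs' : s.submatrix t t * s.submatrix t t = s.submatrix t t) :
    relClass π (q.submatrix t t) (s.submatrix t t) h' hq' hs' = relClass π q s h hq hs := by
  refine relClass_eq π _ _ _ _ _ _ (q.submatrix t id) (q.submatrix id t) (s.submatrix t id)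
    (s.submatrix id t) ?_ ?_ ?_ ?_ ?_ ?_
  · rw [← Matrix.submatrix_map, h]; rfl
  · rw [← Matrix.submatrix_map, h]; rfl
  · have := Matrix.submatrix_mul_equiv q q t (Equiv.refl ι) t
    simp only [Equiv.coe_refl] at this
    rw [this, hq]
  · rw [Matrix.submatrix_mul_equiv, hq, Matrix.submatrix_id_id]
  · have := Matrix.submatrix_mul_equiv s s t (Equiv.refl ι) t
    simp only [Equiv.coe_refl] at this
    rw [this, hs]
  · rw [Matrix.submatrix_mul_equiv, hs, Matrix.submatrix_id_id]

/-- The invertible matrix `diag(u, v)`. -/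
def blockUnit {R : Type} [Ring R] {ι κ : Type} [Fintype ι] [Fintype κ] [DecidableEq ι]
    [DecidableEq κ] (u : (Matrix ι ι R)ˣ) (v : (Matrix κ κ R)ˣ) : (Matrix (ι ⊕ κ) (ι ⊕ κ) R)ˣ where
  val := Matrix.fromBlocks u.val 0 0 v.val
  inv := Matrix.fromBlocks u⁻¹.val 0 0 v⁻¹.val
  val_inv := by simp [Matrix.fromBlocks_multiply]
  inv_val := by simp [Matrix.fromBlocks_multiply]

/-- The map `GL(A) → GL(B)` induced by `π : A → B`, for matrices indexed by `ι`. -/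
def mapUnit (π : A →ₐ[ℂ] B) {ι : Type} [Fintype ι] [DecidableEq ι] :
    (Matrix ι ι A)ˣ →* (Matrix ι ι B)ˣ :=
  Units.map (π.mapMatrix : Matrix ι ι A →ₐ[ℂ] Matrix ι ι B).toRingHom.toMonoidHom

theorem mapUnit_val (π : A →ₐ[ℂ] B) {ι : Type} [Fintype ι] [DecidableEq ι] (w : (Matrix ι ι A)ˣ) :
    (mapUnit π w).val = w.val.map π := rfl

/-- The scalar idempotent matrix `diag(1, 0)`. -/
def corner (ι : Type) [DecidableEq ι] : Matrix (ι ⊕ ι) (ι ⊕ ι) ℂ := Matrix.fromBlocks 1 0 0 0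

theorem corner_idem (ι : Type) [Fintype ι] [DecidableEq ι] :
    corner ι * corner ι = corner ι := by
  simp [corner, Matrix.fromBlocks_multiply]

theorem scalarMat_corner (A : Type) [Ring A] [Algebra ℂ A] (ι : Type) [DecidableEq ι] :
    scalarMat A (corner ι) = Matrix.fromBlocks 1 0 0 0 := by
  rw [scalarMat, corner, Matrix.fromBlocks_map]
  simp

theorem map_mul₀ (π : A →ₐ[ℂ] B) {ι κ μ : Type} [Fintype κ] (M : Matrix ι κ A) (N : Matrix κ μ A) :
    (M * N).map π = M.map π * N.map π := by
  have := Matrix.map_mul (L := M) (M := N) (f := (π : A →+* B))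
  simpa only [RingHom.coe_coe] using this

variable {ι κ : Type} [Fintype ι] [Fintype κ] [DecidableEq ι] [DecidableEq κ]

theorem conj_map (π : A →ₐ[ℂ] B) (w : (Matrix (ι ⊕ ι) (ι ⊕ ι) A)ˣ) (u x : (Matrix ι ι B)ˣ)
    (h : mapUnit π w = blockUnit u x) :
    (w.val * scalarMat A (corner ι) * w⁻¹.val).map π = scalarMat B (corner ι) := by
  have h1 : w.val.map π = Matrix.fromBlocks u.val 0 0 x.val := by
    rw [← mapUnit_val, h]; rfl
  have h2 : w⁻¹.val.map π = Matrix.fromBlocks u⁻¹.val 0 0 x⁻¹.val := by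
    rw [← mapUnit_val, map_inv, h]; rfl
  rw [map_mul₀, map_mul₀, h1, h2, map_scalarMat, scalarMat_corner]
  simp [Matrix.fromBlocks_multiply]

theorem conj_idem {R : Type} [Ring R] {μ : Type} [Fintype μ] [DecidableEq μ] (w : (Matrix μ μ R)ˣ)
    {p : Matrix μ μ R} (hp : p * p = p) :
    w.val * p * w⁻¹.val * (w.val * p * w⁻¹.val) = w.val * p * w⁻¹.val := by
  calc w.val * p * w⁻¹.val * (w.val * p * w⁻¹.val)
      = w.val * p * (w⁻¹.val * w.val) * p * w⁻¹.val := by simp only [Matrix.mul_assoc]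
    _ = w.val * (p * p) * w⁻¹.val := by rw [Units.inv_mul]; simp only [Matrix.mul_assoc, Matrix.one_mul]
    _ = _ := by rw [hp]

/-- The class `[w p w⁻¹]₀ - [p]₀` with `p = diag(1, 0)`, for an invertible matrix `w` over `A` whose
image in `B` is `diag(u, x)`. -/
noncomputable def liftClass (π : A →ₐ[ℂ] B) (w : (Matrix (ι ⊕ ι) (ι ⊕ ι) A)ˣ) (u x : (Matrix ι ι B)ˣ)
    (h : mapUnit π w = blockUnit u x) : KZero (kerAlg π) :=
  relClass π (w.val * scalarMat A (corner ι) * w⁻¹.val) (corner ι) (conj_map π w u x h)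
    (conj_idem w (idem_scalarMat (corner_idem ι))) (corner_idem ι)

theorem liftClass_eq (π : A →ₐ[ℂ] B) {w w' : (Matrix (ι ⊕ ι) (ι ⊕ ι) A)ˣ} {u x u' x' : (Matrix ι ι B)ˣ}
    (h : mapUnit π w = blockUnit u x) (h' : mapUnit π w' = blockUnit u' x')
    (a : (Matrix ι ι A)ˣ) (ha : mapUnit π a = u⁻¹ * u') :
    liftClass π w u x h = liftClass π w' u' x' h' := by
  have h1 : w.val.map π = Matrix.fromBlocks u.val 0 0 x.val := by
    rw [← mapUnit_val, h]; rfl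
  have h2 : w⁻¹.val.map π = Matrix.fromBlocks u⁻¹.val 0 0 x⁻¹.val := by
    rw [← mapUnit_val, map_inv, h]; rfl
  have h1' : w'.val.map π = Matrix.fromBlocks u'.val 0 0 x'.val := by
    rw [← mapUnit_val, h']; rfl
  have h2' : w'⁻¹.val.map π = Matrix.fromBlocks u'⁻¹.val 0 0 x'⁻¹.val := by
    rw [← mapUnit_val, map_inv, h']; rfl
  have a1 : a.val.map π = u⁻¹.val * u'.val := by rw [← mapUnit_val, ha]; rfl
  have a2 : a⁻¹.val.map π = u'⁻¹.val * u.val := by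
    rw [← mapUnit_val, map_inv, ha, mul_inv_rev, inv_inv]; rfl
  have pp := idem_scalarMat (A := A) (corner_idem ι)
  have c1 : Matrix.fromBlocks a.val 0 0 0 * Matrix.fromBlocks a⁻¹.val 0 0 0 =
      scalarMat A (corner ι) := by
    rw [scalarMat_corner]; simp [Matrix.fromBlocks_multiply]
  have c2 : Matrix.fromBlocks a⁻¹.val 0 0 0 * Matrix.fromBlocks a.val 0 0 0 =
      scalarMat A (corner ι) := by
    rw [scalarMat_corner]; simp [Matrix.fromBlocks_multiply]
  refine relClass_eq π _ _ _ _ _ _ (w.val * Matrix.fromBlocks a.val 0 0 0 * w'⁻¹.val)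
    (w'.val * Matrix.fromBlocks a⁻¹.val 0 0 0 * w⁻¹.val) (corner ι) (corner ι) ?_ ?_ ?_ ?_
    (corner_idem ι) (corner_idem ι)
  · rw [map_mul₀, map_mul₀, h1, h2', scalarMat_corner, Matrix.fromBlocks_map, a1]
    simp [Matrix.fromBlocks_multiply]
  · rw [map_mul₀, map_mul₀, h2, h1', scalarMat_corner, Matrix.fromBlocks_map, a2]
    simp [Matrix.fromBlocks_multiply]
  · rw [← c1]
    calc _ = w.val * Matrix.fromBlocks a.val 0 0 0 * (w'⁻¹.val * w'.val) *
            Matrix.fromBlocks a⁻¹.val 0 0 0 * w⁻¹.val := by simp only [Matrix.mul_assoc]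
      _ = _ := by rw [Units.inv_mul]; simp only [Matrix.mul_assoc, Matrix.one_mul]
  · rw [← c2]
    calc _ = w'.val * Matrix.fromBlocks a⁻¹.val 0 0 0 * (w⁻¹.val * w.val) *
            Matrix.fromBlocks a.val 0 0 0 * w'⁻¹.val := by simp only [Matrix.mul_assoc]
      _ = _ := by rw [Units.inv_mul]; simp only [Matrix.mul_assoc, Matrix.one_mul]

/-- If `π` is surjective, then `diag(u, u⁻¹)` lifts to an invertible matrix. -/
theorem exists_lift (π : A →ₐ[ℂ] B) (hπ : Function.Surjective π) (u : (Matrix ι ι B)ˣ) :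
    ∃ w : (Matrix (ι ⊕ ι) (ι ⊕ ι) A)ˣ, mapUnit π w = blockUnit u u⁻¹ := by
  choose g hg using hπ
  set a : Matrix ι ι A := u.val.map g with ha
  set b : Matrix ι ι A := u⁻¹.val.map g with hb
  have ha' : a.map π = u.val := by ext i j; simp [ha, hg]
  have hb' : b.map π = u⁻¹.val := by ext i j; simp [hb, hg]
  refine ⟨⟨Matrix.fromBlocks (2 * a - a * b * a) (a * b - 1) (1 - b * a) b,
    Matrix.fromBlocks b (1 - b * a) (a * b - 1) (2 * a - a * b * a), ?_, ?_⟩, ?_⟩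
  · rw [Matrix.fromBlocks_multiply, ← Matrix.fromBlocks_one]
    congr 1 <;> noncomm_ring
  · rw [Matrix.fromBlocks_multiply, ← Matrix.fromBlocks_one]
    congr 1 <;> noncomm_ring
  · ext1
    rw [mapUnit_val]
    change (Matrix.fromBlocks (2 * a - a * b * a) (a * b - 1) (1 - b * a) b).map π =
      Matrix.fromBlocks u.val 0 0 u⁻¹.val
    have e : ∀ M : Matrix ι ι A, M.map π = π.mapMatrix M := fun _ => rfl
    rw [e] at ha' hb'
    rw [Matrix.fromBlocks_map]
    simp only [e, map_sub, map_mul, ha', hb', map_one, map_ofNat]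
    congr 1
    · rw [Units.mul_inv]; noncomm_ring
    · simp
    · simp

/-- The index of an invertible matrix `u` over `B`: the class `[w p w⁻¹]₀ - [p]₀` in `K₀(ker π)`,
where `p = diag(1, 0)` and `w` is an invertible matrix over `A` with image `diag(u, u⁻¹)`. -/
noncomputable def index (π : A →ₐ[ℂ] B) (hπ : Function.Surjective π) (u : (Matrix ι ι B)ˣ) :
    KZero (kerAlg π) :=
  liftClass π (exists_lift π hπ u).choose u u⁻¹ (exists_lift π hπ u).choose_spec

theorem index_eq_liftClass (π : A →ₐ[ℂ] B) (hπ : Function.Surjective π) (u x : (Matrix ι ι B)ˣ)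
    (w : (Matrix (ι ⊕ ι) (ι ⊕ ι) A)ˣ) (h : mapUnit π w = blockUnit u x) :
    index π hπ u = liftClass π w u x h :=
  liftClass_eq π _ _ 1 (by simp)

theorem index_congr (π : A →ₐ[ℂ] B) (hπ : Function.Surjective π) (u u' : (Matrix ι ι B)ˣ)
    (a : (Matrix ι ι A)ˣ) (ha : mapUnit π a = u⁻¹ * u') : index π hπ u = index π hπ u' :=
  liftClass_eq π _ _ a ha

theorem index_one (π : A →ₐ[ℂ] B) (hπ : Function.Surjective π) :
    index π hπ (1 : (Matrix ι ι B)ˣ) = 0 := by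
  rw [index_eq_liftClass π hπ 1 1 1 (by ext1; simp [blockUnit])]
  rw [← relClass_scalarMat π (corner_idem ι)]
  refine relClass_congr π _ _ _ ?_ rfl
  simp

/-- Renumbering of the rows and columns of an invertible matrix. -/
def reindexUnit {R : Type} [Ring R] (t : κ ≃ ι) (u : (Matrix ι ι R)ˣ) : (Matrix κ κ R)ˣ where
  val := u.val.submatrix t t
  inv := u⁻¹.val.submatrix t t
  val_inv := by rw [Matrix.submatrix_mul_equiv, Units.mul_inv, Matrix.submatrix_one_equiv]
  inv_val := by rw [Matrix.submatrix_mul_equiv, Units.inv_mul, Matrix.submatrix_one_equiv]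

theorem index_reindexUnit (π : A →ₐ[ℂ] B) (hπ : Function.Surjective π) (t : κ ≃ ι)
    (u : (Matrix ι ι B)ˣ) : index π hπ (reindexUnit t u) = index π hπ u := by
  obtain ⟨w, hw⟩ := exists_lift π hπ u
  rw [index_eq_liftClass π hπ u _ w hw]
  have hw1 : w.val.map π = Matrix.fromBlocks u.val 0 0 u⁻¹.val := by
    rw [← mapUnit_val, hw]; rfl
  rw [index_eq_liftClass π hπ _ (reindexUnit t u⁻¹) (reindexUnit (Equiv.sumCongr t t) w)]
  swap
  · ext1
    rw [mapUnit_val]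
    change (w.val.submatrix _ _).map π = _
    rw [← Matrix.submatrix_map, hw1]
    refine Matrix.ext fun i j => ?_
    rcases i with i | i <;> rcases j with j | j <;> simp [blockUnit, reindexUnit]
  have e1 : (corner ι).submatrix (Equiv.sumCongr t t) (Equiv.sumCongr t t) = corner κ := by
    refine Matrix.ext fun i j => ?_
    rcases i with i | i <;> rcases j with j | j <;> simp [corner, Matrix.one_apply]
  have e2 : (scalarMat A (corner ι)).submatrix (Equiv.sumCongr t t) (Equiv.sumCongr t t) =
      scalarMat A (corner κ) := by
    rw [scalarMat, Matrix.submatrix_map, e1]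
  have e3 : (w.val * scalarMat A (corner ι) * w⁻¹.val).submatrix (Equiv.sumCongr t t)
      (Equiv.sumCongr t t) = (reindexUnit (Equiv.sumCongr t t) w).val * scalarMat A (corner κ) *
      (reindexUnit (Equiv.sumCongr t t) w)⁻¹.val := by
    change _ = w.val.submatrix _ _ * _ * w⁻¹.val.submatrix _ _
    rw [← e2, Matrix.submatrix_mul_equiv, Matrix.submatrix_mul_equiv]
  refine Eq.trans ?_ (relClass_submatrix π (conj_map π w u _ hw)
    (conj_idem w (idem_scalarMat (corner_idem ι))) (corner_idem ι) (Equiv.sumCongr t t) ?_ ?_ ?_)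
  · exact relClass_congr π _ _ _ e3.symm e1.symm

theorem index_blockUnit (π : A →ₐ[ℂ] B) (hπ : Function.Surjective π)
    (u : (Matrix ι ι B)ˣ) (v : (Matrix κ κ B)ˣ) :
    index π hπ (blockUnit u v) = index π hπ u + index π hπ v := by
  obtain ⟨w, hw⟩ := exists_lift π hπ u
  obtain ⟨z, hz⟩ := exists_lift π hπ v
  rw [index_eq_liftClass π hπ u _ w hw, index_eq_liftClass π hπ v _ z hz]
  have hw1 : w.val.map π = Matrix.fromBlocks u.val 0 0 u⁻¹.val := by
    rw [← mapUnit_val, hw]; rfl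
  have hz1 : z.val.map π = Matrix.fromBlocks v.val 0 0 v⁻¹.val := by
    rw [← mapUnit_val, hz]; rfl
  set t : (ι ⊕ κ) ⊕ (ι ⊕ κ) ≃ (ι ⊕ ι) ⊕ (κ ⊕ κ) := Equiv.sumSumSumComm ι κ ι κ with ht
  rw [index_eq_liftClass π hπ _ (blockUnit u⁻¹ v⁻¹) (reindexUnit t (blockUnit w z))]
  swap
  · ext1
    rw [mapUnit_val]
    change ((Matrix.fromBlocks w.val 0 0 z.val).submatrix _ _).map π = _
    rw [← Matrix.submatrix_map, Matrix.fromBlocks_map, hw1, hz1]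
    refine Matrix.ext fun i j => ?_
    rcases i with (i | i) | (i | i) <;> rcases j with (j | j) | (j | j) <;> simp [blockUnit, t]
  have e1 : (Matrix.fromBlocks (corner ι) 0 0 (corner κ)).submatrix t t = corner (ι ⊕ κ) := by
    refine Matrix.ext fun i j => ?_
    rcases i with (i | i) | (i | i) <;> rcases j with (j | j) | (j | j) <;>
      simp [corner, Matrix.one_apply, t]
  have e2 : (Matrix.fromBlocks (scalarMat A (corner ι)) 0 0 (scalarMat A (corner κ))).submatrix t t =
      scalarMat A (corner (ι ⊕ κ)) := by
    rw [← e1, scalarMat, scalarMat, scalarMat, ← Matrix.submatrix_map, Matrix.fromBlocks_map]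
    simp
  have e3 : (Matrix.fromBlocks (w.val * scalarMat A (corner ι) * w⁻¹.val) 0 0
        (z.val * scalarMat A (corner κ) * z⁻¹.val)).submatrix t t =
      (reindexUnit t (blockUnit w z)).val * scalarMat A (corner (ι ⊕ κ)) *
      (reindexUnit t (blockUnit w z))⁻¹.val := by
    change _ = (Matrix.fromBlocks w.val 0 0 z.val).submatrix _ _ * _ *
      (Matrix.fromBlocks w⁻¹.val 0 0 z⁻¹.val).submatrix _ _
    rw [← e2, Matrix.submatrix_mul_equiv, Matrix.submatrix_mul_equiv]
    simp [Matrix.fromBlocks_multiply]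
  have iw := conj_idem w (idem_scalarMat (A := A) (corner_idem ι))
  have iz := conj_idem z (idem_scalarMat (A := A) (corner_idem κ))
  have mm : (Matrix.fromBlocks (w.val * scalarMat A (corner ι) * w⁻¹.val) 0 0
      (z.val * scalarMat A (corner κ) * z⁻¹.val)).map π =
      scalarMat B (Matrix.fromBlocks (corner ι) 0 0 (corner κ)) := by
    rw [Matrix.fromBlocks_map, conj_map π w u _ hw, conj_map π z v _ hz, scalarMat, scalarMat,
      scalarMat, Matrix.fromBlocks_map]
    simp
  have s1 := relClass_fromBlocks π (conj_map π w u _ hw) iw (corner_idem ι) (conj_map π z v _ hz) iz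
    (corner_idem κ) mm
  refine Eq.trans ?_ s1
  refine Eq.trans ?_ (relClass_submatrix π mm (idem_fromBlocks iw iz)
    (idem_fromBlocks (corner_idem ι) (corner_idem κ)) t ?_ ?_ ?_)
  · exact relClass_congr π _ _ _ e3.symm e1.symm

theorem index_mul (π : A →ₐ[ℂ] B) (hπ : Function.Surjective π) (u v : (Matrix ι ι B)ˣ) :
    index π hπ (u * v) = index π hπ u + index π hπ v := by
  obtain ⟨z, hz⟩ := exists_lift π hπ v
  rw [← index_blockUnit, index_congr π hπ (blockUnit u v) (blockUnit (u * v) 1) z, index_blockUnit,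
    index_one, add_zero]
  rw [hz, eq_inv_mul_iff_mul_eq]
  ext1
  simp [blockUnit, Matrix.fromBlocks_multiply]

theorem index_pad (π : A →ₐ[ℂ] B) (hπ : Function.Surjective π) {n N : ℕ} (h : n ≤ N)
    (u : InvMatrix n B) : index π hπ (pad h u) = index π hπ u := by
  obtain ⟨k, rfl⟩ := Nat.exists_eq_add_of_le h
  have e : pad h u = reindexUnit finSumFinEquiv.symm (blockUnit u (1 : InvMatrix k B)) := by
    ext1
    rw [pad_val]
    change _ = (Matrix.fromBlocks u.val 0 0 1).submatrix finSumFinEquiv.symm finSumFinEquiv.symm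
    have h1 : incl B n (n + k) =
        (Matrix.fromRows 1 0).submatrix finSumFinEquiv.symm (Equiv.refl (Fin n)) := by
      refine Matrix.ext fun i j => ?_
      obtain ⟨i, rfl⟩ := finSumFinEquiv.surjective i
      rcases i with i | i
      · simp [incl, Matrix.one_apply, Fin.ext_iff]
      · simp [incl]
        omega
    have h2 : proj B n (n + k) =
        (Matrix.fromCols 1 0).submatrix (Equiv.refl (Fin n)) finSumFinEquiv.symm := by
      refine Matrix.ext fun i j => ?_
      obtain ⟨j, rfl⟩ := finSumFinEquiv.surjective j
      rcases j with j | j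
      · simp [proj, Matrix.one_apply, Fin.ext_iff]
      · simp [proj]
        omega
    have h3 : u.val - 1 = (u.val - 1).submatrix (Equiv.refl (Fin n)) (Equiv.refl (Fin n)) := by
      simp
    rw [h1, h2, h3, Matrix.submatrix_mul_equiv, Matrix.submatrix_mul_equiv,
      ← Matrix.submatrix_one_equiv finSumFinEquiv.symm, ← Matrix.fromBlocks_one]
    have h4 : ∀ X Y : Matrix (Fin n ⊕ Fin k) (Fin n ⊕ Fin k) B,
      X.submatrix finSumFinEquiv.symm finSumFinEquiv.symm +
      Y.submatrix finSumFinEquiv.symm finSumFinEquiv.symm =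
      (X + Y).submatrix finSumFinEquiv.symm finSumFinEquiv.symm := fun X Y => rfl
    rw [h4]
    congr 1
    rw [Matrix.fromRows_mul, Matrix.fromRows_mul]
    refine Matrix.ext fun i j => ?_
    rcases i with i | i <;> rcases j with j | j <;> simp [Matrix.one_apply]
  rw [e, index_reindexUnit, index_blockUnit, index_one, add_zero]

end IndexMap

section IndexMap

variable {A B : Type} [Ring A] [Ring B] [Algebra ℂ A] [Algebra ℂ B]
  [TopologicalSpace A] [IsTopologicalRing A] [TopologicalSpace B] [IsTopologicalRing B]

/-- The invertible elements of the matrix algebras `M_n(A)` form open sets, as they do for a Banach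
algebra `A`. -/
def MatrixUnitsOpen (A : Type) [Ring A] [TopologicalSpace A] : Prop :=
  ∀ n : ℕ, IsOpen {x : Matrix (Fin n) (Fin n) A | IsUnit x}

theorem exists_lift_of_mem_idComp (π : A →ₐ[ℂ] B) (hπ : Function.Surjective π) (ho : IsOpenMap π)
    (hA : MatrixUnitsOpen A) {n : ℕ} {u : InvMatrix n B} (hu : u ∈ IdComp B n) :
    ∃ a : InvMatrix n A, mapUnit π a = u := by
  have hopen : IsOpen ((mapUnit π : InvMatrix n A →* InvMatrix n B).range : Set (InvMatrix n B)) := by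
    have hm : IsOpenMap (fun x : Matrix (Fin n) (Fin n) A => x.map π) :=
      IsOpenMap.piMap (fun _ => IsOpenMap.piMap (fun _ => ho) (by simp [hπ])) (by
        refine Filter.Eventually.of_forall fun _ g => ?_
        choose f hf using fun i => hπ (g i)
        exact ⟨f, funext hf⟩)
    have : ((mapUnit π : InvMatrix n A →* InvMatrix n B).range : Set (InvMatrix n B)) =
        (fun u : InvMatrix n B => u.val) ⁻¹'
          ((fun x : Matrix (Fin n) (Fin n) A => x.map π) '' {x | IsUnit x}) := by
      ext v
      constructor
      · rintro ⟨a, rfl⟩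
        exact ⟨a.val, a.isUnit, rfl⟩
      · rintro ⟨_, ⟨a, rfl⟩, h⟩
        exact ⟨a, Units.ext h⟩
    rw [this]
    exact (hm _ (hA n)).preimage Units.continuous_val
  have hclopen : IsClopen ((mapUnit π : InvMatrix n A →* InvMatrix n B).range :
      Set (InvMatrix n B)) := ⟨Subgroup.isClosed_of_isOpen _ hopen, hopen⟩
  exact hclopen.connectedComponent_subset (one_mem _) hu

/-- The index map on `GL_n(B)`, as a group homomorphism. -/
noncomputable def indexHom (π : A →ₐ[ℂ] B) (hπ : Function.Surjective π) (n : ℕ) :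
    InvMatrix n B →* Multiplicative (KZero (kerAlg π)) where
  toFun u := Multiplicative.ofAdd (index π hπ u)
  map_one' := by rw [index_one]; rfl
  map_mul' u v := by rw [index_mul]; rfl

/-- The index map on `GL_n(B) / GL_n(B)₀`. -/
noncomputable def indexQuot (π : A →ₐ[ℂ] B) (hπ : Function.Surjective π) (ho : IsOpenMap π)
    (hA : MatrixUnitsOpen A) (n : ℕ) : CompGroup B n →* Multiplicative (KZero (kerAlg π)) :=
  QuotientGroup.lift (IdComp B n) (indexHom π hπ n) (fun u hu => by
    obtain ⟨a, ha⟩ := exists_lift_of_mem_idComp π hπ ho hA hu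
    have := index_congr π hπ 1 u a (by rw [ha]; simp)
    rw [index_one] at this
    change Multiplicative.ofAdd (index π hπ u) = 1
    rw [← this]
    rfl)

/-- The index map `δ₁ : K₁(B) → K₀(J)` of the exact sequence `0 → J → A → B → 0`, where `J` is the
kernel of `π : A → B`. It sends the class of `u ∈ GL_n(B)` to `[w p w⁻¹]₀ - [p]₀`, where
`p = diag(1, 0)` and `w ∈ GL_{2n}(A)` is any lift of `diag(u, u⁻¹)`. -/
noncomputable def indexMap (π : A →ₐ[ℂ] B) (hπ : Function.Surjective π) (ho : IsOpenMap π)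
    (hA : MatrixUnitsOpen A) : KOne B →+ KZero (kerAlg π) where
  toFun x := Multiplicative.toAdd (DirectLimit.lift (padQuot B) (fun n => indexQuot π hπ ho hA n)
    (fun n N h x => by
      obtain ⟨u, rfl⟩ := QuotientGroup.mk_surjective x
      exact congrArg Multiplicative.ofAdd (index_pad π hπ h u).symm) x.toMul)
  map_zero' := by
    have := DirectLimit.lift_one (f := padQuot B) (fun n => indexQuot π hπ ho hA n)
      (fun n N h x => by
      obtain ⟨u, rfl⟩ := QuotientGroup.mk_surjective x
      exact congrArg Multiplicative.ofAdd (index_pad π hπ h u).symm)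
    exact this
  map_add' x y := by
    have := DirectLimit.lift_mul (f := padQuot B) (fun n => indexQuot π hπ ho hA n)
      (fun n N h x => by
      obtain ⟨u, rfl⟩ := QuotientGroup.mk_surjective x
      exact congrArg Multiplicative.ofAdd (index_pad π hπ h u).symm) x.toMul y.toMul
    exact this

theorem indexMap_mk (π : A →ₐ[ℂ] B) (hπ : Function.Surjective π) (ho : IsOpenMap π)
    (hA : MatrixUnitsOpen A) {n : ℕ} (u x : InvMatrix n B)
    (w : (Matrix (Fin n ⊕ Fin n) (Fin n ⊕ Fin n) A)ˣ) (hw : mapUnit π w = blockUnit u x) :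
    indexMap π hπ ho hA (KOne.mk u) = liftClass π w u x hw :=
  index_eq_liftClass π hπ u x w hw

end IndexMap

section Quotients

open scoped Matrix.Norms.Operator in
theorem matrixUnitsOpen_of_complete {A : Type} [NormedRing A] [CompleteSpace A] :
    MatrixUnitsOpen A := by
  intro n
  have : @CompleteSpace (Matrix (Fin n) (Fin n) A) PseudoMetricSpace.toUniformSpace :=
    inferInstanceAs (CompleteSpace (Fin n → Fin n → A))
  exact Units.isOpen

theorem matrixUnitsOpen_of_surjective {A B : Type} [Ring A] [Ring B] [TopologicalSpace A]
    [TopologicalSpace B] [IsTopologicalRing B] (π : A →+* B) (hπ : Function.Surjective π)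
    (ho : IsOpenMap π) (hA : MatrixUnitsOpen A) : MatrixUnitsOpen B := by
  intro n
  have hm : IsOpenMap (fun x : Matrix (Fin n) (Fin n) A => x.map π) :=
    IsOpenMap.piMap (fun _ => IsOpenMap.piMap (fun _ => ho) (by simp [hπ])) (by
      refine Filter.Eventually.of_forall fun _ g => ?_
      choose f hf using fun i => hπ (g i)
      exact ⟨f, funext hf⟩)
  rw [isOpen_iff_mem_nhds]
  rintro _ ⟨y, rfl⟩
  have h1 : IsOpen ((fun x : Matrix (Fin n) (Fin n) B => x * y⁻¹.val) ⁻¹'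
      ((fun x : Matrix (Fin n) (Fin n) A => x.map π) '' {x | IsUnit x})) :=
    (hm _ (hA n)).preimage (by fun_prop)
  refine Filter.mem_of_superset (h1.mem_nhds ⟨1, isUnit_one, by simp⟩) ?_
  rintro x ⟨a, ha, hx⟩
  have h2 : IsUnit (x * y⁻¹.val) := by
    have hx' : a.map π = x * y⁻¹.val := hx
    rw [← hx']
    exact ha.map (π.mapMatrix : Matrix (Fin n) (Fin n) A →+* _)
  have h3 := h2.mul y.isUnit
  rwa [mul_assoc, Units.inv_mul, mul_one] at h3

variable {R : Type} [Ring R] [TopologicalSpace R] [IsTopologicalRing R]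

theorem isOpenQuotientMap_mk (I : Ideal R) [I.IsTwoSided] : IsOpenQuotientMap (Ideal.Quotient.mk I) :=
  QuotientAddGroup.isOpenQuotientMap_mk

instance (I : Ideal R) [I.IsTwoSided] : IsTopologicalRing (R ⧸ I) where
  __ := QuotientAddGroup.instIsTopologicalAddGroup _
  continuous_mul := by
    have := ((isOpenQuotientMap_mk I).prodMap (isOpenQuotientMap_mk I)).isQuotientMap
    refine this.continuous_iff.2 ?_
    exact (isOpenQuotientMap_mk I).continuous.comp continuous_mul

end Quotients

end KTheory

namespace PsiDO

open MeasureTheory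
open scoped ENNReal FourierTransform

section MulOp

variable {α : Type} [MeasurableSpace α] (μ : Measure α)

/-- The operator on `L²(μ)` of multiplication by an essentially bounded function. -/
noncomputable def mulOp (f : α → ℂ) (hf : MemLp f ∞ μ) : Lp ℂ 2 μ →L[ℂ] Lp ℂ 2 μ :=
  (ContinuousLinearMap.mul ℂ ℂ).holderL μ ∞ 2 2 (hf.toLp f)

variable {μ}

theorem mulOp_coeFn {f : α → ℂ} (hf : MemLp f ∞ μ) (u : Lp ℂ 2 μ) :
    mulOp μ f hf u =ᵐ[μ] fun x => f x * u x := by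
  have h1 := (ContinuousLinearMap.mul ℂ ℂ).coeFn_holder (r := 2) (hf.toLp f) u
  filter_upwards [h1, hf.coeFn_toLp] with x h1 h2
  rw [← h2]
  exact h1

theorem mulOp_mul {f g : α → ℂ} (hf : MemLp f ∞ μ) (hg : MemLp g ∞ μ)
    (hfg : MemLp (fun x => f x * g x) ∞ μ) :
    mulOp μ f hf * mulOp μ g hg = mulOp μ (fun x => f x * g x) hfg := by
  ext u
  filter_upwards [mulOp_coeFn hf (mulOp μ g hg u), mulOp_coeFn hg u, mulOp_coeFn hfg u]
    with x h1 h2 h3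
  change (mulOp μ f hf (mulOp μ g hg u)) x = _
  rw [h1, h2, h3, mul_assoc]

theorem mulOp_add {f g : α → ℂ} (hf : MemLp f ∞ μ) (hg : MemLp g ∞ μ)
    (hfg : MemLp (fun x => f x + g x) ∞ μ) :
    mulOp μ f hf + mulOp μ g hg = mulOp μ (fun x => f x + g x) hfg := by
  ext u
  filter_upwards [mulOp_coeFn hf u, mulOp_coeFn hg u, mulOp_coeFn hfg u,
    Lp.coeFn_add (mulOp μ f hf u) (mulOp μ g hg u)] with x h1 h2 h3 h4
  change (mulOp μ f hf u + mulOp μ g hg u : Lp ℂ 2 μ) x = _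
  rw [h4, Pi.add_apply, h1, h2, h3, add_mul]

theorem mulOp_const (c : ℂ) (hf : MemLp (fun _ : α => c) ∞ μ) :
    mulOp μ (fun _ => c) hf = c • (1 : Lp ℂ 2 μ →L[ℂ] Lp ℂ 2 μ) := by
  ext u
  filter_upwards [mulOp_coeFn hf u, Lp.coeFn_smul c u] with x h1 h2
  change _ = (c • u : Lp ℂ 2 μ) x
  rw [h1, h2, Pi.smul_apply, smul_eq_mul]

theorem mulOp_star {f : α → ℂ} (hf : MemLp f ∞ μ)
    (hf' : MemLp (fun x => (starRingEnd ℂ) (f x)) ∞ μ) :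
    star (mulOp μ f hf) = mulOp μ (fun x => (starRingEnd ℂ) (f x)) hf' := by
  symm
  rw [ContinuousLinearMap.star_eq_adjoint, ContinuousLinearMap.eq_adjoint_iff]
  intro u v
  rw [L2.inner_def, L2.inner_def]
  refine integral_congr_ae ?_
  filter_upwards [mulOp_coeFn hf v, mulOp_coeFn hf' u] with x h1 h2
  rw [h1, h2]
  simp only [RCLike.inner_apply, map_mul, Complex.conj_conj]
  ring

end MulOp

/-- The Hilbert space `L²(ℝ)`. -/
abbrev L2R : Type := Lp ℂ 2 (volume : Measure ℝ)

/-- A continuous function on `[-∞, +∞]` restricts to a bounded function on `ℝ`. -/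
theorem memLp_ereal (a : C(EReal, ℂ)) (t : ℝ) :
    MemLp (fun x : ℝ => a ((t * x : ℝ) : EReal)) ∞ (volume : Measure ℝ) := by
  refine memLp_top_of_bound (C := ‖a‖) ?_ (Filter.Eventually.of_forall fun x => a.norm_coe_le_norm _)
  exact (Continuous.aestronglyMeasurable (by
    exact a.continuous.comp (continuous_coe_real_ereal.comp (continuous_const.mul continuous_id))))

theorem memLp_periodic (p : C(Circle, ℂ)) :
    MemLp (fun x : ℝ => p (Circle.exp x)) ∞ (volume : Measure ℝ) := by
  refine memLp_top_of_bound (C := ‖p‖) ?_ (Filter.Eventually.of_forall fun x => p.norm_coe_le_norm _)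
  exact (p.continuous.comp Circle.exp.continuous).aestronglyMeasurable

/-- The multiplication operator `a(M)` on `L²(ℝ)`, for `a ∈ C[-∞, +∞]`. -/
noncomputable def multOp (a : C(EReal, ℂ)) : L2R →L[ℂ] L2R :=
  mulOp volume (fun x : ℝ => a x) (by simpa using memLp_ereal a 1)

/-- The operator on `L²(ℝ)` of multiplication by the continuous `2π`-periodic function
`x ↦ p(e^{ix})`, for `p ∈ C(S¹)`. Every continuous `2π`-periodic function on `ℝ` is of this form. -/
noncomputable def periodicOp (p : C(Circle, ℂ)) : L2R →L[ℂ] L2R :=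
  mulOp volume (fun x : ℝ => p (Circle.exp x)) (memLp_periodic p)

/-- The Fourier multiplier `b(D) = F⁻¹ b(M) F` on `L²(ℝ)`, `b ∈ C[-∞, +∞]`, where `F` is the
Fourier transform `(F u)(ξ) = (2π)^(-1/2) ∫ e^{-ixξ} u(x) dx`. Since the Fourier transform `𝓕` of
the library is `(𝓕 u)(ξ) = ∫ e^{-2πixξ} u(x) dx`, this is `𝓕⁻¹ b(2π M) 𝓕`. -/
noncomputable def fourierOp (b : C(EReal, ℂ)) : L2R →L[ℂ] L2R :=
  (Lp.fourierTransformₗᵢ ℝ ℂ).symm.toContinuousLinearEquiv.toContinuousLinearMap ∘L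
    mulOp volume (fun ξ : ℝ => b ((2 * Real.pi * ξ : ℝ) : EReal)) (memLp_ereal b (2 * Real.pi)) ∘L
    (Lp.fourierTransformₗᵢ ℝ ℂ).toContinuousLinearEquiv.toContinuousLinearMap

/-- The C*-algebra `𝔄` of operators on `L²(ℝ)` generated by the operators `a(M)` and `b(D)`, for
`a, b ∈ C[-∞, +∞]`, and by the multiplications by continuous `2π`-periodic functions. -/
noncomputable def algA : StarSubalgebra ℂ (L2R →L[ℂ] L2R) :=
  (StarAlgebra.adjoin ℂ
    (Set.range multOp ∪ Set.range periodicOp ∪ Set.range fourierOp)).topologicalClosure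

instance isClosed_algA : IsClosed (algA : Set (L2R →L[ℂ] L2R)) :=
  StarSubalgebra.isClosed_topologicalClosure _

noncomputable instance : CStarAlgebra algA := StarSubalgebra.cstarAlgebra algA

noncomputable instance : NormedRing algA := inferInstance

instance : IsTopologicalRing algA := inferInstance

theorem multOp_mem (a : C(EReal, ℂ)) : multOp a ∈ algA :=
  StarSubalgebra.le_topologicalClosure _
    (StarAlgebra.subset_adjoin ℂ _ (Or.inl (Or.inl ⟨a, rfl⟩)))

theorem periodicOp_mem (p : C(Circle, ℂ)) : periodicOp p ∈ algA :=
  StarSubalgebra.le_topologicalClosure _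
    (StarAlgebra.subset_adjoin ℂ _ (Or.inl (Or.inr ⟨p, rfl⟩)))

theorem fourierOp_mem (b : C(EReal, ℂ)) : fourierOp b ∈ algA :=
  StarSubalgebra.le_topologicalClosure _
    (StarAlgebra.subset_adjoin ℂ _ (Or.inr ⟨b, rfl⟩))

/-- The Hilbert space `ℓ²(ℤ)`. -/
abbrev L2Z : Type := lp (fun _ : ℤ => ℂ) 2

/-- The algebra `𝔅` of bounded operators on `ℓ²(ℤ)`. -/
abbrev algB : Type := L2Z →L[ℂ] L2Z

noncomputable instance : CStarAlgebra algB := inferInstance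

noncomputable instance : NormedRing algB := inferInstance

instance : IsTopologicalRing algB := inferInstance

noncomputable instance : NormedAlgebra ℂ algB := inferInstance

noncomputable instance : Ring C(Circle × ℤˣ, algB) := inferInstance

noncomputable instance : StarRing C(Circle × ℤˣ, algB) := inferInstance

noncomputable instance : Algebra ℂ C(Circle × ℤˣ, algB) := inferInstance

theorem memLp_cpow (φ : ℝ) :
    MemLp (fun x : UnitAddCircle => ((AddCircle.toCircle x : Circle) : ℂ) ^ (-(φ : ℂ))) ∞
      AddCircle.haarAddCircle := by
  refine memLp_top_of_bound (C := 1) ?_ (Filter.Eventually.of_forall fun x => ?_)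
  · refine Measurable.aestronglyMeasurable ?_
    have : Measurable fun x : UnitAddCircle => ((AddCircle.toCircle x : Circle) : ℂ) :=
      (continuous_subtype_val.comp AddCircle.continuous_toCircle).measurable
    exact this.pow_const _
  · rw [← Complex.ofReal_neg, Complex.norm_cpow_real, Circle.norm_coe, Real.one_rpow]

/-- The unitary operator `U_φ` on `L²(S¹)`, `(U_φ f)(z) = z^{-φ} f(z)`, where `z^{-φ}` is defined by
the principal branch; `S¹` is parametrized by `z = e^{2πix}`, `x ∈ ℝ/ℤ`. -/
noncomputable def opU (φ : ℝ) :
    Lp ℂ 2 (AddCircle.haarAddCircle (T := 1)) →L[ℂ] Lp ℂ 2 (AddCircle.haarAddCircle (T := 1)) :=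
  mulOp AddCircle.haarAddCircle
    (fun x : UnitAddCircle => ((AddCircle.toCircle x : Circle) : ℂ) ^ (-(φ : ℂ))) (memLp_cpow φ)

/-- The discrete Fourier transform `L²(S¹) → ℓ²(ℤ)`, mapping `f` to its Fourier coefficients. -/
noncomputable abbrev discreteFourier :
    Lp ℂ 2 (AddCircle.haarAddCircle (T := 1)) ≃ₗᵢ[ℂ] L2Z := fourierBasis.repr

/-- The operator `Y_φ` on `ℓ²(ℤ)` obtained by conjugating `U_φ` with the discrete Fourier
transform. -/
noncomputable def opY (φ : ℝ) : algB :=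
  discreteFourier.toContinuousLinearEquiv.toContinuousLinearMap ∘L opU φ ∘L
    discreteFourier.symm.toContinuousLinearEquiv.toContinuousLinearMap

theorem memlp_mul {c : ℤ → ℂ} {C : ℝ} (hc : ∀ j, ‖c j‖ ≤ C) (a : L2Z) :
    Memℓp (fun j => c j * a j) 2 := by
  refine ((lp.memℓp a).norm.const_mul C).mono fun j => ?_
  rw [norm_mul]
  exact mul_le_mul_of_nonneg_right (hc j) (norm_nonneg _)

/-- The diagonal operator `(a_j) ↦ (c_j a_j)` on `ℓ²(ℤ)`, for a bounded sequence `c`. -/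
noncomputable def diagOp (c : ℤ → ℂ) (C : ℝ) (hc : ∀ j, ‖c j‖ ≤ C) : algB :=
  LinearMap.mkContinuous
    { toFun := fun a => (⟨fun j => c j * a j, memlp_mul hc a⟩ : L2Z)
      map_add' := fun a b => by
        ext j
        exact mul_add (c j) (a j) (b j)
      map_smul' := fun r a => by
        ext j
        exact mul_left_comm (c j) r (a j) } C (fun a => by
    have hC : 0 ≤ C := (norm_nonneg _).trans (hc 0)
    have h2 : ‖(C : ℂ) • a‖ = C * ‖a‖ := by
      rw [norm_smul, Complex.norm_real, Real.norm_of_nonneg hC]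
    rw [← h2]
    refine lp.norm_mono two_ne_zero fun j => ?_
    change ‖c j * a j‖ ≤ ‖(C : ℂ) * a j‖
    rw [norm_mul, norm_mul, Complex.norm_real, Real.norm_of_nonneg hC]
    exact mul_le_mul_of_nonneg_right (hc j) (norm_nonneg _))

/-- The operator `M^b_φ` on `ℓ²(ℤ)`, mapping `(a_j)` to `(b(j - φ) a_j)`. -/
noncomputable def opM (b : C(EReal, ℂ)) (φ : ℝ) : algB :=
  diagOp (fun j : ℤ => b (((j : ℝ) - φ : ℝ) : EReal)) ‖b‖ fun _ => b.norm_coe_le_norm _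

/-- The function `e_k` on the circle; `e_k(e^{ix}) = e^{ikx}`. -/
noncomputable def circlePow (k : ℤ) : C(Circle, ℂ) where
  toFun z := ((z ^ k : Circle) : ℂ)
  continuous_toFun := continuous_subtype_val.comp (continuous_zpow k)

/-- The points `+∞` and `-∞` of `[-∞, +∞]`, indexed by the signs `1` and `-1`. -/
noncomputable def endpoint (s : ℤˣ) : EReal := if s = 1 then ⊤ else ⊥

/-- The set `X` of all `(x, e^{iθ})` in `[-∞, +∞] × S¹` such that `|x| = ∞` or `x = θ ∈ ℝ`. -/
def spaceX : Set (EReal × Circle) :=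
  {m | m.1 = ⊤ ∨ m.1 = ⊥ ∨ ∃ θ : ℝ, m.1 = (θ : EReal) ∧ m.2 = Circle.exp θ}

theorem isClosed_spaceX : IsClosed spaceX := by
  have ho : IsOpen {x : EReal | x ≠ ⊤ ∧ x ≠ ⊥} :=
    (isOpen_ne).inter isOpen_ne
  have h1 : spaceXᶜ = {m : EReal × Circle | m.1 ∈ {x : EReal | x ≠ ⊤ ∧ x ≠ ⊥}} ∩
      (fun m : EReal × Circle => (m.2, Circle.exp m.1.toReal)) ⁻¹' {q | q.1 ≠ q.2} := by
    ext ⟨x, z⟩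
    induction x with
    | bot => simp [spaceX]
    | top => simp [spaceX]
    | coe t =>
      simp only [spaceX, Set.mem_compl_iff, Set.mem_ofPred_eq, EReal.coe_ne_top, EReal.coe_ne_bot,
        false_or, not_exists, not_and, Set.mem_inter_iff, Set.mem_preimage, EReal.toReal_coe,
        ne_eq, not_false_eq_true, and_self, true_and, EReal.coe_eq_coe_iff]
      exact ⟨fun h => h t rfl, fun h s hs => hs ▸ h⟩
  rw [← isOpen_compl_iff, h1]
  refine ContinuousOn.isOpen_inter_preimage ?_ (ho.preimage continuous_fst)
    (isOpen_ne_fun continuous_fst continuous_snd)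
  refine ContinuousOn.prodMk continuousOn_snd (Circle.exp.continuous.comp_continuousOn ?_)
  refine EReal.continuousOn_toReal.comp continuousOn_fst ?_
  rintro ⟨x, z⟩ ⟨h, h'⟩
  simpa using ⟨h', h⟩

instance : CompactSpace spaceX := isCompact_iff_compactSpace.1 isClosed_spaceX.isCompact

/-- The properties characterizing the principal symbol
`σ : 𝔄 → C(X × {-∞, +∞})`; `{-∞, +∞}` is indexed by the signs `-1`, `1`. -/
structure IsPrincipalSymbol (σ : algA →⋆ₐ[ℂ] C(spaceX × ℤˣ, ℂ)) : Prop where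
  mult : ∀ (a : C(EReal, ℂ)) (m : spaceX) (s : ℤˣ), σ ⟨multOp a, multOp_mem a⟩ (m, s) = a m.1.1
  periodic : ∀ (p : C(Circle, ℂ)) (m : spaceX) (s : ℤˣ),
    σ ⟨periodicOp p, periodicOp_mem p⟩ (m, s) = p m.1.2
  fourier : ∀ (b : C(EReal, ℂ)) (m : spaceX) (s : ℤˣ),
    σ ⟨fourierOp b, fourierOp_mem b⟩ (m, s) = b (endpoint s)

/-- The properties characterizing the boundary principal symbol
`γ : 𝔄 → C(S*S¹, 𝔅)`, where `S*S¹ = S¹ × {-1, +1}`. -/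
structure IsBoundarySymbol (γ : algA →⋆ₐ[ℂ] C(Circle × ℤˣ, algB)) : Prop where
  mult : ∀ (a : C(EReal, ℂ)) (z : Circle) (s : ℤˣ),
    γ ⟨multOp a, multOp_mem a⟩ (z, s) = a (endpoint s) • (1 : algB)
  periodic : ∀ (k : ℤ) (z : Circle) (s : ℤˣ),
    γ ⟨periodicOp (circlePow k), periodicOp_mem _⟩ (z, s) = opY (-k)
  fourier : ∀ (b : C(EReal, ℂ)) (φ : ℝ) (s : ℤˣ),
    γ ⟨fourierOp b, fourierOp_mem b⟩ (Circle.exp (2 * Real.pi * φ), s) =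
      opY φ * opM b φ * opY (-φ)

/-- Multiplication by periodic functions, as a homomorphism `C(S¹) → 𝔄`. -/
noncomputable def periodicHom : C(Circle, ℂ) →⋆ₐ[ℂ] algA where
  toFun p := ⟨periodicOp p, periodicOp_mem p⟩
  map_one' := Subtype.ext ((mulOp_const 1 _).trans (one_smul _ _))
  map_mul' _ _ := Subtype.ext (mulOp_mul _ _ _).symm
  map_zero' := Subtype.ext ((mulOp_const 0 _).trans (zero_smul _ _))
  map_add' _ _ := Subtype.ext (mulOp_add _ _ _).symm
  commutes' c := Subtype.ext (mulOp_const c _)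
  map_star' _ := Subtype.ext (mulOp_star _ _).symm

theorem circle_hom_ext {B : Type} [CStarAlgebra B] {f g : C(Circle, ℂ) →⋆ₐ[ℂ] B}
    (h : ∀ k, f (circlePow k) = g (circlePow k)) : f = g := by
  have hf : Continuous f := AddMonoidHomClass.continuous_of_bound f 1 fun a => by
    rw [one_mul]
    exact NonUnitalStarAlgHom.norm_apply_le f a
  have hg : Continuous g := AddMonoidHomClass.continuous_of_bound g 1 fun a => by
    rw [one_mul]
    exact NonUnitalStarAlgHom.norm_apply_le g a
  have h1 : (StarAlgebra.adjoin ℂ {circlePow 1}).topologicalClosure = ⊤ := by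
    refine ContinuousMap.starSubalgebra_topologicalClosure_eq_top_of_separatesPoints _ ?_
    intro x y hxy
    refine ⟨_, ⟨circlePow 1, StarAlgebra.subset_adjoin ℂ _ rfl, rfl⟩, fun h => hxy ?_⟩
    have h' : ((x ^ (1 : ℤ) : Circle) : ℂ) = ((y ^ (1 : ℤ) : Circle) : ℂ) := h
    rw [zpow_one, zpow_one] at h'
    exact Circle.ext h'
  have h2 : (StarAlgebra.adjoin ℂ {circlePow 1}).topologicalClosure ≤ StarAlgHom.equalizer f g :=
    StarSubalgebra.topologicalClosure_minimal
      (StarAlgebra.adjoin_le (by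
        rintro _ rfl
        exact h 1)) (isClosed_eq hf hg)
  rw [h1] at h2
  exact StarAlgHom.ext fun x => h2 (by trivial : x ∈ (⊤ : StarSubalgebra ℂ C(Circle, ℂ)))

/-- Star homomorphisms on `𝔄` that agree on the generators are equal. -/
theorem algA_hom_ext {B : Type} [CStarAlgebra B] {f g : algA →⋆ₐ[ℂ] B}
    (h1 : ∀ a, f ⟨multOp a, multOp_mem a⟩ = g ⟨multOp a, multOp_mem a⟩)
    (h2 : ∀ k, f ⟨periodicOp (circlePow k), periodicOp_mem _⟩ =
      g ⟨periodicOp (circlePow k), periodicOp_mem _⟩)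
    (h3 : ∀ b, f ⟨fourierOp b, fourierOp_mem b⟩ = g ⟨fourierOp b, fourierOp_mem b⟩) : f = g := by
  have hp : ∀ p, f ⟨periodicOp p, periodicOp_mem p⟩ = g ⟨periodicOp p, periodicOp_mem p⟩ := by
    have := circle_hom_ext (f := f.comp periodicHom) (g := g.comp periodicHom) h2
    exact fun p => DFunLike.congr_fun this p
  have hf : Continuous f := AddMonoidHomClass.continuous_of_bound f 1 fun a => by
    rw [one_mul]
    exact NonUnitalStarAlgHom.norm_apply_le f a
  have hg : Continuous g := AddMonoidHomClass.continuous_of_bound g 1 fun a => by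
    rw [one_mul]
    exact NonUnitalStarAlgHom.norm_apply_le g a
  refine StarAlgHom.ext_topologicalClosure hf hg (StarAlgHom.ext_adjoin ?_)
  rintro ⟨x, hx⟩ ((⟨a, rfl⟩ | ⟨p, rfl⟩) | ⟨b, rfl⟩)
  · exact h1 a
  · exact hp p
  · exact h3 b

/-- There is at most one principal symbol. -/
theorem IsPrincipalSymbol.unique {σ τ : algA →⋆ₐ[ℂ] C(spaceX × ℤˣ, ℂ)}
    (hσ : IsPrincipalSymbol σ) (hτ : IsPrincipalSymbol τ) : σ = τ :=
  algA_hom_ext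
    (fun a => ContinuousMap.ext fun v => (hσ.mult a v.1 v.2).trans (hτ.mult a v.1 v.2).symm)
    (fun k => ContinuousMap.ext fun v =>
      (hσ.periodic (circlePow k) v.1 v.2).trans (hτ.periodic (circlePow k) v.1 v.2).symm)
    (fun b => ContinuousMap.ext fun v => (hσ.fourier b v.1 v.2).trans (hτ.fourier b v.1 v.2).symm)

/-- There is at most one boundary principal symbol. -/
theorem IsBoundarySymbol.unique {γ τ : algA →⋆ₐ[ℂ] C(Circle × ℤˣ, algB)}
    (hγ : IsBoundarySymbol γ) (hτ : IsBoundarySymbol τ) : γ = τ :=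
  algA_hom_ext
    (fun a => ContinuousMap.ext fun v => (hγ.mult a v.1 v.2).trans (hτ.mult a v.1 v.2).symm)
    (fun k => ContinuousMap.ext fun v => (hγ.periodic k v.1 v.2).trans (hτ.periodic k v.1 v.2).symm)
    (fun b => ContinuousMap.ext fun v => by
      obtain ⟨z, s⟩ := v
      obtain ⟨φ, rfl⟩ : ∃ φ : ℝ, Circle.exp (2 * Real.pi * φ) = z :=
        ⟨Complex.arg z / (2 * Real.pi), by
          rw [mul_div_cancel₀ _ (by positivity), Circle.exp_arg]⟩
      exact (hγ.fourier b φ s).trans (hτ.fourier b φ s).symm)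

/-- The ideal of compact operators `𝔎_ℝ` of `𝔄`. -/
noncomputable def idealK : Ideal algA where
  carrier := {A | IsCompactOperator A.1}
  zero_mem' := isCompactOperator_zero
  add_mem' := fun ha hb => IsCompactOperator.add ha hb
  smul_mem' := fun c _ ha => IsCompactOperator.clm_comp ha c.1

instance : idealK.IsTwoSided where
  mul_mem_of_left := fun b ha => IsCompactOperator.comp_clm ha b.1

/-- The algebra `𝔎_ℤ` of compact operators on `ℓ²(ℤ)`. -/
noncomputable def algK : NonUnitalSubalgebra ℂ algB where
  carrier := {T | IsCompactOperator T}
  zero_mem' := isCompactOperator_zero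
  add_mem' := fun ha hb => IsCompactOperator.add ha hb
  mul_mem' := fun {_ _} _ hb => IsCompactOperator.clm_comp hb _
  smul_mem' := fun c _ ha => IsCompactOperator.smul ha c

/-- The index of an operator `T`, `dim ker T - dim (H / im T)`. -/
noncomputable def fredholmIndex (T : algB) : ℤ :=
  (Module.finrank ℂ T.ker : ℤ) - Module.finrank ℂ (L2Z ⧸ T.range)

section Delta

variable (σ : algA →⋆ₐ[ℂ] C(spaceX × ℤˣ, ℂ)) (γ : algA →⋆ₐ[ℂ] C(Circle × ℤˣ, algB))

/-- The ideal `𝔈`, the kernel of the principal symbol. -/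
noncomputable def idealE : Ideal algA := RingHom.ker σ

instance : (idealE σ).IsTwoSided := inferInstanceAs (RingHom.ker σ).IsTwoSided

/-- The canonical projection `𝔄/𝔎_ℝ → 𝔄/𝔈`. -/
noncomputable def quotMap (hK : idealK ≤ idealE σ) : (algA ⧸ idealK) →ₐ[ℂ] (algA ⧸ idealE σ) :=
  Ideal.Quotient.factorₐ ℂ hK

theorem quotMap_surjective (hK : idealK ≤ idealE σ) : Function.Surjective (quotMap σ hK) :=
  Ideal.Quotient.factor_surjective hK

theorem isOpenMap_quotMap (hK : idealK ≤ idealE σ) : IsOpenMap (quotMap σ hK) := by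
  intro U hU
  have h1 : quotMap σ hK '' U =
      Ideal.Quotient.mk (idealE σ) '' (Ideal.Quotient.mk idealK ⁻¹' U) := by
    ext y
    constructor
    · rintro ⟨x, hx, rfl⟩
      obtain ⟨A, rfl⟩ := Ideal.Quotient.mk_surjective x
      exact ⟨A, hx, rfl⟩
    · rintro ⟨A, hA, rfl⟩
      exact ⟨Ideal.Quotient.mk idealK A, hA, rfl⟩
  rw [h1]
  exact (KTheory.isOpenQuotientMap_mk (idealE σ)).isOpenMap _
    (hU.preimage (KTheory.isOpenQuotientMap_mk idealK).continuous)

theorem matrixUnitsOpen_quot : KTheory.MatrixUnitsOpen (algA ⧸ idealK) :=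
  KTheory.matrixUnitsOpen_of_surjective (Ideal.Quotient.mk idealK) Ideal.Quotient.mk_surjective
    (KTheory.isOpenQuotientMap_mk idealK).isOpenMap KTheory.matrixUnitsOpen_of_complete

/-- The index map `K₁(𝔄/𝔈) → K₀(𝔈/𝔎_ℝ)` of `0 → 𝔈/𝔎_ℝ → 𝔄/𝔎_ℝ → 𝔄/𝔈 → 0`. -/
noncomputable def indexMapE (hK : idealK ≤ idealE σ) :
    KTheory.KOne (algA ⧸ idealE σ) →+ KTheory.KZero (KTheory.kerAlg (quotMap σ hK)) :=
  KTheory.indexMap (quotMap σ hK) (quotMap_surjective σ hK) (isOpenMap_quotMap σ hK)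
    matrixUnitsOpen_quot

/-- The homomorphism `𝔄/𝔎_ℝ → C(S*S¹, 𝔅)` induced by `γ`. -/
noncomputable def gammaQuot (hγ : idealK ≤ RingHom.ker γ) :
    (algA ⧸ idealK) →ₐ[ℂ] C(Circle × ℤˣ, algB) :=
  Ideal.Quotient.liftₐ idealK (γ : algA →ₐ[ℂ] C(Circle × ℤˣ, algB)) (fun _ ha => hγ ha)

theorem gammaQuot_compact {hK : idealK ≤ idealE σ} {hγ : idealK ≤ RingHom.ker γ}
    (hE : ∀ A ∈ idealE σ, ∀ v, IsCompactOperator (γ A v))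
    (x : KTheory.kerAlg (quotMap σ hK)) (v : Circle × ℤˣ) : gammaQuot γ hγ x v ∈ algK := by
  obtain ⟨x, hx⟩ := x
  obtain ⟨A, rfl⟩ := Ideal.Quotient.mk_surjective x
  exact hE A (Ideal.Quotient.eq_zero_iff_mem.1 hx) v

/-- The homomorphism `𝔈/𝔎_ℝ → C(S*S¹, 𝔎_ℤ)` induced by `γ`. -/
noncomputable def gammaE (hK : idealK ≤ idealE σ) (hγ : idealK ≤ RingHom.ker γ)
    (hE : ∀ A ∈ idealE σ, ∀ v, IsCompactOperator (γ A v)) :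
    KTheory.kerAlg (quotMap σ hK) →ₙₐ[ℂ] C(Circle × ℤˣ, algK) where
  toFun x := ⟨fun v => ⟨gammaQuot γ hγ x v, gammaQuot_compact σ γ hE x v⟩,
    (gammaQuot γ hγ x).continuous.subtype_mk _⟩
  map_smul' c x := by
    ext v : 2
    simp
  map_zero' := by
    ext v : 2
    simp
  map_add' x y := by
    ext v : 2
    simp
  map_mul' x y := by
    ext v : 2
    simp

/-- Evaluation at the point `v`, `C(S*S¹, 𝔎_ℤ) → 𝔎_ℤ`. -/
noncomputable def evalAt (v : Circle × ℤˣ) : C(Circle × ℤˣ, algK) →ₙₐ[ℂ] algK where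
  toFun f := f v
  map_smul' _ _ := rfl
  map_zero' := rfl
  map_add' _ _ := rfl
  map_mul' _ _ := rfl

/-- The map `K₀(C(S*S¹, 𝔎_ℤ)) → K₀(𝔎_ℤ) ⊕ K₀(𝔎_ℤ)` induced by `ν(f) = (f(1, -1), f(1, 1))`. -/
noncomputable def nuStar :
    KTheory.KZero C(Circle × ℤˣ, algK) →+ KTheory.KZero algK × KTheory.KZero algK :=
  (KTheory.KZero.map (evalAt (1, -1))).prod (KTheory.KZero.map (evalAt (1, 1)))

/-- The index map `δ₁ : K₁(𝔄/𝔈) → K₀(𝔈/𝔎_ℝ)`, with `K₀(𝔈/𝔎_ℝ)` mapped to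
`K₀(C(S*S¹, 𝔎_ℤ))` by `γ`, and then to `K₀(𝔎_ℤ) ⊕ K₀(𝔎_ℤ)` by `ν`. -/
noncomputable def delta₁ (hK : idealK ≤ idealE σ) (hγ : idealK ≤ RingHom.ker γ)
    (hE : ∀ A ∈ idealE σ, ∀ v, IsCompactOperator (γ A v)) :
    KTheory.KOne (algA ⧸ idealE σ) →+ KTheory.KZero algK × KTheory.KZero algK :=
  nuStar.comp ((KTheory.KZero.map (gammaE σ γ hK hγ hE)).comp (indexMapE σ hK))

end Delta

end PsiDO

/-! Both symbols are limits along wave packets. Let V_n : H → L²(ℝ) be isometries with A V_n a − V_n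
T a → 0 for every a (`Intertwines`). Then ‖T‖ ≤ ‖A‖ (`Intertwines.norm_le`), so A determines T;
sums, products and norm limits pass from A to T, and so do adjoints when A* has a limit as well.
Given one such sequence for each point of a compact space P, the operators A for which A and A* have
a continuous symbol P → B(H) form a closed star algebra (`symbolDomain`). It contains 𝔄 as soon as
it contains the generators and their adjoints, and the symbol is then a *-homomorphism on 𝔄
(`symbolHom`).

For σ one takes H = ℂ and packets of width of order 1/(n+1) and frequency ±(n+1)²; over the points
at infinity their centres run off to ±∞ inside one residue class modulo 2π. For γ one takes H =
ℓ²(ℤ) and sends the j-th basis vector to a packet of frequency j − φ, width of order n+1 and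
position near ±2π(n+1)². Multiplication by e_k shifts j by k, while in the limit b(D) becomes the
diagonal b(j − φ) and a(M) the scalar a(±∞). Conjugation by Y_φ makes the result depend on e^{2πiφ}
alone. Compact operators have symbol zero because suitable cutoffs have symbol zero and tend
strongly to 1 (`Intertwines.eq_zero_of_compact`).

Modulo compacts, γ is determined by σ. Let P be the projection onto ℓ²(ℕ), L(f) the convolution
operator with symbol f, and f_± the restriction of σ_A to the circle over the endpoint in question,
at covariable ±∞. Then Y_{−φ} γ_A Y_φ − (L(f_+) P + L(f_−)(1 − P)) is compact
(`boundaryDefect_mem`): this is checked on generators and survives products because L(f) commutes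
with P modulo compacts. Hence γ_A is compact when σ_A = 0, and Fredholm when A is invertible modulo
𝔈.

For the index formula, naturality of the index map along 𝔄/𝔎_ℝ → 𝔅 replaces each component by the
extension of the Calkin algebra by 𝔎_ℤ (`map_indexMap_ofUnit`). A Fredholm operator T has S with TST
= T and STS = S; the block matrix w with rows (T, 1 − TS) and (1 − ST, S) is invertible, lifts
diag(u, u⁻¹), and conjugates diag(1, 0) to diag(TS, 1 − ST). So the index class is [1 − ST]₀ − [1 −
TS]₀ (`liftClass_generalizedInverseUnit`). These idempotents have ranks dim ker T and dim coker T,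
and a finite rank idempotent has class rank · [E]₀ (`mk_eq_finrank_nsmul`). -/

namespace PsiDO

open MeasureTheory Filter Topology
open scoped ENNReal FourierTransform

/-! ### Multiplication operators: norm bounds and strong limits. -/

section MulOpBounds

variable {α : Type} [MeasurableSpace α] {μ : Measure α}

theorem norm_mulOp_apply_le {f : α → ℂ} (hf : MemLp f ∞ μ) {C : ℝ} (hC : ∀ x, ‖f x‖ ≤ C)
    (u : Lp ℂ 2 μ) : ‖mulOp μ f hf u‖ ≤ C * ‖u‖ := by
  refine Lp.norm_le_mul_norm_of_ae_le_mul ?_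
  filter_upwards [mulOp_coeFn hf u] with x h
  rw [h, norm_mul]
  exact mul_le_mul_of_nonneg_right (hC x) (norm_nonneg _)

theorem norm_mulOp_le {f : α → ℂ} (hf : MemLp f ∞ μ) {C : ℝ} (hC0 : 0 ≤ C)
    (hC : ∀ x, ‖f x‖ ≤ C) : ‖mulOp μ f hf‖ ≤ C :=
  ContinuousLinearMap.opNorm_le_bound _ hC0 (norm_mulOp_apply_le hf hC)

theorem mulOp_congr {f g : α → ℂ} (hf : MemLp f ∞ μ) (hg : MemLp g ∞ μ) (h : ∀ x, f x = g x) :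
    mulOp μ f hf = mulOp μ g hg := by
  obtain rfl : f = g := funext h
  rfl

theorem mulOp_sub_const_apply {f : α → ℂ} (hf : MemLp f ∞ μ) (c : ℂ) (u : Lp ℂ 2 μ) :
    (mulOp μ f hf u - c • u : Lp ℂ 2 μ) =ᵐ[μ] fun x => (f x - c) * u x := by
  filter_upwards [mulOp_coeFn hf u, Lp.coeFn_smul c u, Lp.coeFn_sub (mulOp μ f hf u) (c • u)]
    with x h1 h2 h3
  rw [h3, Pi.sub_apply, h1, h2, Pi.smul_apply, smul_eq_mul, sub_mul]

theorem norm_sq_eq_integral (u : Lp ℂ 2 μ) : ‖u‖ ^ 2 = ∫ x, ‖u x‖ ^ 2 ∂μ := by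
  have h := L2.inner_def (𝕜 := ℂ) u u
  rw [inner_self_eq_norm_sq_to_K] at h
  have h2 : ∀ x, inner ℂ (u x) (u x) = ((‖u x‖ ^ 2 : ℝ) : ℂ) := fun x => by
    rw [inner_self_eq_norm_sq_to_K]
    norm_cast
  simp only [h2] at h
  rw [integral_complex_ofReal] at h
  refine Complex.ofReal_injective ?_
  rw [← h]
  norm_cast

/-- Multiplications by a bounded sequence of functions with pointwise limit `c` converge strongly
to `c`. -/
theorem tendsto_mulOp {f : ℕ → α → ℂ} (hf : ∀ n, MemLp (f n) ∞ μ) {C : ℝ}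
    (hC : ∀ n x, ‖f n x‖ ≤ C) (c : ℂ) (hlim : ∀ x, Tendsto (fun n => f n x) atTop (𝓝 c))
    (u : Lp ℂ 2 μ) : Tendsto (fun n => mulOp μ (f n) (hf n) u - c • u) atTop (𝓝 0) := by
  rw [tendsto_zero_iff_norm_tendsto_zero]
  -- Dominated convergence applies to the integral of the squared modulus, so the limit is first
  -- taken for squared norms.
  have key : Tendsto (fun n => ‖mulOp μ (f n) (hf n) u - c • u‖ ^ 2) atTop (𝓝 0) := by
    have h1 : ∀ n, ‖mulOp μ (f n) (hf n) u - c • u‖ ^ 2 = ∫ x, ‖(f n x - c) * u x‖ ^ 2 ∂μ := by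
      intro n
      rw [norm_sq_eq_integral]
      refine integral_congr_ae ?_
      filter_upwards [mulOp_sub_const_apply (hf n) c u] with x hx
      rw [hx]
    simp only [h1]
    have h0 : (0 : ℝ) = ∫ x, (0 : ℝ) ∂μ := by simp
    rw [h0]
    have hu : Integrable (fun x => ‖u x‖ ^ 2) μ := (Lp.memLp u).integrable_norm_pow two_ne_zero
    refine tendsto_integral_of_dominated_convergence (fun x => (C + ‖c‖) ^ 2 * ‖u x‖ ^ 2) ?_
      (hu.const_mul _) ?_ ?_
    · intro n
      exact ((((hf n).1.sub aestronglyMeasurable_const).mul (Lp.aestronglyMeasurable u)).norm.pow 2)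
    · intro n
      refine Eventually.of_forall fun x => ?_
      rw [norm_mul, mul_pow, Real.norm_of_nonneg (by positivity)]
      gcongr
      exact (norm_sub_le _ _).trans (by gcongr; exact hC n x)
    · refine Eventually.of_forall fun x => ?_
      have h2 : Tendsto (fun n => ‖(f n x - c) * u x‖ ^ 2) atTop (𝓝 (‖(c - c) * u x‖ ^ 2)) :=
        (((hlim x).sub_const c).mul_const _).norm.pow 2
      simpa using h2
  have := key.sqrt
  simpa [Real.sqrt_sq] using this

end MulOpBounds

/-! ### Wave packets: modulated, translated and rescaled copies of a profile. -/

section Packet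

/-- The factor r here is what the normalization r^(-1/2) in `packetFun` compensates. -/
theorem measurePreserving_affine (h : ℝ) {r : ℝ} (hr : 0 < r) :
    MeasurePreserving (fun x : ℝ => r⁻¹ * (x - h)) volume (ENNReal.ofReal r • volume) := by
  refine ⟨by fun_prop, ?_⟩
  have h1 : (fun x : ℝ => r⁻¹ * (x - h)) = (fun x => r⁻¹ * x) ∘ fun x => x - h := rfl
  rw [h1, ← Measure.map_map (by fun_prop) (by fun_prop), map_sub_right_eq_self,
    Real.map_volume_mul_left (inv_ne_zero hr.ne'), inv_inv, abs_of_pos hr]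

theorem quasi_affine (h : ℝ) {r : ℝ} (hr : 0 < r) :
    Measure.QuasiMeasurePreserving (fun x : ℝ => r⁻¹ * (x - h)) volume volume :=
  ⟨by fun_prop, by
    rw [(measurePreserving_affine h hr).map_eq]
    exact Measure.smul_absolutelyContinuous⟩

/-- The function `x ↦ r^(-1/2) e^{ilx} g((x - h) / r)`. -/
noncomputable def packetFun (l h r : ℝ) (g : ℝ → ℂ) (x : ℝ) : ℂ :=
  ((r ^ (-(1 / 2) : ℝ) : ℝ) : ℂ) * Complex.exp (l * x * Complex.I) * g (r⁻¹ * (x - h))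

theorem eLpNorm_packetFun (l h : ℝ) {r : ℝ} (hr : 0 < r) {g : ℝ → ℂ}
    (hg : AEStronglyMeasurable g volume) :
    eLpNorm (packetFun l h r g) 2 volume = eLpNorm g 2 volume := by
  have h1 : eLpNorm (packetFun l h r g) 2 volume =
      eLpNorm ((r ^ (-(1 / 2) : ℝ) : ℝ) • fun x => g (r⁻¹ * (x - h))) 2 volume := by
    refine eLpNorm_congr_norm_ae (Eventually.of_forall fun x => ?_)
    have : ‖Complex.exp (l * x * Complex.I)‖ = 1 := by
      rw [← Complex.ofReal_mul, Complex.norm_exp_ofReal_mul_I]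
    simp only [packetFun, norm_mul, this, mul_one, Pi.smul_apply, norm_smul, Complex.norm_real]
  have h2 := eLpNorm_comp_measurePreserving (p := 2) (g := g)
    (hg.smul_measure (ENNReal.ofReal r)) (measurePreserving_affine h hr)
  have h3 : (fun x => g (r⁻¹ * (x - h))) = g ∘ fun x => r⁻¹ * (x - h) := rfl
  rw [h1, eLpNorm_const_smul, h3, h2, eLpNorm_smul_measure_of_ne_top (by simp), smul_eq_mul,
    ← mul_assoc]
  have h4 : ‖(r ^ (-(1 / 2) : ℝ) : ℝ)‖ₑ * ENNReal.ofReal r ^ (1 / (2 : ℝ≥0∞)).toReal = 1 := by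
    rw [Real.enorm_of_nonneg (by positivity), ENNReal.ofReal_rpow_of_pos hr,
      ← ENNReal.ofReal_mul (by positivity), ← Real.rpow_add hr]
    simp
  rw [h4, one_mul]

theorem memLp_packetFun (l h : ℝ) {r : ℝ} (hr : 0 < r) {g : ℝ → ℂ} (hg : MemLp g 2 volume) :
    MemLp (packetFun l h r g) 2 volume := by
  refine ⟨?_, by rw [eLpNorm_packetFun l h hr hg.1]; exact hg.2⟩
  refine AEStronglyMeasurable.mul (Continuous.aestronglyMeasurable (by fun_prop)) ?_
  exact hg.1.comp_quasiMeasurePreserving (quasi_affine h hr)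

theorem packetFun_congr (l h : ℝ) {r : ℝ} (hr : 0 < r) {f g : ℝ → ℂ} (hfg : f =ᵐ[volume] g) :
    packetFun l h r f =ᵐ[volume] packetFun l h r g := by
  filter_upwards [(quasi_affine h hr).ae_eq_comp hfg] with x hx
  have hx' : f (r⁻¹ * (x - h)) = g (r⁻¹ * (x - h)) := hx
  simp only [packetFun, hx']

/-- The unitary operator `(packet g)(x) = r^(-1/2) e^{ilx} g((x - h) / r)` on `L²(ℝ)`. -/
noncomputable def packet (l h : ℝ) {r : ℝ} (hr : 0 < r) : L2R →ₗᵢ[ℂ] L2R where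
  toFun g := (memLp_packetFun l h hr (Lp.memLp g)).toLp
  map_add' f g := by
    rw [← MemLp.toLp_add]
    refine MemLp.toLp_congr _ _ ?_
    filter_upwards [packetFun_congr l h hr (Lp.coeFn_add f g)] with x hx
    rw [hx]
    simp only [packetFun, Pi.add_apply]
    ring
  map_smul' c f := by
    rw [RingHom.id_apply, ← MemLp.toLp_const_smul]
    refine MemLp.toLp_congr _ _ ?_
    filter_upwards [packetFun_congr l h hr (Lp.coeFn_smul c f)] with x hx
    rw [hx]
    simp only [packetFun, Pi.smul_apply, smul_eq_mul]
    ring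
  norm_map' g := by
    change ‖(memLp_packetFun l h hr (Lp.memLp g)).toLp‖ = ‖g‖
    rw [Lp.norm_toLp, eLpNorm_packetFun l h hr (Lp.aestronglyMeasurable g), Lp.norm_def]

theorem packet_toLp (l h : ℝ) {r : ℝ} (hr : 0 < r) {g : ℝ → ℂ} (hg : MemLp g 2 volume) :
    packet l h hr hg.toLp = (memLp_packetFun l h hr hg).toLp :=
  MemLp.toLp_congr (memLp_packetFun l h hr (Lp.memLp _)) (memLp_packetFun l h hr hg)
    (packetFun_congr l h hr hg.coeFn_toLp)

theorem packet_coeFn (l h : ℝ) {r : ℝ} (hr : 0 < r) (g : L2R) :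
    packet l h hr g =ᵐ[volume] packetFun l h r g :=
  (memLp_packetFun l h hr (Lp.memLp g)).coeFn_toLp

/-- Moving a multiplication past a packet rescales the multiplier around h. All dependence on the
packet then sits in the multiplier, and limits along packets reduce to `tendsto_mulOp` for a fixed
vector. -/
theorem mulOp_packet {f : ℝ → ℂ} (hf : MemLp f ∞ volume) (l h : ℝ) {r : ℝ} (hr : 0 < r)
    (hf' : MemLp (fun y => f (h + r * y)) ∞ volume) (g : L2R) :
    mulOp volume f hf (packet l h hr g) = packet l h hr (mulOp volume (fun y => f (h + r * y)) hf' g) := by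
  ext1
  filter_upwards [mulOp_coeFn hf (packet l h hr g), packet_coeFn l h hr g,
    packet_coeFn l h hr (mulOp volume _ hf' g),
    packetFun_congr l h hr (mulOp_coeFn hf' g)] with x h1 h2 h3 h4
  rw [h1, h2, h3, h4]
  simp only [packetFun]
  have : h + r * (r⁻¹ * (x - h)) = x := by field_simp; ring
  rw [this]
  ring

end Packet

open scoped SchwartzMap

/-! ### The Fourier transform of a wave packet. -/

section FourierPacket

theorem iteratedDeriv_exp_mul_I (l : ℝ) (n : ℕ) :
    iteratedDeriv n (fun x : ℝ => Complex.exp (l * x * Complex.I)) =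
      fun x : ℝ => (l * Complex.I) ^ n * Complex.exp (l * x * Complex.I) := by
  induction n with
  | zero => simp
  | succ n ih =>
    rw [iteratedDeriv_succ, ih]
    ext x
    have h1 : HasDerivAt (fun x : ℝ => (l : ℂ) * x * Complex.I) (l * 1 * Complex.I) x :=
      ((Complex.ofRealCLM.hasDerivAt (x := x)).const_mul _).mul_const _
    rw [((h1.cexp).const_mul _).deriv]
    ring

theorem hasTemperateGrowth_exp_mul_I (l : ℝ) :
    (fun x : ℝ => Complex.exp (l * x * Complex.I)).HasTemperateGrowth := by
  -- Each derivative is a constant times a function of modulus one, so degree 0 is enough.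
  refine ⟨?_, fun n => ⟨0, ‖(l * Complex.I : ℂ) ^ n‖, fun x => ?_⟩⟩
  · have h : ContDiff ℝ ⊤ (fun x : ℝ => (x : ℂ)) := Complex.ofRealCLM.contDiff
    exact ((contDiff_const.mul (h.of_le (by simp))).mul contDiff_const).cexp
  · rw [norm_iteratedFDeriv_eq_norm_iteratedDeriv, iteratedDeriv_exp_mul_I, norm_mul,
      ← Complex.ofReal_mul, Complex.norm_exp_ofReal_mul_I]
    simp

theorem hasTemperateGrowth_affine (h r : ℝ) :
    (fun x : ℝ => r⁻¹ * (x - h)).HasTemperateGrowth := by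
  fun_prop

theorem antilipschitz_affine (h : ℝ) {r : ℝ} (hr : 0 < r) :
    AntilipschitzWith ⟨r, hr.le⟩ fun x : ℝ => r⁻¹ * (x - h) := by
  refine AntilipschitzWith.of_le_mul_dist fun x y => ?_
  rw [Real.dist_eq, Real.dist_eq]
  have : r⁻¹ * (x - h) - r⁻¹ * (y - h) = r⁻¹ * (x - y) := by ring
  rw [this, abs_mul, abs_of_pos (inv_pos.2 hr)]
  change _ ≤ r * _
  rw [← mul_assoc, mul_inv_cancel₀ hr.ne', one_mul]

/-- The function `packetFun l h r g` for a Schwartz function `g`. -/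
noncomputable def packetSchwartz (l h : ℝ) {r : ℝ} (hr : 0 < r) (g : 𝓢(ℝ, ℂ)) : 𝓢(ℝ, ℂ) :=
  ((r ^ (-(1 / 2) : ℝ) : ℝ) : ℂ) • SchwartzMap.smulLeftCLM ℂ
    (fun x : ℝ => Complex.exp (l * x * Complex.I))
    (SchwartzMap.compCLMOfAntilipschitz ℂ (hasTemperateGrowth_affine h r)
      (antilipschitz_affine h hr) g)

theorem coe_packetSchwartz (l h : ℝ) {r : ℝ} (hr : 0 < r) (g : 𝓢(ℝ, ℂ)) :
    (packetSchwartz l h hr g : ℝ → ℂ) = packetFun l h r g := by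
  ext x
  simp only [packetSchwartz, smul_apply, packetFun]
  rw [SchwartzMap.smulLeftCLM_apply_apply (hasTemperateGrowth_exp_mul_I l), smul_eq_mul,
    smul_eq_mul, ← mul_assoc]
  rfl

/-- The Fourier transform exchanges modulation with translation and inverts the width. The remaining
constant e^{ilh} comes from the order in which the two are applied. -/
theorem fourier_packetFun (l h : ℝ) {r : ℝ} (hr : 0 < r) (g : ℝ → ℂ) (w : ℝ) :
    𝓕 (packetFun l h r g) w = Complex.exp (l * h * Complex.I) *
      packetFun (-(2 * Real.pi * h)) (l / (2 * Real.pi)) r⁻¹ (𝓕 g) w := by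
  rw [Real.fourier_real_eq_integral_exp_smul]
  simp only [packetFun]
  rw [Real.fourier_real_eq_integral_exp_smul]
  -- `G` is the integrand in the variable y = (x − h)/r.
  set G : ℝ → ℂ := fun y => Complex.exp (↑(-2 * Real.pi * (h + r * y) * w) * Complex.I) •
    (((r ^ (-(1 / 2) : ℝ) : ℝ) : ℂ) * Complex.exp (l * (h + r * y : ℝ) * Complex.I) * g y) with hG
  have h1 : ∀ x : ℝ, Complex.exp (↑(-2 * Real.pi * x * w) * Complex.I) •
      (((r ^ (-(1 / 2) : ℝ) : ℝ) : ℂ) * Complex.exp (l * x * Complex.I) * g (r⁻¹ * (x - h))) =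
      G (r⁻¹ * (x - h)) := by
    intro x
    have : h + r * (r⁻¹ * (x - h)) = x := by field_simp; ring
    simp only [hG, this]
  simp only [h1]
  have h2 := integral_sub_right_eq_self (μ := volume) (fun x => G (r⁻¹ * x)) h
  rw [h2, Measure.integral_comp_mul_left, inv_inv, abs_of_pos hr, ← integral_smul,
    ← integral_const_mul, ← integral_const_mul]
  congr 1
  ext y
  -- The Jacobian r turns the normalization for width r into the one for width 1/r.
  have e1 : ((r⁻¹ ^ (-(1 / 2) : ℝ) : ℝ) : ℂ) = ((r : ℝ) : ℂ) * ((r ^ (-(1 / 2) : ℝ) : ℝ) : ℂ) := by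
    rw [← Complex.ofReal_mul]
    congr 1
    rw [Real.inv_rpow hr.le, ← Real.rpow_neg hr.le, neg_neg]
    nth_rewrite 2 [← Real.rpow_one r]
    rw [← Real.rpow_add hr]
    norm_num
  have e2 : Complex.exp (↑(-2 * Real.pi * (h + r * y) * w) * Complex.I) *
      Complex.exp (l * (h + r * y : ℝ) * Complex.I) = Complex.exp (l * h * Complex.I) *
      Complex.exp (((-(2 * Real.pi * h) : ℝ) : ℂ) * w * Complex.I) *
      Complex.exp (↑(-2 * Real.pi * y * (r * (w - l / (2 * Real.pi)))) * Complex.I) := by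
    rw [← Complex.exp_add, ← Complex.exp_add, ← Complex.exp_add]
    congr 1
    push_cast
    have := Complex.ofReal_ne_zero.2 Real.pi_ne_zero
    field_simp
    ring
  simp only [hG, smul_eq_mul, Complex.real_smul, e1]
  linear_combination (r * ((r ^ (-(1 / 2) : ℝ) : ℝ) : ℂ) * g y) * e2

/-- The integral formula is available on Schwartz functions; both sides are continuous, so density
extends it to L². -/
theorem fourier_packet (l h : ℝ) {r : ℝ} (hr : 0 < r) (g : L2R) :
    Lp.fourierTransformₗᵢ ℝ ℂ (packet l h hr g) = Complex.exp (l * h * Complex.I) •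
      packet (-(2 * Real.pi * h)) (l / (2 * Real.pi)) (inv_pos.2 hr)
        (Lp.fourierTransformₗᵢ ℝ ℂ g) := by
  refine (SchwartzMap.denseRange_toLpCLM (E := ℝ) (F := ℂ) (p := 2) (μ := volume)
    ENNReal.ofNat_ne_top).induction_on (p := fun g => Lp.fourierTransformₗᵢ ℝ ℂ (packet l h hr g) =
      Complex.exp (l * h * Complex.I) • packet (-(2 * Real.pi * h)) (l / (2 * Real.pi))
        (inv_pos.2 hr) (Lp.fourierTransformₗᵢ ℝ ℂ g)) g ?_ ?_
  · refine isClosed_eq ?_ ?_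
    · exact (Lp.fourierTransformₗᵢ ℝ ℂ).continuous.comp (packet l h hr).continuous
    · exact (((packet _ _ (inv_pos.2 hr)).continuous).comp
        (Lp.fourierTransformₗᵢ ℝ ℂ).continuous).const_smul (Complex.exp (l * h * Complex.I))
  · intro f
    rw [SchwartzMap.toLpCLM_apply]
    have h1 : packet l h hr (f.toLp 2 volume) = (packetSchwartz l h hr f).toLp 2 volume := by
      refine (packet_toLp l h hr (f.memLp 2 volume)).trans ?_
      refine MemLp.toLp_congr _ ((packetSchwartz l h hr f).memLp 2 volume) ?_
      rw [coe_packetSchwartz]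
    have h2 : ∀ f : 𝓢(ℝ, ℂ), Lp.fourierTransformₗᵢ ℝ ℂ (f.toLp 2 volume) =
      (𝓕 f).toLp 2 volume := SchwartzMap.toLp_fourier_eq
    rw [h1, h2, h2]
    have h3 : packet (-(2 * Real.pi * h)) (l / (2 * Real.pi)) (inv_pos.2 hr)
        ((𝓕 f).toLp 2 volume) = (packetSchwartz (-(2 * Real.pi * h)) (l / (2 * Real.pi))
          (inv_pos.2 hr) (𝓕 f)).toLp 2 volume := by
      refine (packet_toLp _ _ (inv_pos.2 hr) ((𝓕 f).memLp 2 volume)).trans ?_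
      refine MemLp.toLp_congr _ (SchwartzMap.memLp _ 2 volume) ?_
      rw [coe_packetSchwartz]
    rw [h3]
    have h4 : 𝓕 (packetSchwartz l h hr f) = Complex.exp (l * h * Complex.I) •
        packetSchwartz (-(2 * Real.pi * h)) (l / (2 * Real.pi)) (inv_pos.2 hr) (𝓕 f) := by
      ext w
      rw [SchwartzMap.fourier_coe, coe_packetSchwartz, fourier_packetFun l h hr,
        smul_apply, coe_packetSchwartz, SchwartzMap.fourier_coe, smul_eq_mul]
    rw [h4]
    exact (SchwartzMap.toLpCLM ℂ ℂ 2 volume).map_smul _ _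

end FourierPacket

/-! ### Action of multipliers on sequences of packets. -/

section Limits

/-- After a Fourier transform the packet is centred at l/(2π) with width 1/r. Up to an isometry and
a phase, the error is then that of multiplication by a rescaled b on the fixed vector F g. -/
theorem tendsto_fourierOp_packet (b : C(EReal, ℂ)) (c : ℂ) (l h r : ℕ → ℝ) (hr : ∀ n, 0 < r n)
    (hlim : ∀ y : ℝ, Tendsto (fun n => b ((l n + (r n)⁻¹ * y : ℝ) : EReal)) atTop (𝓝 c)) (g : L2R) :
    Tendsto (fun n => fourierOp b (packet (l n) (h n) (hr n) g) - c • packet (l n) (h n) (hr n) g)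
      atTop (𝓝 0) := by
  set F := Lp.fourierTransformₗᵢ ℝ ℂ with hF
  have hm : ∀ n, MemLp (fun y : ℝ => b ((2 * Real.pi * (l n / (2 * Real.pi) + (r n)⁻¹ * y) : ℝ) :
      EReal)) ∞ volume := fun n => memLp_top_of_bound (C := ‖b‖)
    (Continuous.aestronglyMeasurable (b.continuous.comp (continuous_coe_real_ereal.comp
      (by fun_prop)))) (Eventually.of_forall fun x => b.norm_coe_le_norm _)
  have h1 : ∀ n, ‖fourierOp b (packet (l n) (h n) (hr n) g) - c • packet (l n) (h n) (hr n) g‖ =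
      ‖mulOp volume _ (hm n) (F g) - c • F g‖ := by
    intro n
    set P := packet (l n) (h n) (hr n)
    set P' := packet (-(2 * Real.pi * h n)) (l n / (2 * Real.pi)) (inv_pos.2 (hr n)) with hP'
    have e1 : F (fourierOp b (P g) - c • P g) = Complex.exp (l n * h n * Complex.I) •
        P' (mulOp volume _ (hm n) (F g) - c • F g) := by
      have e2 : F (fourierOp b (P g)) = mulOp volume (fun ξ : ℝ => b ((2 * Real.pi * ξ : ℝ) : EReal))
          (memLp_ereal b (2 * Real.pi)) (F (P g)) := F.apply_symm_apply _
      rw [map_sub, e2, map_smul, fourier_packet, map_smul, mulOp_packet _ _ _ _ (hm n), map_sub,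
        map_smul, smul_sub, smul_comm c]
    rw [← F.norm_map, e1, norm_smul, P'.norm_map, ← Complex.ofReal_mul,
      Complex.norm_exp_ofReal_mul_I, one_mul]
  rw [tendsto_zero_iff_norm_tendsto_zero]
  simp only [h1]
  rw [← tendsto_zero_iff_norm_tendsto_zero]
  refine tendsto_mulOp hm (C := ‖b‖) (fun n x => b.norm_coe_le_norm _) c (fun y => ?_) _
  -- The multiplier is b(2πξ), so the hypothesis is used at 2πy.
  have := hlim (2 * Real.pi * y)
  convert this using 5
  have := Real.pi_ne_zero
  field_simp

theorem tendsto_mulOp_packet {f : ℝ → ℂ} (hf : MemLp f ∞ volume) (hcont : Continuous f) {C : ℝ}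
    (hC : ∀ x, ‖f x‖ ≤ C) (c : ℂ) (l h r : ℕ → ℝ) (hr : ∀ n, 0 < r n)
    (hlim : ∀ y : ℝ, Tendsto (fun n => f (h n + r n * y)) atTop (𝓝 c)) (g : L2R) :
    Tendsto (fun n => mulOp volume f hf (packet (l n) (h n) (hr n) g) -
      c • packet (l n) (h n) (hr n) g) atTop (𝓝 0) := by
  have hm : ∀ n, MemLp (fun y : ℝ => f (h n + r n * y)) ∞ volume := fun n =>
    memLp_top_of_bound (C := C) (Continuous.aestronglyMeasurable (by fun_prop))
      (Eventually.of_forall fun x => hC _)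
  have h1 : ∀ n, ‖mulOp volume f hf (packet (l n) (h n) (hr n) g) -
      c • packet (l n) (h n) (hr n) g‖ = ‖mulOp volume _ (hm n) g - c • g‖ := by
    intro n
    rw [mulOp_packet _ _ _ _ (hm n), ← map_smul, ← map_sub, LinearIsometry.norm_map]
  rw [tendsto_zero_iff_norm_tendsto_zero]
  simp only [h1]
  rw [← tendsto_zero_iff_norm_tendsto_zero]
  exact tendsto_mulOp hm (fun n x => hC _) c hlim g

end Limits

/-! ### Strong convergence of bounded sequences of operators. -/

section StrongLimits

variable {E F G : Type} [NormedAddCommGroup E] [NormedSpace ℂ E] [NormedAddCommGroup F]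
  [NormedSpace ℂ F] [NormedAddCommGroup G] [NormedSpace ℂ G]

/-- A uniformly bounded sequence of operators that converges to `0` on a total set converges
strongly to `0`. -/
theorem tendsto_zero_of_total {B : ℕ → E →L[ℂ] F} {C : ℝ} (hB : ∀ n, ‖B n‖ ≤ C) {S : Set E}
    (hS : Dense (Submodule.span ℂ S : Set E))
    (h : ∀ a ∈ S, Tendsto (fun n => B n a) atTop (𝓝 0)) (a : E) :
    Tendsto (fun n => B n a) atTop (𝓝 0) := by
  have h1 : ∀ a ∈ Submodule.span ℂ S, Tendsto (fun n => B n a) atTop (𝓝 0) := by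
    intro a ha
    induction ha using Submodule.span_induction with
    | mem x hx => exact h x hx
    | zero => simp
    | add x y _ _ hx hy => simpa using hx.add hy
    | smul c x _ hx => simpa using hx.const_smul c
  have hC : 0 ≤ C := (norm_nonneg _).trans (hB 0)
  rw [Metric.tendsto_atTop]
  intro ε hε
  -- The summand 1 keeps the denominator positive when C = 0.
  obtain ⟨b, hb, hab⟩ := Metric.dense_iff.1 hS a (ε / (2 * (C + 1))) (by positivity)
  obtain ⟨N, hN⟩ := Metric.tendsto_atTop.1 (h1 b hab) (ε / 2) (by positivity)
  refine ⟨N, fun n hn => ?_⟩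
  have h2 := hN n hn
  rw [dist_zero_right] at h2 ⊢
  have h3 : ‖B n (a - b)‖ ≤ C * (ε / (2 * (C + 1))) := by
    refine (B n).le_of_opNorm_le_of_le (hB n) ?_
    rw [← dist_eq_norm, dist_comm]
    exact (Metric.mem_ball.1 hb).le
  have h4 : C * (ε / (2 * (C + 1))) ≤ ε / 2 := by
    rw [mul_div_assoc', div_le_div_iff₀ (by positivity) (by positivity)]
    nlinarith
  have h5 : B n a = B n (a - b) + B n b := by rw [map_sub, sub_add_cancel]
  rw [h5]
  linarith [norm_add_le (B n (a - b)) (B n b)]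

/-- If `Z n → 1` strongly, with `Z n` uniformly bounded, and `K` is compact, then `Z n K → K` in
norm. -/
theorem tendsto_comp_compact {Z : ℕ → F →L[ℂ] F} {C : ℝ} (hZ : ∀ n, ‖Z n‖ ≤ C)
    (h : ∀ a, Tendsto (fun n => Z n a) atTop (𝓝 a)) {K : E →L[ℂ] F} (hK : IsCompactOperator K) :
    Tendsto (fun n => Z n ∘L K) atTop (𝓝 K) := by
  have hC : 0 ≤ C := (norm_nonneg _).trans (hZ 0)
  have hcpt := hK.isCompact_closure_image_closedBall (f := (K : E →ₗ[ℂ] F)) 1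
  rw [Metric.tendsto_atTop]
  intro ε hε
  -- Three errors occur, bounded by Cδ, δ and δ; this choice makes their sum ε/2.
  set δ := ε / (2 * (C + 2)) with hδ
  have hδ0 : 0 < δ := by positivity
  -- Strong convergence is uniform on a finite δ-net of the relatively compact image of the unit
  -- ball.
  obtain ⟨t, ht, hcov⟩ := Metric.totallyBounded_iff.1 hcpt.totallyBounded δ hδ0
  have h1 : ∀ᶠ n in atTop, ∀ y ∈ t, dist (Z n y) y < δ :=
    (eventually_all_finite ht).2 fun y _ => (Metric.tendsto_nhds.1 (h y)) δ hδ0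
  obtain ⟨N, hN⟩ := eventually_atTop.1 h1
  refine ⟨N, fun n hn => ?_⟩
  rw [dist_eq_norm]
  refine lt_of_le_of_lt (ContinuousLinearMap.opNorm_le_of_unit_norm (C := ε / 2) (by positivity)
    fun x hx => ?_) (by linarith)
  have hx' : K x ∈ closure ((K : E →ₗ[ℂ] F) '' Metric.closedBall 0 1) :=
    subset_closure ⟨x, by simp [hx], rfl⟩
  obtain ⟨y, hy, hxy⟩ := Set.mem_iUnion₂.1 (hcov hx')
  have h2 := hN n hn y hy
  rw [Metric.mem_ball] at hxy
  rw [dist_eq_norm] at h2 hxy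
  have h3 : ‖Z n (K x - y)‖ ≤ C * δ := (Z n).le_of_opNorm_le_of_le (hZ n) hxy.le
  have h4 : (Z n ∘L K - K) x = Z n (K x - y) + (Z n y - y) - (K x - y) := by
    simp
  have h5 : C * δ + δ + δ = ε / 2 := by
    rw [hδ]; field_simp; ring
  rw [h4]
  linarith [norm_sub_le (Z n (K x - y) + (Z n y - y)) (K x - y),
    norm_add_le (Z n (K x - y)) (Z n y - y)]

end StrongLimits

/-! ### Symbols as limits along sequences of isometries. -/

section Intertwining

variable {H : Type} [NormedAddCommGroup H] [InnerProductSpace ℂ H]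

/-- The isometries `V n : H → L²(ℝ)` asymptotically intertwine the operators `A` and `T`. -/
def Intertwines (V : ℕ → H →ₗᵢ[ℂ] L2R) (A : L2R →L[ℂ] L2R) (T : H →L[ℂ] H) : Prop :=
  ∀ a, Tendsto (fun n => A (V n a) - V n (T a)) atTop (𝓝 0)

namespace Intertwines

variable {V : ℕ → H →ₗᵢ[ℂ] L2R} {A A' : L2R →L[ℂ] L2R} {T T' : H →L[ℂ] H}

theorem add (h : Intertwines V A T) (h' : Intertwines V A' T') :
    Intertwines V (A + A') (T + T') := fun a => by
  have := (h a).add (h' a)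
  rw [add_zero] at this
  refine this.congr fun n => ?_
  simp only [add_apply, map_add]
  abel

theorem smul (h : Intertwines V A T) (c : ℂ) : Intertwines V (c • A) (c • T) := fun a => by
  have := (h a).const_smul c
  rw [smul_zero] at this
  refine this.congr fun n => ?_
  simp only [smul_apply, map_smul, smul_sub]

theorem one : Intertwines V 1 1 := fun a => by simp

theorem zero : Intertwines V 0 0 := fun a => by simp

theorem sub (h : Intertwines V A T) (h' : Intertwines V A' T') :
    Intertwines V (A - A') (T - T') := by
  simpa [sub_eq_add_neg] using h.add (h'.smul (-1))

theorem mul (h : Intertwines V A T) (h' : Intertwines V A' T') :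
    Intertwines V (A * A') (T * T') := fun a => by
  -- With V = V_n: AA'V − VTT' = A(A'V − VT') + (AV − VT)T'.
  have h1 := ((A.continuous.tendsto 0).comp (h' a)).add (h (T' a))
  rw [map_zero, add_zero] at h1
  refine h1.congr fun n => ?_
  simp only [Function.comp_apply, map_sub, mul_apply_eq_comp]
  abel

/-- V_n preserves norms, so ‖T a‖ = ‖V_n T a‖ differs from ‖A V_n a‖ by a null sequence. Applied to
differences, this yields both uniqueness of the symbol and its continuity in the operator. -/
theorem norm_le (h : Intertwines V A T) : ‖T‖ ≤ ‖A‖ := by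
  refine ContinuousLinearMap.opNorm_le_bound _ (norm_nonneg _) fun a => ?_
  have h1 : Tendsto (fun n => ‖A (V n a) - V n (T a)‖ + ‖A‖ * ‖a‖) atTop (𝓝 (‖(0 : L2R)‖ + ‖A‖ * ‖a‖)) :=
    (h a).norm.add_const _
  rw [norm_zero, zero_add] at h1
  refine ge_of_tendsto' h1 fun n => ?_
  calc ‖T a‖ = ‖V n (T a)‖ := ((V n).norm_map _).symm
    _ = ‖A (V n a) - (A (V n a) - V n (T a))‖ := by rw [sub_sub_cancel]
    _ ≤ ‖A (V n a)‖ + ‖A (V n a) - V n (T a)‖ := norm_sub_le _ _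
    _ ≤ ‖A‖ * ‖a‖ + ‖A (V n a) - V n (T a)‖ := by
        gcongr
        rw [← (V n).norm_map a]
        exact A.le_opNorm _
    _ = _ := add_comm _ _

theorem unique (h : Intertwines V A T) (h' : Intertwines V A T') : T = T' := by
  have := (h.sub h').norm_le
  rw [sub_self, norm_zero, norm_le_zero_iff, sub_eq_zero] at this
  exact this

/-- Passing to adjoints preserves only weak limits: ⟨V_n a, A V_n b⟩ → ⟨a, T b⟩. Hence a symbol of
A* has to be assumed and is merely identified here; this is why `symbolDomain` imposes conditions on
A and on A*. -/
theorem star_unique [CompleteSpace H] (h : Intertwines V A T) (h' : Intertwines V (star A) T') :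
    T' = star T := by
  rw [ContinuousLinearMap.star_eq_adjoint, ContinuousLinearMap.eq_adjoint_iff]
  intro a b
  have h1 : Tendsto (fun n => inner ℂ (V n a) (A (V n b) - V n (T b))) atTop (𝓝 0) := by
    refine squeeze_zero_norm (a := fun n => ‖a‖ * ‖A (V n b) - V n (T b)‖) (fun n => ?_) ?_
    · rw [← (V n).norm_map a]
      exact norm_inner_le_norm _ _
    · simpa using (h b).norm.const_mul ‖a‖
  have h2 : Tendsto (fun n => inner ℂ (star A (V n a) - V n (T' a)) (V n b)) atTop (𝓝 0) := by
    refine squeeze_zero_norm (a := fun n => ‖star A (V n a) - V n (T' a)‖ * ‖b‖) (fun n => ?_) ?_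
    · rw [← (V n).norm_map b]
      exact norm_inner_le_norm _ _
    · simpa using (h' a).norm.mul_const ‖b‖
  have h3 := h1.sub h2
  rw [sub_zero] at h3
  have h4 : ∀ n, inner ℂ (V n a) (A (V n b) - V n (T b)) -
      inner ℂ (star A (V n a) - V n (T' a)) (V n b) = inner ℂ (T' a) b - inner ℂ a (T b) := by
    intro n
    rw [inner_sub_left, inner_sub_right, ContinuousLinearMap.star_eq_adjoint,
      ContinuousLinearMap.adjoint_inner_left, (V n).inner_map_map, (V n).inner_map_map]
    ring
  simp only [h4] at h3
  exact sub_eq_zero.1 (tendsto_nhds_unique tendsto_const_nhds h3)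

theorem of_total {S : Set H} (hS : Dense (Submodule.span ℂ S : Set H))
    (h : ∀ a ∈ S, Tendsto (fun n => A (V n a) - V n (T a)) atTop (𝓝 0)) : Intertwines V A T := by
  refine tendsto_zero_of_total (B := fun n => A ∘L (V n).toContinuousLinearMap -
    (V n).toContinuousLinearMap ∘L T) (C := ‖A‖ + ‖T‖) (fun n => ?_) hS h
  have hV : ‖(V n).toContinuousLinearMap‖ ≤ 1 := (V n).norm_toContinuousLinearMap_le
  refine (norm_sub_le _ _).trans (add_le_add ?_ ?_)
  · refine (ContinuousLinearMap.opNorm_comp_le _ _).trans ?_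
    exact mul_le_of_le_one_right (norm_nonneg _) hV
  · refine (ContinuousLinearMap.opNorm_comp_le _ _).trans ?_
    exact mul_le_of_le_one_left (norm_nonneg _) hV

/-- Limits of asymptotically intertwined operators are asymptotically intertwined. -/
theorem of_tendsto {A : ℕ → L2R →L[ℂ] L2R} {T : ℕ → H →L[ℂ] H} {A' : L2R →L[ℂ] L2R}
    {T' : H →L[ℂ] H} (h : ∀ k, Intertwines V (A k) (T k)) (hA : Tendsto A atTop (𝓝 A'))
    (hT : Tendsto T atTop (𝓝 T')) : Intertwines V A' T' := by
  intro a
  rw [Metric.tendsto_atTop]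
  intro ε hε
  have h1 : Tendsto (fun k => ‖A' - A k‖ * ‖a‖ + ‖T k - T'‖ * ‖a‖) atTop (𝓝 0) := by
    have e1 := ((tendsto_const_nhds (x := A')).sub hA).norm.mul_const ‖a‖
    have e2 := (hT.sub_const T').norm.mul_const ‖a‖
    simpa using e1.add e2
  obtain ⟨k, hk⟩ := (h1.eventually (gt_mem_nhds (half_pos hε))).exists
  obtain ⟨N, hN⟩ := Metric.tendsto_atTop.1 (h k a) (ε / 2) (half_pos hε)
  refine ⟨N, fun n hn => ?_⟩
  have h2 := hN n hn
  rw [dist_zero_right] at h2 ⊢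
  have h3 : A' (V n a) - V n (T' a) = (A' - A k) (V n a) + (A k (V n a) - V n (T k a)) +
      V n ((T k - T') a) := by
    simp only [sub_apply, map_sub]
    abel
  have h4 : ‖(A' - A k) (V n a)‖ ≤ ‖A' - A k‖ * ‖a‖ := by
    rw [← (V n).norm_map a]
    exact ContinuousLinearMap.le_opNorm _ _
  have h5 : ‖V n ((T k - T') a)‖ ≤ ‖T k - T'‖ * ‖a‖ := by
    rw [(V n).norm_map]
    exact ContinuousLinearMap.le_opNorm _ _
  rw [h3]
  refine (norm_add_le _ _).trans_lt ?_
  linarith [norm_add_le ((A' - A k) (V n a)) (A k (V n a) - V n (T k a))]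

/-- A compact operator is intertwined with `0` only, if there are operators that converge strongly
to `1` and are intertwined with `0`. -/
theorem eq_zero_of_compact (h : Intertwines V A T) (hA : IsCompactOperator A)
    {Z : ℕ → L2R →L[ℂ] L2R} {C : ℝ} (hZ : ∀ n, ‖Z n‖ ≤ C)
    (hlim : ∀ u, Tendsto (fun n => Z n u) atTop (𝓝 u)) (h0 : ∀ n, Intertwines V (Z n) 0) :
    T = 0 := by
  have h1 := tendsto_comp_compact hZ hlim hA
  have h2 : Tendsto (fun n => ‖A - Z n ∘L A‖) atTop (𝓝 0) := by
    simpa using ((tendsto_const_nhds (x := A)).sub h1).norm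
  rw [← norm_le_zero_iff]
  refine ge_of_tendsto' h2 fun n => ?_
  -- A − Z_n A has symbol T − 0·T = T, so ‖T‖ ≤ ‖A − Z_n A‖, and the right side tends to 0 because A
  -- is compact.
  have h3 := (h.sub ((h0 n).mul h)).norm_le
  rwa [zero_mul, sub_zero] at h3

end Intertwines

variable {P : Type} [TopologicalSpace P]

/-- The function `T` on `P` is the symbol of the operator `A`, with respect to a family `V p` of
sequences of isometries `H → L²(ℝ)`. -/
def IsSymbol (V : P → ℕ → H →ₗᵢ[ℂ] L2R) (A : L2R →L[ℂ] L2R) (T : C(P, H →L[ℂ] H)) : Prop :=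
  ∀ p, Intertwines (V p) A (T p)

variable {V : P → ℕ → H →ₗᵢ[ℂ] L2R}

theorem IsSymbol.unique {A : L2R →L[ℂ] L2R} {T T' : C(P, H →L[ℂ] H)} (h : IsSymbol V A T)
    (h' : IsSymbol V A T') : T = T' :=
  ContinuousMap.ext fun p => (h p).unique (h' p)

variable [CompactSpace P]

theorem IsSymbol.norm_le {A : L2R →L[ℂ] L2R} {T : C(P, H →L[ℂ] H)} (h : IsSymbol V A T) :
    ‖T‖ ≤ ‖A‖ :=
  (ContinuousMap.norm_le _ (norm_nonneg _)).2 fun p => (h p).norm_le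

/-- The norm estimate, uniform over P, makes the symbols a Cauchy sequence in the sup norm; its
limit is again continuous on P. -/
theorem IsSymbol.of_tendsto [CompleteSpace H] {A : ℕ → L2R →L[ℂ] L2R} {T : ℕ → C(P, H →L[ℂ] H)}
    {A' : L2R →L[ℂ] L2R} (h : ∀ k, IsSymbol V (A k) (T k)) (hA : Tendsto A atTop (𝓝 A')) :
    ∃ T', IsSymbol V A' T' := by
  have h1 : CauchySeq T := by
    rw [Metric.cauchySeq_iff]
    intro ε hε
    obtain ⟨N, hN⟩ := Metric.cauchySeq_iff.1 hA.cauchySeq ε hε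
    refine ⟨N, fun m hm n hn => lt_of_le_of_lt ?_ (hN m hm n hn)⟩
    rw [dist_eq_norm, dist_eq_norm]
    exact IsSymbol.norm_le (V := V) (T := T m - T n) fun p => (h m p).sub (h n p)
  obtain ⟨T', hT'⟩ := cauchySeq_tendsto_of_complete h1
  refine ⟨T', fun p => Intertwines.of_tendsto (fun k => h k p) hA ?_⟩
  exact ((ContinuousEvalConst.continuous_eval_const p).tendsto T').comp hT'

variable (V) in
/-- The star algebra of all operators `A` such that `A` and `A*` have a symbol. -/
def symbolDomain : StarSubalgebra ℂ (L2R →L[ℂ] L2R) where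
  carrier := {A | (∃ T, IsSymbol V A T) ∧ ∃ T, IsSymbol V (star A) T}
  mul_mem' := by
    rintro A B ⟨⟨S, hS⟩, S', hS'⟩ ⟨⟨T, hT⟩, T', hT'⟩
    refine ⟨⟨S * T, fun p => (hS p).mul (hT p)⟩, T' * S', fun p => ?_⟩
    rw [star_mul]
    exact (hT' p).mul (hS' p)
  add_mem' := by
    rintro A B ⟨⟨S, hS⟩, S', hS'⟩ ⟨⟨T, hT⟩, T', hT'⟩
    refine ⟨⟨S + T, fun p => (hS p).add (hT p)⟩, S' + T', fun p => ?_⟩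
    rw [star_add]
    exact (hS' p).add (hT' p)
  algebraMap_mem' c := by
    refine ⟨⟨c • 1, fun p => ?_⟩, star c • 1, fun p => ?_⟩
    · rw [Algebra.algebraMap_eq_smul_one]
      exact Intertwines.one.smul c
    · rw [Algebra.algebraMap_eq_smul_one, star_smul, star_one]
      exact Intertwines.one.smul (star c)
  star_mem' := by
    rintro A ⟨⟨S, hS⟩, S', hS'⟩
    exact ⟨⟨S', hS'⟩, S, by rwa [star_star]⟩

theorem isClosed_symbolDomain [CompleteSpace H] :
    IsClosed (symbolDomain V : Set (L2R →L[ℂ] L2R)) := by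
  refine isClosed_of_closure_subset fun A hA => ?_
  obtain ⟨x, hx, hlim⟩ := mem_closure_iff_seq_limit.1 hA
  choose T hT using fun k => (hx k).1
  choose T' hT' using fun k => (hx k).2
  exact ⟨IsSymbol.of_tendsto hT hlim, IsSymbol.of_tendsto hT' hlim.star⟩

/-- The homomorphism that maps an operator in `𝔄` to its symbol. -/
noncomputable def symbolHom [CompleteSpace H] (h : algA ≤ symbolDomain V) :
    algA →⋆ₐ[ℂ] C(P, H →L[ℂ] H) where
  -- The choice is immaterial since symbols are unique, and every law below is an instance of that
  -- uniqueness.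
  toFun A := (h A.2).1.choose
  map_one' := IsSymbol.unique (h (1 : algA).2).1.choose_spec fun _ => Intertwines.one
  map_mul' A B := IsSymbol.unique (h (A * B).2).1.choose_spec fun p =>
    ((h A.2).1.choose_spec p).mul ((h B.2).1.choose_spec p)
  map_zero' := IsSymbol.unique (h (0 : algA).2).1.choose_spec fun _ => Intertwines.zero
  map_add' A B := IsSymbol.unique (h (A + B).2).1.choose_spec fun p =>
    ((h A.2).1.choose_spec p).add ((h B.2).1.choose_spec p)
  commutes' c := IsSymbol.unique (h (algebraMap ℂ algA c).2).1.choose_spec fun p => by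
    have := (Intertwines.one (V := V p)).smul c
    rw [← Algebra.algebraMap_eq_smul_one] at this
    exact this
  map_star' A := ContinuousMap.ext fun p =>
    Intertwines.star_unique ((h A.2).1.choose_spec p) ((h (star A).2).1.choose_spec p)

theorem symbolHom_spec [CompleteSpace H] (h : algA ≤ symbolDomain V) (A : algA) :
    IsSymbol V A.1 (symbolHom h A) :=
  (h A.2).1.choose_spec

end Intertwining

/-! ### Reduction from 𝔄 to its generators. -/

section Generators

theorem star_multOp (a : C(EReal, ℂ)) : star (multOp a) = multOp (star a) :=
  mulOp_star _ _

theorem star_fourierOp (b : C(EReal, ℂ)) : star (fourierOp b) = fourierOp (star b) := by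
  rw [ContinuousLinearMap.star_eq_adjoint]
  refine ((ContinuousLinearMap.eq_adjoint_iff _ _).2 fun u v => ?_).symm
  set F := Lp.fourierTransformₗᵢ ℝ ℂ with hF
  have h := mulOp_star (memLp_ereal b (2 * Real.pi)) (memLp_ereal (star b) (2 * Real.pi))
  rw [ContinuousLinearMap.star_eq_adjoint] at h
  change inner ℂ (F.symm (mulOp volume _ (memLp_ereal (star b) (2 * Real.pi)) (F u))) v =
    inner ℂ u (F.symm (mulOp volume _ (memLp_ereal b (2 * Real.pi)) (F v)))
  have e1 : ∀ x y : L2R, inner ℂ (F.symm x) y = inner ℂ x (F y) := fun x y => by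
    rw [← F.inner_map_map, F.apply_symm_apply]
  have e2 : ∀ x y : L2R, inner ℂ x (F.symm y) = inner ℂ (F x) y := fun x y => by
    rw [← F.inner_map_map, F.apply_symm_apply]
  rw [e1, e2, ← ContinuousLinearMap.adjoint_inner_left, h]
  rfl

theorem star_circlePow (k : ℤ) : star (circlePow k) = circlePow (-k) := by
  ext z
  change (starRingEnd ℂ) ((z ^ k : Circle) : ℂ) = ((z ^ (-k) : Circle) : ℂ)
  rw [zpow_neg, Circle.coe_inv_eq_conj]

theorem topologicalClosure_adjoin_circlePow :
    (StarAlgebra.adjoin ℂ {circlePow 1}).topologicalClosure = ⊤ := by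
  refine ContinuousMap.starSubalgebra_topologicalClosure_eq_top_of_separatesPoints _ ?_
  intro x y hxy
  refine ⟨_, ⟨circlePow 1, StarAlgebra.subset_adjoin ℂ _ rfl, rfl⟩, fun h => hxy ?_⟩
  have h' : ((x ^ (1 : ℤ) : Circle) : ℂ) = ((y ^ (1 : ℤ) : Circle) : ℂ) := h
  rw [zpow_one, zpow_one] at h'
  exact Circle.ext h'

theorem continuous_periodicHom : Continuous periodicHom :=
  AddMonoidHomClass.continuous_of_bound periodicHom 1 fun a => by
    rw [one_mul]
    exact NonUnitalStarAlgHom.norm_apply_le periodicHom a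

/-- A closed star subalgebra that contains the generators of `𝔄` contains `𝔄`. -/
theorem algA_le {S : StarSubalgebra ℂ (L2R →L[ℂ] L2R)} (hS : IsClosed (S : Set (L2R →L[ℂ] L2R)))
    (h1 : ∀ a, multOp a ∈ S) (h2 : periodicOp (circlePow 1) ∈ S) (h3 : ∀ b, fourierOp b ∈ S) :
    algA ≤ S := by
  refine StarSubalgebra.topologicalClosure_minimal (StarAlgebra.adjoin_le ?_) hS
  rintro _ ((⟨a, rfl⟩ | ⟨p, rfl⟩) | ⟨b, rfl⟩)
  · exact h1 a
  -- By Stone–Weierstrass e^{ix} generates C(S¹), so the preimage of `S` under p ↦ `periodicOp p` is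
  -- everything.
  · have h4 : (StarAlgebra.adjoin ℂ {circlePow 1}).topologicalClosure ≤
        S.comap (algA.subtype.comp periodicHom) := by
      refine StarSubalgebra.topologicalClosure_minimal (StarAlgebra.adjoin_le ?_) ?_
      · rintro _ rfl
        exact h2
      · exact hS.preimage (continuous_subtype_val.comp continuous_periodicHom)
    rw [topologicalClosure_adjoin_circlePow] at h4
    exact h4 (by trivial : p ∈ (⊤ : StarSubalgebra ℂ C(Circle, ℂ)))
  · exact h3 b

/-- Each family of generators is stable under adjoints, so symbols of the generators also provide
symbols of their adjoints. -/
theorem algA_le_symbolDomain {H : Type} [NormedAddCommGroup H] [InnerProductSpace ℂ H]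
    [CompleteSpace H] {P : Type} [TopologicalSpace P] [CompactSpace P]
    {V : P → ℕ → H →ₗᵢ[ℂ] L2R} (h1 : ∀ a, ∃ T, IsSymbol V (multOp a) T)
    (h2 : ∀ k, ∃ T, IsSymbol V (periodicOp (circlePow k)) T)
    (h3 : ∀ b, ∃ T, IsSymbol V (fourierOp b) T) : algA ≤ symbolDomain V := by
  refine algA_le isClosed_symbolDomain (fun a => ⟨h1 a, ?_⟩) ⟨h2 1, ?_⟩ fun b => ⟨h3 b, ?_⟩
  · rw [star_multOp]
    exact h1 _
  · have : star (periodicOp (circlePow 1)) = periodicOp (star (circlePow 1)) := mulOp_star _ _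
    rw [this, star_circlePow]
    exact h2 _
  · rw [star_fourierOp]
    exact h3 _

end Generators

/-! ### Orthonormal packets with a box profile. -/

section WavePackets

theorem memLp_exp (l : ℝ) :
    MemLp (fun x : ℝ => Complex.exp (l * x * Complex.I)) ∞ volume :=
  memLp_top_of_bound (C := 1) (Continuous.aestronglyMeasurable (by fun_prop))
    (Eventually.of_forall fun x => by
      rw [← Complex.ofReal_mul, Complex.norm_exp_ofReal_mul_I])

theorem memLp_exp_affine (l h r : ℝ) :
    MemLp (fun x : ℝ => Complex.exp (l * (h + r * x : ℝ) * Complex.I)) ∞ volume :=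
  memLp_top_of_bound (C := 1) (Continuous.aestronglyMeasurable (by fun_prop))
    (Eventually.of_forall fun x => by
      rw [← Complex.ofReal_mul, Complex.norm_exp_ofReal_mul_I])

theorem mulOp_exp_packet (l l' h : ℝ) {r : ℝ} (hr : 0 < r) (g : L2R) :
    mulOp volume _ (memLp_exp l') (packet l h hr g) = packet (l + l') h hr g := by
  ext1
  filter_upwards [mulOp_coeFn (memLp_exp l') (packet l h hr g), packet_coeFn l h hr g,
    packet_coeFn (l + l') h hr g] with x h1 h2 h3
  rw [h1, h2, h3]
  have : Complex.exp ((l + l' : ℝ) * x * Complex.I) =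
      Complex.exp (l * x * Complex.I) * Complex.exp (l' * x * Complex.I) := by
    rw [← Complex.exp_add]
    congr 1
    push_cast
    ring
  simp only [packetFun, this]
  ring

theorem inner_packet (l l' h : ℝ) {r : ℝ} (hr : 0 < r) (g : L2R) :
    inner ℂ (packet l h hr g) (packet (l + l') h hr g) =
      ∫ x, Complex.exp (l' * (h + r * x : ℝ) * Complex.I) * ((‖g x‖ ^ 2 : ℝ) : ℂ) := by
  rw [← mulOp_exp_packet, mulOp_packet _ _ _ _ (memLp_exp_affine l' h r), LinearIsometry.inner_map_map,
    L2.inner_def]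
  refine integral_congr_ae ?_
  filter_upwards [mulOp_coeFn (memLp_exp_affine l' h r) g] with x hx
  rw [hx, ← smul_eq_mul, inner_smul_right, inner_self_eq_norm_sq_to_K]
  norm_cast

/-- The function `(2π)^(-1/2)` on `(0, 2π]`, and `0` elsewhere. -/
noncomputable def boxFun (x : ℝ) : ℂ :=
  Set.indicator (Set.Ioc 0 (2 * Real.pi)) (fun _ => (((2 * Real.pi) ^ (-(1 / 2) : ℝ) : ℝ) : ℂ)) x

theorem memLp_boxFun : MemLp boxFun 2 (volume : Measure ℝ) :=
  memLp_indicator_const 2 measurableSet_Ioc _ (Or.inr measure_Ioc_lt_top.ne)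

/-- The normalized characteristic function of `(0, 2π]`. -/
noncomputable def box : L2R := memLp_boxFun.toLp

theorem integral_box (f : ℝ → ℂ) : ∫ x, f x * ((‖box x‖ ^ 2 : ℝ) : ℂ) =
    ((2 * Real.pi : ℝ) : ℂ)⁻¹ * ∫ x in (0 : ℝ)..(2 * Real.pi), f x := by
  have hp : (0 : ℝ) < 2 * Real.pi := by positivity
  rw [intervalIntegral.integral_of_le hp.le, ← integral_const_mul,
    ← integral_indicator measurableSet_Ioc]
  refine integral_congr_ae ?_
  filter_upwards [memLp_boxFun.coeFn_toLp] with x hx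
  have hx' : box x = boxFun x := hx
  rw [hx', boxFun]
  by_cases h : x ∈ Set.Ioc 0 (2 * Real.pi)
  · simp only [Set.indicator_of_mem h, Complex.norm_real]
    rw [mul_comm, Real.norm_of_nonneg (by positivity), ← Real.rpow_natCast, ← Real.rpow_mul hp.le]
    have : -(1 / 2 : ℝ) * ((2 : ℕ) : ℝ) = -1 := by norm_num
    rw [this, Real.rpow_neg_one, Complex.ofReal_inv]
  · simp [Set.indicator_of_notMem h]

theorem norm_box : ‖box‖ = 1 := by
  have h1 := integral_box (fun _ => 1)
  have h2 : ((‖box‖ ^ 2 : ℝ) : ℂ) = 1 := by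
    rw [norm_sq_eq_integral, ← integral_complex_ofReal]
    simp only [one_mul] at h1
    rw [h1, intervalIntegral.integral_const, Complex.real_smul, mul_one, sub_zero]
    exact inv_mul_cancel₀ (Complex.ofReal_ne_zero.2 (by positivity))
  have h3 : ‖box‖ ^ 2 = 1 := by exact_mod_cast h2
  nlinarith [norm_nonneg box]

theorem integral_exp_int {k : ℤ} (hk : k ≠ 0) (h : ℝ) :
    ∫ x in (0 : ℝ)..(2 * Real.pi), Complex.exp ((h + k * x : ℝ) * Complex.I) = 0 := by
  have hc : (k : ℂ) * Complex.I ≠ 0 := mul_ne_zero (Int.cast_ne_zero.2 hk) Complex.I_ne_zero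
  have h1 : ∀ x : ℝ, Complex.exp ((h + k * x : ℝ) * Complex.I) =
      Complex.exp (h * Complex.I) * Complex.exp (k * Complex.I * x) := fun x => by
    rw [← Complex.exp_add]
    congr 1
    push_cast
    ring
  simp only [h1]
  rw [intervalIntegral.integral_const_mul, integral_exp_mul_complex hc]
  have h2 : Complex.exp (k * Complex.I * (2 * Real.pi : ℝ)) = 1 := by
    rw [Complex.exp_eq_one_iff]
    exact ⟨k, by push_cast; ring⟩
  rw [h2]
  simp

/-- The frequencies differ by integers and the width n+1 is an integer; after rescaling, the inner
product integrates e^{i(k−j)(n+1)x} over an interval of length 2π. The box profile and the integer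
widths are chosen for this orthogonality. -/
theorem orthonormal_packet (l h : ℝ) (n : ℕ) :
    Orthonormal ℂ fun j : ℤ => packet (j + l) h (Nat.cast_add_one_pos n) box := by
  rw [orthonormal_iff_ite]
  intro j k
  split_ifs with hjk
  · subst hjk
    rw [inner_self_eq_norm_sq_to_K, LinearIsometry.norm_map, norm_box]
    simp
  · have h1 : (k : ℝ) + l = (j + l) + ((k - j : ℤ) : ℝ) := by push_cast; ring
    rw [h1, inner_packet, integral_box]
    have h2 := integral_exp_int (k := (k - j) * (n + 1))
      (mul_ne_zero (sub_ne_zero.2 (Ne.symm hjk)) (by positivity)) ((k - j : ℤ) * h)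
    convert mul_zero _
    rw [← h2]
    congr 1
    ext x
    congr 2
    push_cast
    ring

end WavePackets

/-! ### Sequences tending to ±∞. -/

section Endpoints

theorem tendsto_inv_nat : Tendsto (fun n : ℕ => ((n : ℝ) + 1)⁻¹) atTop (𝓝 0) :=
  tendsto_inv_atTop_zero.comp (tendsto_atTop_add_const_right _ _ tendsto_natCast_atTop_atTop)

/-- The quadratic displacement beats the linear spread (n+1)y for every fixed y. It serves the
frequencies of the packets for σ, with c = 1, and their positions for γ, with c = 2π. -/
theorem tendsto_endpoint {c : ℝ} (hc : 0 < c) (s : ℤˣ) (d y : ℝ) :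
    Tendsto (fun n : ℕ => (((s : ℤ) * c * ((n : ℝ) + 1) ^ 2 + d + ((n : ℝ) + 1) * y : ℝ) : EReal))
      atTop (𝓝 (endpoint s)) := by
  have h1 : Tendsto (fun n : ℕ => (n : ℝ) + 1) atTop atTop :=
    tendsto_atTop_add_const_right _ _ tendsto_natCast_atTop_atTop
  have h2 : ∀ y d : ℝ, Tendsto (fun n : ℕ => ((n : ℝ) + 1) * (c * ((n : ℝ) + 1) + y) + d) atTop
      atTop := fun y d => tendsto_atTop_add_const_right _ _
        (h1.atTop_mul_atTop₀ (tendsto_atTop_add_const_right _ _ (h1.const_mul_atTop hc)))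
  rcases Int.units_eq_one_or s with rfl | rfl
  · rw [endpoint, if_pos rfl]
    refine EReal.tendsto_coe_nhds_top_iff.2 ((h2 y d).congr fun n => ?_)
    push_cast
    ring
  · rw [endpoint, if_neg (by decide)]
    refine EReal.tendsto_coe_nhds_bot_iff.2 ?_
    refine (tendsto_neg_atTop_atBot.comp (h2 (-y) (-d))).congr fun n => ?_
    simp only [Function.comp_apply]
    push_cast
    ring

end Endpoints

/-! ### Construction of the principal symbol. -/

section PrincipalSymbol

/-- A sequence of real numbers that converges to `x` in `[-∞, +∞]` and whose images on the circle
are constant, equal to `e^{iθ}`, for `(x, e^{iθ}) ∈ X`. -/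
noncomputable def center (m : EReal × Circle) (n : ℕ) : ℝ :=
  if m.1 = ⊤ then Complex.arg m.2 + 2 * Real.pi * n
  else if m.1 = ⊥ then Complex.arg m.2 - 2 * Real.pi * n else m.1.toReal

theorem exp_center {m : EReal × Circle} (hm : m ∈ spaceX) (n : ℕ) :
    Circle.exp (center m n) = m.2 := by
  have h1 : Circle.exp (2 * Real.pi * n) = 1 := by
    rw [Circle.exp_eq_one]
    exact ⟨n, by push_cast; ring⟩
  rcases hm with h | h | ⟨θ, h, h'⟩
  · simp [center, h, Circle.exp_add, h1, Circle.exp_arg]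
  · simp [center, h, Circle.exp_sub, h1, Circle.exp_arg]
  · simp [center, h, h']

theorem tendsto_center {m : EReal × Circle} (hm : m ∈ spaceX) (y : ℝ) :
    Tendsto (fun n : ℕ => ((center m n + ((n : ℝ) + 1)⁻¹ * y : ℝ) : EReal)) atTop (𝓝 m.1) := by
  have h0 : Tendsto (fun n : ℕ => ((n : ℝ) + 1)⁻¹ * y) atTop (𝓝 0) := by
    simpa using tendsto_inv_nat.mul_const y
  have h1 : Tendsto (fun n : ℕ => 2 * Real.pi * (n : ℝ)) atTop atTop :=
    tendsto_natCast_atTop_atTop.const_mul_atTop (by positivity)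
  rcases hm with h | h | ⟨θ, h, h'⟩
  · rw [h]
    refine EReal.tendsto_coe_nhds_top_iff.2 ?_
    simp only [center, h, if_true]
    exact (tendsto_atTop_add_const_left _ _ h1).atTop_add h0
  · rw [h]
    refine EReal.tendsto_coe_nhds_bot_iff.2 ?_
    simp only [center, h, if_true, if_neg bot_ne_top, sub_eq_add_neg]
    exact (tendsto_atBot_add_const_left _ _ (tendsto_neg_atTop_atBot.comp h1)).atBot_add h0
  · rw [h]
    refine (continuous_coe_real_ereal.tendsto θ).comp ?_
    simp only [center, h, EReal.coe_ne_top, EReal.coe_ne_bot, if_false, EReal.toReal_coe]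
    simpa using h0.const_add θ

/-- The isometries `ℂ → L²(ℝ)` onto the lines spanned by wave packets that are concentrated at the
point `m` and have frequencies that tend to the endpoint `s`. -/
noncomputable def symbolIso (p : spaceX × ℤˣ) (n : ℕ) : ℂ →ₗᵢ[ℂ] L2R :=
  LinearIsometry.toSpanSingleton ℂ L2R
    -- The profile shrinks like 1/(n+1) in space and spreads like n+1 in frequency, which is
    -- negligible against (n+1)². The factor 1 and the summand 0 give the shape used in
    -- `tendsto_endpoint`.
    (v := packet ((p.2 : ℤ) * 1 * ((n : ℝ) + 1) ^ 2 + 0) (center p.1.1 n)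
      (inv_pos.2 (Nat.cast_add_one_pos n)) box)
    (by rw [LinearIsometry.norm_map, norm_box])

theorem intertwines_symbolIso {A : L2R →L[ℂ] L2R} {c : ℂ} {p : spaceX × ℤˣ}
    (h : Tendsto (fun n : ℕ => A (packet ((p.2 : ℤ) * 1 * ((n : ℝ) + 1) ^ 2 + 0) (center p.1.1 n)
      (inv_pos.2 (Nat.cast_add_one_pos n)) box) -
      c • (packet ((p.2 : ℤ) * 1 * ((n : ℝ) + 1) ^ 2 + 0) (center p.1.1 n)
      (inv_pos.2 (Nat.cast_add_one_pos n)) box)) atTop (𝓝 0)) :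
    Intertwines (symbolIso p) A (c • 1) := by
  intro a
  have h1 := h.const_smul a
  rw [smul_zero] at h1
  refine h1.congr fun n => ?_
  simp only [symbolIso, LinearIsometry.toSpanSingleton_apply, smul_sub, map_smul, smul_apply,
    one_apply_eq_self]
  rw [smul_comm a c]

theorem intertwines_symbolIso_multOp (a : C(EReal, ℂ)) (p : spaceX × ℤˣ) :
    Intertwines (symbolIso p) (multOp a) (a p.1.1.1 • 1) := by
  refine intertwines_symbolIso (tendsto_mulOp_packet _
    (a.continuous.comp continuous_coe_real_ereal) (fun x => a.norm_coe_le_norm _) _ _ _ _ _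
    (fun y => ?_) _)
  exact (a.continuous.tendsto _).comp (tendsto_center p.1.2 y)

theorem intertwines_symbolIso_periodicOp (q : C(Circle, ℂ)) (p : spaceX × ℤˣ) :
    Intertwines (symbolIso p) (periodicOp q) (q p.1.1.2 • 1) := by
  refine intertwines_symbolIso (tendsto_mulOp_packet _
    (q.continuous.comp Circle.exp.continuous) (fun x => q.norm_coe_le_norm _) _ _ _ _ _
    (fun y => ?_) _)
  refine (q.continuous.tendsto _).comp ?_
  have h0 : Tendsto (fun n : ℕ => ((n : ℝ) + 1)⁻¹ * y) atTop (𝓝 0) := by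
    simpa using tendsto_inv_nat.mul_const y
  -- The centres have a constant image on the circle, so only the shrinking displacement y/(n+1) has
  -- to be controlled.
  have h1 := ((Circle.exp.continuous.tendsto 0).comp h0).const_mul p.1.1.2
  rw [Circle.exp_zero, mul_one] at h1
  refine h1.congr fun n => ?_
  rw [Circle.exp_add, exp_center p.1.2]
  rfl

theorem intertwines_symbolIso_fourierOp (b : C(EReal, ℂ)) (p : spaceX × ℤˣ) :
    Intertwines (symbolIso p) (fourierOp b) (b (endpoint p.2) • 1) := by
  refine intertwines_symbolIso (tendsto_fourierOp_packet _ _ _ _ _ _ (fun y => ?_) _)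
  refine ((b.continuous.tendsto _).comp (tendsto_endpoint one_pos p.2 0 y)).congr fun n => ?_
  simp only [Function.comp_apply, inv_inv]

theorem algA_le_symbolDomain_symbolIso : algA ≤ symbolDomain symbolIso := by
  refine algA_le_symbolDomain (fun a => ?_) (fun k => ?_) (fun b => ?_)
  · exact ⟨⟨fun p => a p.1.1.1 • 1, by fun_prop⟩, intertwines_symbolIso_multOp a⟩
  · exact ⟨⟨fun p => circlePow k p.1.1.2 • 1, by fun_prop⟩,
      intertwines_symbolIso_periodicOp _⟩
  · exact ⟨⟨fun p => b (endpoint p.2) • 1, by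
      have : Continuous endpoint := continuous_of_discreteTopology
      fun_prop⟩, intertwines_symbolIso_fourierOp b⟩

/-- Operators on `ℂ` are numbers. -/
noncomputable def evalOne : (ℂ →L[ℂ] ℂ) →⋆ₐ[ℂ] ℂ where
  toFun T := T 1
  map_one' := rfl
  map_mul' S T := by
    change S (T 1) = S 1 * T 1
    conv_lhs => rw [← mul_one (T 1), ← smul_eq_mul, map_smul, smul_eq_mul, mul_comm]
  map_zero' := rfl
  map_add' _ _ := rfl
  commutes' c := by simp [Algebra.algebraMap_eq_smul_one]
  map_star' T := by
    have h := ContinuousLinearMap.adjoint_inner_left T (1 : ℂ) (1 : ℂ)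
    simp only [RCLike.inner_apply, map_one, mul_one, one_mul] at h
    rw [ContinuousLinearMap.star_eq_adjoint]
    have := congrArg (starRingEnd ℂ) h
    simpa using this

theorem continuous_evalOne : Continuous evalOne :=
  (ContinuousLinearMap.apply ℂ ℂ (1 : ℂ)).continuous

/-- The principal symbol. -/
noncomputable def principalSymbol : algA →⋆ₐ[ℂ] C(spaceX × ℤˣ, ℂ) where
  toFun A := ⟨fun p => evalOne (symbolHom algA_le_symbolDomain_symbolIso A p),
    continuous_evalOne.comp (ContinuousMap.continuous _)⟩
  map_one' := ContinuousMap.ext fun p => by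
    rw [map_one]
    exact map_one evalOne
  map_mul' A B := ContinuousMap.ext fun p => by
    rw [map_mul]
    exact map_mul evalOne _ _
  map_zero' := ContinuousMap.ext fun p => by
    rw [map_zero]
    exact map_zero evalOne
  map_add' A B := ContinuousMap.ext fun p => by
    rw [map_add]
    exact map_add evalOne _ _
  commutes' c := ContinuousMap.ext fun p => by
    rw [AlgHomClass.commutes]
    exact AlgHomClass.commutes evalOne c
  map_star' A := ContinuousMap.ext fun p => by
    rw [map_star]
    exact map_star evalOne _

theorem principalSymbol_apply {A : algA} {p : spaceX × ℤˣ} {c : ℂ}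
    (h : Intertwines (symbolIso p) A.1 (c • 1)) : principalSymbol A p = c := by
  have h1 := (symbolHom_spec algA_le_symbolDomain_symbolIso A p).unique h
  change (symbolHom algA_le_symbolDomain_symbolIso A p) 1 = c
  rw [h1]
  simp

theorem isPrincipalSymbol_principalSymbol : IsPrincipalSymbol principalSymbol where
  mult a m s := principalSymbol_apply (intertwines_symbolIso_multOp a (m, s))
  periodic q m s := principalSymbol_apply (intertwines_symbolIso_periodicOp q (m, s))
  fourier b m s := principalSymbol_apply (intertwines_symbolIso_fourierOp b (m, s))

end PrincipalSymbol

/-! ### The standard basis of ℓ²(ℤ) and conjugation by the discrete Fourier transform. -/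

section Basis

/-- The standard basis vectors of `ℓ²(ℤ)`. -/
noncomputable def basisVec (j : ℤ) : L2Z := lp.single 2 j (1 : ℂ)

theorem dense_span_basisVec : Dense (Submodule.span ℂ (Set.range basisVec) : Set L2Z) := by
  intro a
  refine mem_closure_of_tendsto (lp.hasSum_single (p := 2) (by simp) a)
    (Eventually.of_forall fun s => Submodule.sum_mem _ fun j _ => ?_)
  have : lp.single 2 j (a j) = (a j) • basisVec j := by
    rw [basisVec, ← lp.single_smul, smul_eq_mul, mul_one]
  rw [this]
  exact Submodule.smul_mem _ _ (Submodule.subset_span ⟨j, rfl⟩)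

theorem algB_ext {S T : algB} (h : ∀ j, S (basisVec j) = T (basisVec j)) : S = T :=
  ContinuousLinearMap.ext_on dense_span_basisVec (by
    rintro _ ⟨j, rfl⟩
    exact h j)

theorem discreteFourier_fourierBasis (j : ℤ) :
    discreteFourier (fourierBasis j) = basisVec j :=
  fourierBasis.repr_self j

theorem discreteFourier_symm_basisVec (j : ℤ) :
    discreteFourier.symm (basisVec j) = fourierBasis j := by
  rw [← discreteFourier_fourierBasis, LinearIsometryEquiv.symm_apply_apply]

end Basis

section Conj

/-- The conjugate of an operator on `L²(S¹)` by the discrete Fourier transform. -/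
noncomputable def fourierConj
    (S : Lp ℂ 2 (AddCircle.haarAddCircle (T := 1)) →L[ℂ] Lp ℂ 2 (AddCircle.haarAddCircle (T := 1))) :
    algB :=
  discreteFourier.toContinuousLinearEquiv.toContinuousLinearMap ∘L S ∘L
    discreteFourier.symm.toContinuousLinearEquiv.toContinuousLinearMap

variable (S T : Lp ℂ 2 (AddCircle.haarAddCircle (T := 1)) →L[ℂ]
  Lp ℂ 2 (AddCircle.haarAddCircle (T := 1)))

theorem fourierConj_apply (a : L2Z) :
    fourierConj S a = discreteFourier (S (discreteFourier.symm a)) := rfl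

theorem fourierConj_mul : fourierConj (S * T) = fourierConj S * fourierConj T := by
  ext1 a
  change discreteFourier (S (T (discreteFourier.symm a))) = discreteFourier (S
    (discreteFourier.symm (discreteFourier (T (discreteFourier.symm a)))))
  rw [LinearIsometryEquiv.symm_apply_apply]

theorem fourierConj_add : fourierConj (S + T) = fourierConj S + fourierConj T := by
  ext1 a
  exact map_add discreteFourier _ _

theorem fourierConj_sub : fourierConj (S - T) = fourierConj S - fourierConj T := by
  ext1 a
  exact map_sub discreteFourier _ _

theorem fourierConj_smul (c : ℂ) : fourierConj (c • S) = c • fourierConj S := by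
  ext1 a
  rw [smul_apply, fourierConj_apply, fourierConj_apply, smul_apply]
  exact discreteFourier.toLinearEquiv.map_smul c (S (discreteFourier.symm a))

theorem fourierConj_one : fourierConj 1 = 1 := by
  ext1 a
  exact discreteFourier.apply_symm_apply a

theorem norm_fourierConj_le : ‖fourierConj S‖ ≤ ‖S‖ := by
  refine ContinuousLinearMap.opNorm_le_bound _ (norm_nonneg _) fun a => ?_
  rw [fourierConj_apply, LinearIsometryEquiv.norm_map, ← discreteFourier.symm.norm_map a]
  exact S.le_opNorm _

end Conj

/-! ### The unitary group Y_φ. -/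

section OpY

theorem opY_eq (φ : ℝ) : opY φ = fourierConj (opU φ) := rfl

/-- With one fixed branch of the logarithm the exponents add pointwise, even where z^{−φ} jumps. So
φ ↦ Y_φ is a one-parameter group. -/
theorem opY_add (φ ψ : ℝ) : opY (φ + ψ) = opY φ * opY ψ := by
  rw [opY_eq, opY_eq, opY_eq, ← fourierConj_mul]
  congr 1
  have h : ∀ x : UnitAddCircle, ((AddCircle.toCircle x : Circle) : ℂ) ^ (-(φ : ℂ)) *
      ((AddCircle.toCircle x : Circle) : ℂ) ^ (-(ψ : ℂ)) =
      ((AddCircle.toCircle x : Circle) : ℂ) ^ (-((φ + ψ : ℝ) : ℂ)) := fun x => by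
    rw [← Complex.cpow_add _ _ (Circle.coe_ne_zero _)]
    congr 1
    push_cast
    ring
  have h' := memLp_cpow (φ + ψ)
  simp only [← h] at h'
  rw [opU, opU, opU, mulOp_mul _ _ h']
  exact (mulOp_congr _ _ h).symm

theorem opY_zero : opY 0 = 1 := by
  rw [opY_eq, ← fourierConj_one]
  congr 1
  have h : MemLp (fun _ : UnitAddCircle => (1 : ℂ)) ∞ AddCircle.haarAddCircle :=
    memLp_top_const 1
  rw [opU, mulOp_congr _ h (fun x => by simp), mulOp_const, one_smul]

theorem opY_mul_opY_neg (φ : ℝ) : opY φ * opY (-φ) = 1 := by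
  rw [← opY_add, add_neg_cancel, opY_zero]

theorem opY_neg_mul_opY (φ : ℝ) : opY (-φ) * opY φ = 1 := by
  rw [← opY_add, neg_add_cancel, opY_zero]

theorem opY_comm (φ ψ : ℝ) : opY φ * opY ψ = opY ψ * opY φ := by
  rw [← opY_add, ← opY_add, add_comm]

theorem norm_opY_le (φ : ℝ) : ‖opY φ‖ ≤ 1 :=
  (norm_fourierConj_le _).trans (norm_mulOp_le _ zero_le_one fun x => by
    rw [← Complex.ofReal_neg, Complex.norm_cpow_real, Circle.norm_coe, Real.one_rpow])

/-- The operator `Y_φ` as a linear isometry. -/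
noncomputable def isoY (φ : ℝ) : L2Z →ₗᵢ[ℂ] L2Z where
  toLinearMap := (opY φ : L2Z →ₗ[ℂ] L2Z)
  norm_map' a := by
    refine le_antisymm (((opY φ).le_of_opNorm_le (norm_opY_le φ) a).trans_eq (one_mul _)) ?_
    have h : opY (-φ) (opY φ a) = a := congrArg (fun T : algB => T a) (opY_neg_mul_opY φ)
    calc ‖a‖ = ‖opY (-φ) (opY φ a)‖ := by rw [h]
      _ ≤ 1 * ‖opY φ a‖ := (opY (-φ)).le_of_opNorm_le (norm_opY_le _) _
      _ = ‖opY φ a‖ := one_mul _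

theorem mulOp_sub {α : Type} [MeasurableSpace α] {μ : Measure α} {f g : α → ℂ} (hf : MemLp f ∞ μ)
    (hg : MemLp g ∞ μ) (hfg : MemLp (fun x => f x - g x) ∞ μ) :
    mulOp μ f hf - mulOp μ g hg = mulOp μ (fun x => f x - g x) hfg := by
  rw [sub_eq_iff_eq_add, mulOp_add hfg hg (by simpa using hf)]
  exact mulOp_congr _ _ fun x => (sub_add_cancel _ _).symm

theorem circle_cpow (z : Circle) (φ : ℝ) :
    (z : ℂ) ^ (-(φ : ℂ)) = Complex.exp ((-(φ * Complex.arg z) : ℝ) * Complex.I) := by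
  rw [Complex.cpow_def_of_ne_zero (Circle.coe_ne_zero z), Complex.log, Circle.norm_coe]
  congr 1
  push_cast
  simp
  ring

/-- Since |arg z| ≤ π, the function φ ↦ z^{−φ} has Lipschitz constant π uniformly in z; hence the
group is norm continuous. -/
theorem norm_opY_sub_le (φ ψ : ℝ) : ‖opY φ - opY ψ‖ ≤ Real.pi * |φ - ψ| := by
  rw [opY_eq, opY_eq, ← fourierConj_sub, opU, opU,
    mulOp_sub _ _ ((memLp_cpow φ).sub (memLp_cpow ψ))]
  refine (norm_fourierConj_le _).trans (norm_mulOp_le _ (by positivity) fun x => ?_)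
  rw [circle_cpow, circle_cpow]
  set t := Complex.arg (AddCircle.toCircle x : Circle)
  have h1 : Complex.exp ((-(φ * t) : ℝ) * Complex.I) - Complex.exp ((-(ψ * t) : ℝ) * Complex.I) =
      Complex.exp ((-(ψ * t) : ℝ) * Complex.I) *
        (Complex.exp (Complex.I * ((ψ - φ) * t : ℝ)) - 1) := by
    rw [mul_sub, ← Complex.exp_add, mul_one]
    congr 2
    push_cast
    ring
  rw [h1, norm_mul, Complex.norm_exp_ofReal_mul_I, one_mul]
  refine (Real.norm_exp_I_mul_ofReal_sub_one_le).trans ?_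
  rw [Real.norm_eq_abs, abs_mul, mul_comm, abs_sub_comm]
  exact mul_le_mul_of_nonneg_right (Complex.abs_arg_le_pi _) (abs_nonneg _)

theorem continuous_opY : Continuous opY := by
  refine (LipschitzWith.of_dist_le_mul (K := ⟨Real.pi, Real.pi_nonneg⟩) fun φ ψ => ?_).continuous
  rw [dist_eq_norm, Real.dist_eq]
  exact norm_opY_sub_le φ ψ

theorem toCircle_zpow_eq_fourier (j : ℤ) (x : UnitAddCircle) :
    ((AddCircle.toCircle x ^ j : Circle) : ℂ) = fourier j x := by
  rw [fourier_apply, AddCircle.toCircle_zsmul]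

theorem mulOp_fourierBasis {f : UnitAddCircle → ℂ} (hf : MemLp f ∞ AddCircle.haarAddCircle) (k : ℤ)
    (h : ∀ x : UnitAddCircle, f x = ((AddCircle.toCircle x ^ k : Circle) : ℂ)) (j : ℤ) :
    mulOp AddCircle.haarAddCircle f hf (fourierBasis j) = fourierBasis (j + k) := by
  ext1
  rw [coe_fourierBasis]
  filter_upwards [mulOp_coeFn hf (fourierLp 2 j), coeFn_fourierLp 2 j, coeFn_fourierLp 2 (j + k)]
    with x h1 h2 h3
  rw [h1, h2, h3, h, toCircle_zpow_eq_fourier, fourier_add, mul_comm]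

/-- For an integer k the branch plays no role: z^k shifts the Fourier basis by k. -/
theorem opY_basisVec (k j : ℤ) : opY (-k) (basisVec j) = basisVec (j + k) := by
  rw [opY_eq, fourierConj_apply, discreteFourier_symm_basisVec, opU, mulOp_fourierBasis _ k,
    discreteFourier_fourierBasis]
  intro x
  rw [Circle.coe_zpow, ← Complex.cpow_intCast]
  congr 1
  push_cast
  ring

end OpY

/-! ### Diagonal operators and the boundary symbol of b(D). -/

section OpM

/-- The constant in `diagOp` only serves the proof of boundedness; replacing it does not change the
operator. -/
theorem norm_diagOp_le {c : ℤ → ℂ} {C D : ℝ} (hc : ∀ j, ‖c j‖ ≤ C) (hD : ∀ j, ‖c j‖ ≤ D) :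
    ‖diagOp c C hc‖ ≤ D := by
  have h : diagOp c C hc = diagOp c D hD := rfl
  rw [h]
  exact LinearMap.mkContinuous_norm_le _ ((norm_nonneg _).trans (hD 0)) _

theorem diagOp_basisVec {c : ℤ → ℂ} {C : ℝ} (hc : ∀ j, ‖c j‖ ≤ C) (j : ℤ) :
    diagOp c C hc (basisVec j) = c j • basisVec j := by
  ext i
  change c i * basisVec j i = c j * basisVec j i
  rw [basisVec, lp.single_apply]
  by_cases h : i = j
  · rw [h]
  · simp [h]

theorem diagOp_sub {c d : ℤ → ℂ} {C D E : ℝ} (hc : ∀ j, ‖c j‖ ≤ C) (hd : ∀ j, ‖d j‖ ≤ D)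
    (he : ∀ j, ‖c j - d j‖ ≤ E) :
    diagOp c C hc - diagOp d D hd = diagOp (fun j => c j - d j) E he := by
  refine algB_ext fun j => ?_
  rw [sub_apply, diagOp_basisVec, diagOp_basisVec, diagOp_basisVec, sub_smul]

theorem opM_basisVec (b : C(EReal, ℂ)) (φ : ℝ) (j : ℤ) :
    opM b φ (basisVec j) = b (((j : ℝ) - φ : ℝ) : EReal) • basisVec j :=
  diagOp_basisVec _ j

/-- The translates `x ↦ b(x - φ)` of a function on `[-∞, +∞]`. -/
noncomputable def translates (b : C(EReal, ℂ)) : C(ℝ, C(EReal, ℂ)) :=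
  ContinuousMap.curry
    { toFun := fun p : ℝ × EReal => b (p.2 + ((-p.1 : ℝ) : EReal))
      continuous_toFun := by
        refine b.continuous.comp ?_
        rw [continuous_iff_continuousAt]
        intro p
        -- Addition on [-∞, +∞] is continuous here because the second summand is finite.
        have h := EReal.continuousAt_add (p := (p.2, ((-p.1 : ℝ) : EReal)))
          (Or.inr (EReal.coe_ne_bot _)) (Or.inr (EReal.coe_ne_top _))
        exact ContinuousAt.comp (f := fun p : ℝ × EReal => (p.2, ((-p.1 : ℝ) : EReal))) h
          (continuous_snd.prodMk (continuous_coe_real_ereal.comp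
            continuous_fst.neg)).continuousAt }

theorem translates_apply (b : C(EReal, ℂ)) (φ x : ℝ) :
    translates b φ x = b ((x - φ : ℝ) : EReal) := by
  rw [sub_eq_add_neg, EReal.coe_add]
  rfl

theorem norm_opM_sub_le (b : C(EReal, ℂ)) (φ ψ : ℝ) :
    ‖opM b φ - opM b ψ‖ ≤ ‖translates b φ - translates b ψ‖ := by
  have h : ∀ j : ℤ, ‖b (((j : ℝ) - φ : ℝ) : EReal) - b (((j : ℝ) - ψ : ℝ) : EReal)‖ ≤
      ‖translates b φ - translates b ψ‖ := fun j => by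
    rw [← translates_apply, ← translates_apply]
    exact (translates b φ - translates b ψ).norm_coe_le_norm _
  rw [opM, opM, diagOp_sub _ _ h]
  exact norm_diagOp_le _ h

/-- [-∞, +∞] is compact, so joint continuity of b(x − φ) makes the translates of b continuous in the
sup norm, which dominates the operator norm. -/
theorem continuous_opM (b : C(EReal, ℂ)) : Continuous (opM b) := by
  rw [continuous_iff_continuousAt]
  intro φ
  rw [ContinuousAt, tendsto_iff_norm_sub_tendsto_zero]
  refine squeeze_zero (fun _ => norm_nonneg _) (fun ψ => norm_opM_sub_le b ψ φ) ?_
  exact tendsto_iff_norm_sub_tendsto_zero.1 ((translates b).continuous.tendsto φ)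

/-- Y_1 shifts the basis by −1 and carries M^b_{φ+1} to M^b_φ. This period 1 is what makes the
symbol of b(D) a function of e^{2πiφ}. -/
theorem opY_conj_opM (b : C(EReal, ℂ)) (φ : ℝ) :
    opY (φ + 1) * opM b (φ + 1) * opY (-(φ + 1)) = opY φ * opM b φ * opY (-φ) := by
  have h : opY 1 * opM b (φ + 1) * opY (-1) = opM b φ := by
    refine algB_ext fun j => ?_
    have h1 := opY_basisVec 1 j
    have h2 := opY_basisVec (-1) (j + 1)
    simp only [Int.cast_one, Int.cast_neg, neg_neg] at h1 h2
    rw [mul_apply_eq_comp, mul_apply_eq_comp, h1, opM_basisVec, map_smul, h2, opM_basisVec]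
    congr 3
    · push_cast; ring
    · ring
  rw [opY_add, neg_add_rev, opY_add (-1), ← h]
  simp only [mul_assoc]

/-- A continuous function on `ℝ` with period `1` defines a continuous function on the circle. -/
theorem exists_circle_lift {X : Type} [TopologicalSpace X] {f : ℝ → X} (hf : Continuous f)
    (hper : ∀ φ, f (φ + 1) = f φ) :
    ∃ g : C(Circle, X), ∀ φ : ℝ, g (Circle.exp (2 * Real.pi * φ)) = f φ := by
  have hp : Function.Periodic f 1 := hper
  have hc : Continuous hp.lift := continuous_coinduced_dom.2 hf
  refine ⟨⟨fun z => hp.lift ((AddCircle.homeomorphCircle (T := 1) one_ne_zero).symm z),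
    hc.comp (Homeomorph.continuous _)⟩, fun φ => ?_⟩
  have h1 : AddCircle.homeomorphCircle (T := 1) one_ne_zero (φ : AddCircle (1 : ℝ)) =
      Circle.exp (2 * Real.pi * φ) := by
    rw [AddCircle.homeomorphCircle_apply, AddCircle.toCircle_apply_mk, div_one]
  change hp.lift ((AddCircle.homeomorphCircle (T := 1) one_ne_zero).symm _) = _
  rw [← h1, Homeomorph.symm_apply_apply]
  rfl

theorem exists_fourier_symbol (b : C(EReal, ℂ)) :
    ∃ g : C(Circle, algB), ∀ φ : ℝ, g (Circle.exp (2 * Real.pi * φ)) =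
      opY φ * opM b φ * opY (-φ) := by
  refine exists_circle_lift ?_ (opY_conj_opM b)
  exact (continuous_opY.mul (continuous_opM b)).mul (continuous_opY.comp continuous_neg)

end OpM

/-! ### Construction of the boundary symbol. -/

section BoundarySymbol

/-- A real number `φ` with `e^{2πiφ} = z`. -/
noncomputable def phase (z : Circle) : ℝ := Complex.arg z / (2 * Real.pi)

theorem exp_phase (z : Circle) : Circle.exp (2 * Real.pi * phase z) = z := by
  rw [phase, mul_div_cancel₀ _ (by positivity), Circle.exp_arg]

/-- The isometry `ℓ²(ℤ) → L²(ℝ)` that maps the `j`-th basis vector to a wave packet of frequency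
`j - φ`. -/
noncomputable def packetIso (φ : ℝ) (s : ℤˣ) (n : ℕ) : L2Z →ₗᵢ[ℂ] L2R :=
  (orthonormal_packet (-φ) ((s : ℤ) * (2 * Real.pi) * ((n : ℝ) + 1) ^ 2 + 0)
    n).orthogonalFamily.linearIsometry

theorem packetIso_basisVec (φ : ℝ) (s : ℤˣ) (n : ℕ) (j : ℤ) : packetIso φ s n (basisVec j) =
    packet (j + -φ) ((s : ℤ) * (2 * Real.pi) * ((n : ℝ) + 1) ^ 2 + 0)
      (Nat.cast_add_one_pos n) box := by
  rw [packetIso, basisVec, OrthogonalFamily.linearIsometry_apply_single,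
    LinearIsometry.toSpanSingleton_apply, one_smul]

theorem intertwines_packetIso_diag {A : L2R →L[ℂ] L2R} {T : algB} {φ : ℝ} {s : ℤˣ} {c : ℤ → ℂ}
    (hT : ∀ j, T (basisVec j) = c j • basisVec j)
    (h : ∀ j : ℤ, Tendsto (fun n : ℕ => A (packet (j + -φ)
      ((s : ℤ) * (2 * Real.pi) * ((n : ℝ) + 1) ^ 2 + 0) (Nat.cast_add_one_pos n) box) -
      c j • packet (j + -φ) ((s : ℤ) * (2 * Real.pi) * ((n : ℝ) + 1) ^ 2 + 0)
        (Nat.cast_add_one_pos n) box) atTop (𝓝 0)) :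
    Intertwines (packetIso φ s) A T := by
  refine Intertwines.of_total dense_span_basisVec ?_
  rintro _ ⟨j, rfl⟩
  simp only [hT, map_smul, packetIso_basisVec]
  exact h j

theorem intertwines_packetIso_multOp (a : C(EReal, ℂ)) (φ : ℝ) (s : ℤˣ) :
    Intertwines (packetIso φ s) (multOp a) (a (endpoint s) • 1) := by
  refine intertwines_packetIso_diag (c := fun _ => a (endpoint s)) (fun j => rfl) fun j => ?_
  refine tendsto_mulOp_packet _ (a.continuous.comp continuous_coe_real_ereal)
    (fun x => a.norm_coe_le_norm _) _ (fun _ => j + -φ) _ (fun n => (n : ℝ) + 1) _ (fun y => ?_) _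
  exact (a.continuous.tendsto _).comp (tendsto_endpoint (by positivity) s 0 y)

/-- On the Fourier side the width shrinks like 1/(n+1) around the frequency j − φ, so in the limit b
is sampled there. -/
theorem intertwines_packetIso_fourierOp (b : C(EReal, ℂ)) (φ : ℝ) (s : ℤˣ) :
    Intertwines (packetIso φ s) (fourierOp b) (opM b φ) := by
  refine intertwines_packetIso_diag (opM_basisVec b φ) fun j => ?_
  refine tendsto_fourierOp_packet b _ (fun _ => j + -φ) _ (fun n => (n : ℝ) + 1) _ (fun y => ?_) _
  refine ((b.continuous.comp continuous_coe_real_ereal).tendsto _).comp ?_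
  have h0 : Tendsto (fun n : ℕ => ((n : ℝ) + 1)⁻¹ * y) atTop (𝓝 0) := by
    simpa using tendsto_inv_nat.mul_const y
  simpa [sub_eq_add_neg] using h0.const_add ((j : ℝ) + -φ)

theorem periodicOp_circlePow_packet (k : ℤ) (l h : ℝ) {r : ℝ} (hr : 0 < r) (g : L2R) :
    periodicOp (circlePow k) (packet l h hr g) = packet (l + k) h hr g := by
  rw [← mulOp_exp_packet, periodicOp]
  congr 1
  refine mulOp_congr _ _ fun x => ?_
  change ((Circle.exp x ^ k : Circle) : ℂ) = _
  rw [Circle.coe_zpow, Circle.coe_exp, ← Complex.exp_int_mul]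
  congr 1
  push_cast
  ring

theorem intertwines_packetIso_periodicOp (k : ℤ) (φ : ℝ) (s : ℤˣ) :
    Intertwines (packetIso φ s) (periodicOp (circlePow k)) (opY (-k)) := by
  refine Intertwines.of_total dense_span_basisVec ?_
  rintro _ ⟨j, rfl⟩
  -- No limit is involved: e_k shifts the frequency by exactly k, and the difference vanishes for
  -- each n.
  refine tendsto_const_nhds.congr fun n => ?_
  rw [opY_basisVec, packetIso_basisVec, packetIso_basisVec, periodicOp_circlePow_packet, eq_comm,
    sub_eq_zero]
  congr 2
  push_cast
  ring

/-- The isometries `ℓ²(ℤ) → L²(ℝ)` that define the boundary principal symbol. -/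
noncomputable def boundaryIso (p : Circle × ℤˣ) (n : ℕ) : L2Z →ₗᵢ[ℂ] L2R :=
  (packetIso (phase p.1) p.2 n).comp (isoY (-phase p.1))

/-- Precomposition with Y_{−φ} conjugates the symbol. The symbols of a(M) and e_k commute with Y_φ
and do not change; that of b(D) becomes periodic in φ. -/
theorem intertwines_boundaryIso {A : L2R →L[ℂ] L2R} {T : algB} {p : Circle × ℤˣ}
    (h : Intertwines (packetIso (phase p.1) p.2) A T) :
    Intertwines (boundaryIso p) A (opY (phase p.1) * T * opY (-phase p.1)) := by
  intro a
  refine (h (opY (-phase p.1) a)).congr fun n => ?_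
  change _ = A (packetIso _ _ n (opY (-phase p.1) a)) - packetIso _ _ n
    ((opY (-phase p.1) * (opY (phase p.1) * T * opY (-phase p.1))) a)
  rw [← mul_assoc, ← mul_assoc, opY_neg_mul_opY, one_mul]
  rfl

theorem intertwines_boundaryIso_multOp (a : C(EReal, ℂ)) (p : Circle × ℤˣ) :
    Intertwines (boundaryIso p) (multOp a) (a (endpoint p.2) • 1) := by
  have h := intertwines_boundaryIso (intertwines_packetIso_multOp a (phase p.1) p.2)
  rwa [mul_smul_comm, mul_one, smul_mul_assoc, opY_mul_opY_neg] at h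

theorem intertwines_boundaryIso_periodicOp (k : ℤ) (p : Circle × ℤˣ) :
    Intertwines (boundaryIso p) (periodicOp (circlePow k)) (opY (-k)) := by
  have h := intertwines_boundaryIso (intertwines_packetIso_periodicOp k (phase p.1) p.2)
  rwa [opY_comm, mul_assoc, opY_mul_opY_neg, mul_one] at h

theorem algA_le_symbolDomain_boundaryIso : algA ≤ symbolDomain boundaryIso := by
  have he : Continuous endpoint := continuous_of_discreteTopology
  refine algA_le_symbolDomain (fun a => ?_) (fun k => ?_) (fun b => ?_)
  · exact ⟨⟨fun p => a (endpoint p.2) • 1, by fun_prop⟩, intertwines_boundaryIso_multOp a⟩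
  · exact ⟨⟨fun p => opY (-k), by fun_prop⟩, intertwines_boundaryIso_periodicOp k⟩
  · obtain ⟨g, hg⟩ := exists_fourier_symbol b
    -- `phase` jumps on the circle, so continuity is taken from the periodic lift `g`.
    refine ⟨⟨fun p => g p.1, by fun_prop⟩, fun p => ?_⟩
    have h := intertwines_boundaryIso (intertwines_packetIso_fourierOp b (phase p.1) p.2)
    rwa [← hg, exp_phase] at h

/-- The boundary principal symbol. -/
noncomputable def boundarySymbol : algA →⋆ₐ[ℂ] C(Circle × ℤˣ, algB) :=
  symbolHom algA_le_symbolDomain_boundaryIso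

theorem boundarySymbol_apply {A : algA} {p : Circle × ℤˣ} {T : algB}
    (h : Intertwines (boundaryIso p) A.1 T) : boundarySymbol A p = T :=
  (symbolHom_spec algA_le_symbolDomain_boundaryIso A p).unique h

theorem isBoundarySymbol_boundarySymbol : IsBoundarySymbol boundarySymbol where
  mult a z s := boundarySymbol_apply (intertwines_boundaryIso_multOp a (z, s))
  periodic k z s := boundarySymbol_apply (intertwines_boundaryIso_periodicOp k (z, s))
  fourier b φ s := by
    -- The phase of e^{2πiφ} may differ from φ by an integer; both representatives give the value of
    -- `g` at that point.
    obtain ⟨g, hg⟩ := exists_fourier_symbol b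
    rw [← hg]
    refine boundarySymbol_apply ?_
    have h := intertwines_boundaryIso (p := (Circle.exp (2 * Real.pi * φ), s))
      (intertwines_packetIso_fourierOp b (phase (Circle.exp (2 * Real.pi * φ))) s)
    rwa [← hg, exp_phase] at h

end BoundarySymbol

/-! ### The symbols vanish on compact operators. -/

section VanishOnCompacts

theorem exists_cutoff (n : ℕ) : ∃ b : C(EReal, ℂ), (∀ s, b (endpoint s) = 0) ∧
    (∀ x, ‖b x‖ ≤ 1) ∧ ∀ x : ℝ, |x| ≤ n → b x = 1 := by
  have hd : Disjoint ({⊤, ⊥} : Set EReal) (Set.Icc ((-n : ℝ) : EReal) ((n : ℝ) : EReal)) := by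
    rw [Set.disjoint_left]
    rintro x (rfl | rfl) ⟨h1, h2⟩
    · exact absurd h2 (not_le.2 (EReal.coe_lt_top _))
    · exact absurd h1 (not_le.2 (EReal.bot_lt_coe _))
  obtain ⟨f, h0, h1, h01⟩ := exists_continuous_zero_one_of_isClosed
    (Set.toFinite ({⊤, ⊥} : Set EReal)).isClosed isClosed_Icc hd
  refine ⟨⟨fun x => (f x : ℂ), by fun_prop⟩, fun s => ?_, fun x => ?_, fun x hx => ?_⟩
  · have : endpoint s ∈ ({⊤, ⊥} : Set EReal) := by
      rw [endpoint]
      split_ifs <;> simp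
    simpa using h0 this
  · change ‖(f x : ℂ)‖ ≤ 1
    rw [Complex.norm_real, Real.norm_of_nonneg (h01 x).1]
    exact (h01 x).2
  · have : (x : EReal) ∈ Set.Icc ((-n : ℝ) : EReal) ((n : ℝ) : EReal) :=
      ⟨EReal.coe_le_coe_iff.2 (abs_le.1 hx).1, EReal.coe_le_coe_iff.2 (abs_le.1 hx).2⟩
    simpa using h1 this

/-- Functions on `[-∞, +∞]` that vanish at the endpoints and are equal to `1` on `[-n, n]`. -/
noncomputable def cutoff (n : ℕ) : C(EReal, ℂ) := (exists_cutoff n).choose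

theorem cutoff_endpoint (n : ℕ) (s : ℤˣ) : cutoff n (endpoint s) = 0 :=
  (exists_cutoff n).choose_spec.1 s

theorem norm_cutoff_le (n : ℕ) (x : EReal) : ‖cutoff n x‖ ≤ 1 :=
  (exists_cutoff n).choose_spec.2.1 x

theorem tendsto_cutoff (x : ℝ) : Tendsto (fun n => cutoff n x) atTop (𝓝 1) := by
  obtain ⟨N, hN⟩ := exists_nat_ge |x|
  refine tendsto_const_nhds.congr' ?_
  filter_upwards [eventually_ge_atTop N] with n hn
  exact ((exists_cutoff n).choose_spec.2.2 x (hN.trans (by exact_mod_cast hn))).symm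

theorem norm_multOp_cutoff_le (n : ℕ) : ‖multOp (cutoff n)‖ ≤ 1 :=
  norm_mulOp_le _ zero_le_one fun x => norm_cutoff_le n x

theorem tendsto_multOp_cutoff (u : L2R) : Tendsto (fun n => multOp (cutoff n) u) atTop (𝓝 u) := by
  have h := tendsto_mulOp (fun n => by simpa using memLp_ereal (cutoff n) 1)
    (fun n (x : ℝ) => norm_cutoff_le n x) 1 (fun x => tendsto_cutoff x) u
  have h2 := h.add_const u
  simp only [one_smul, sub_add_cancel, zero_add] at h2
  exact h2

theorem norm_fourierOp_cutoff_le (n : ℕ) : ‖fourierOp (cutoff n)‖ ≤ 1 := by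
  refine ContinuousLinearMap.opNorm_le_bound _ zero_le_one fun u => ?_
  rw [one_mul, ← (Lp.fourierTransformₗᵢ ℝ ℂ).norm_map u]
  refine ((Lp.fourierTransformₗᵢ ℝ ℂ).symm.norm_map _).le.trans ?_
  exact (norm_mulOp_apply_le (memLp_ereal (cutoff n) (2 * Real.pi))
    (fun x => norm_cutoff_le n _) _).trans_eq (one_mul _)

theorem tendsto_fourierOp_cutoff (u : L2R) :
    Tendsto (fun n => fourierOp (cutoff n) u) atTop (𝓝 u) := by
  set F := Lp.fourierTransformₗᵢ ℝ ℂ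
  have h := tendsto_mulOp (fun n => memLp_ereal (cutoff n) (2 * Real.pi))
    (fun n (x : ℝ) => norm_cutoff_le n _) 1 (fun x => tendsto_cutoff _) (F u)
  simp only [one_smul] at h
  have h2 := (F.symm.continuous.tendsto _).comp (h.add_const (F u))
  simp only [zero_add, LinearIsometryEquiv.symm_apply_apply] at h2
  refine h2.congr fun n => ?_
  simp only [Function.comp_apply, sub_add_cancel]
  rfl

/-- These packets escape to infinite frequency, so frequency cutoffs have symbol zero although they
tend strongly to 1. -/
theorem idealK_le_idealE : idealK ≤ idealE principalSymbol := by
  intro A hA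
  refine ContinuousMap.ext fun p => ?_
  refine principalSymbol_apply ?_
  have h := symbolHom_spec algA_le_symbolDomain_symbolIso A p
  have h0 := h.eq_zero_of_compact hA norm_fourierOp_cutoff_le tendsto_fourierOp_cutoff fun n => by
    have := intertwines_symbolIso_fourierOp (cutoff n) p
    rwa [cutoff_endpoint, zero_smul] at this
  rw [h0] at h
  simpa using h

/-- These packets keep their frequencies and escape in space, so the cutoffs are now taken in
position. -/
theorem idealK_le_ker_boundarySymbol : idealK ≤ RingHom.ker boundarySymbol := by
  intro A hA
  refine ContinuousMap.ext fun p => ?_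
  have h := symbolHom_spec algA_le_symbolDomain_boundaryIso A p
  exact h.eq_zero_of_compact hA norm_multOp_cutoff_le tendsto_multOp_cutoff fun n => by
    have := intertwines_boundaryIso_multOp (cutoff n) p
    rwa [cutoff_endpoint, zero_smul] at this

end VanishOnCompacts

/-! ### Compact diagonal operators and finite truncations. -/

section CompactDiagonal

theorem isCompactOperator_of_finiteDimensional_range {E F : Type} [NormedAddCommGroup E]
    [NormedSpace ℂ E] [NormedAddCommGroup F] [NormedSpace ℂ F] (T : E →L[ℂ] F)
    [FiniteDimensional ℂ T.range] : IsCompactOperator T := by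
  have : ProperSpace T.range := FiniteDimensional.proper ℂ T.range
  have h1 : IsCompactOperator (T.codRestrict T.range fun x => ⟨x, rfl⟩) :=
    isCompactOperator_of_locallyCompactSpace_dom _
  exact h1.clm_comp T.range.subtypeL

theorem finiteDimensional_range_diagOp {c : ℤ → ℂ} {C : ℝ} (hc : ∀ j, ‖c j‖ ≤ C) (s : Finset ℤ)
    (hs : ∀ j ∉ s, c j = 0) : FiniteDimensional ℂ (diagOp c C hc).range := by
  have h : (diagOp c C hc).range ≤ Submodule.span ℂ (basisVec '' s) := by
    rintro _ ⟨a, rfl⟩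
    have : diagOp c C hc a = ∑ j ∈ s, (c j * a j) • basisVec j := by
      ext i
      rw [lp.coeFn_sum, Finset.sum_apply]
      change c i * a i = ∑ j ∈ s, (c j * a j) * basisVec j i
      have e : ∀ j, (c j * a j) * basisVec j i = if i = j then c i * a i else 0 := fun j => by
        rw [basisVec, lp.single_apply]
        by_cases h : i = j
        · subst h
          simp
        · simp [h]
      simp only [e, Finset.sum_ite_eq]
      split_ifs with h
      · rfl
      · rw [hs i h, zero_mul]
    change diagOp c C hc a ∈ _
    rw [this]
    exact Submodule.sum_mem _ fun j hj =>
      Submodule.smul_mem _ _ (Submodule.subset_span ⟨j, hj, rfl⟩)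
  have : FiniteDimensional ℂ (Submodule.span ℂ (basisVec '' (s : Set ℤ))) :=
    FiniteDimensional.span_of_finite ℂ (s.finite_toSet.image _)
  exact Submodule.finiteDimensional_of_le h

/-- The projection onto the span of the basis vectors with indices in `[-n, n]`. -/
noncomputable def trunc (n : ℕ) : algB :=
  diagOp (fun j => if j ∈ Finset.Icc (-n : ℤ) n then 1 else 0) 1 fun j => by
    split_ifs <;> simp

instance finiteDimensional_range_trunc (n : ℕ) : FiniteDimensional ℂ (trunc n).range :=
  finiteDimensional_range_diagOp _ (Finset.Icc (-n : ℤ) n) fun _ hj => if_neg hj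

theorem norm_trunc_le (n : ℕ) : ‖trunc n‖ ≤ 1 :=
  norm_diagOp_le _ fun j => by split_ifs <;> simp

theorem trunc_basisVec {n : ℕ} {j : ℤ} (h : |j| ≤ n) : trunc n (basisVec j) = basisVec j := by
  rw [trunc, diagOp_basisVec, if_pos (Finset.mem_Icc.2 (abs_le.1 h)), one_smul]

theorem tendsto_trunc (a : L2Z) : Tendsto (fun n => trunc n a) atTop (𝓝 a) := by
  have h : Tendsto (fun n => (trunc n - 1) a) atTop (𝓝 0) := by
    refine tendsto_zero_of_total (C := 1 + 1) (fun n => ?_) dense_span_basisVec ?_ a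
    · refine (norm_sub_le _ _).trans (add_le_add (norm_trunc_le n) ?_)
      exact ContinuousLinearMap.norm_id_le
    · rintro _ ⟨j, rfl⟩
      refine tendsto_const_nhds.congr' ?_
      filter_upwards [eventually_ge_atTop j.natAbs] with n hn
      rw [sub_apply, trunc_basisVec (by rw [Int.abs_eq_natAbs]; exact_mod_cast hn)]
      exact (sub_self _).symm
  have h2 := h.add_const a
  rw [zero_add] at h2
  refine h2.congr fun n => ?_
  rw [sub_apply]
  exact sub_add_cancel _ _

/-- Only finitely many entries have modulus at least ε/2. Keeping just these gives a finite rank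
operator within ε/2, and compact operators are norm closed. -/
theorem isCompactOperator_diagOp {c : ℤ → ℂ} {C : ℝ} (hc : ∀ j, ‖c j‖ ≤ C)
    (h : Tendsto c cofinite (𝓝 0)) : IsCompactOperator (diagOp c C hc) := by
  have hmem : diagOp c C hc ∈ closure {T : algB | IsCompactOperator T} := by
    rw [Metric.mem_closure_iff]
    intro ε hε
    have hfin : {j | ¬ ‖c j‖ < ε / 2}.Finite := by
      have := h.norm.eventually (gt_mem_nhds (by simpa using half_pos hε : ‖(0 : ℂ)‖ < ε / 2))
      exact this
    set s := hfin.toFinset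
    have hs : ∀ j ∉ s, ‖c j‖ < ε / 2 := fun j hj => by simpa [s] using hj
    set d : ℤ → ℂ := fun j => if j ∈ s then c j else 0 with hd
    have hdC : ∀ j, ‖d j‖ ≤ C := fun j => by
      simp only [hd]
      split_ifs
      · exact hc j
      · rw [norm_zero]
        exact (norm_nonneg _).trans (hc 0)
    have := finiteDimensional_range_diagOp hdC s fun j hj => if_neg hj
    refine ⟨diagOp d C hdC, isCompactOperator_of_finiteDimensional_range _, ?_⟩
    have he : ∀ j, ‖c j - d j‖ ≤ ε / 2 := fun j => by
      simp only [hd]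
      split_ifs with hj
      · simpa using (half_pos hε).le
      · simpa using (hs j hj).le
    rw [dist_eq_norm, diagOp_sub hc hdC he]
    exact (norm_diagOp_le _ he).trans_lt (half_lt_self hε)
  rwa [isClosed_setOfPred_isCompactOperator.closure_eq] at hmem

end CompactDiagonal

/-! ### Convolution operators commute with the half-line projection modulo compacts. -/

section Calkin

/-- The ideal of compact operators in `𝔅`. -/
noncomputable def calkinIdeal : Ideal algB where
  carrier := {T | IsCompactOperator T}
  zero_mem' := isCompactOperator_zero
  add_mem' := fun ha hb => IsCompactOperator.add ha hb
  smul_mem' := fun c _ ha => IsCompactOperator.clm_comp ha c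

instance : calkinIdeal.IsTwoSided where
  mul_mem_of_left := fun b ha => IsCompactOperator.comp_clm ha b

theorem isClosed_calkinIdeal : IsClosed (calkinIdeal : Set algB) :=
  isClosed_setOfPred_isCompactOperator

/-- The projection of `ℓ²(ℤ)` onto `ℓ²(ℕ)`. -/
noncomputable def halfProj : algB :=
  diagOp (fun j => if 0 ≤ j then 1 else 0) 1 fun j => by split_ifs <;> simp

theorem halfProj_basisVec (j : ℤ) :
    halfProj (basisVec j) = (if 0 ≤ j then 1 else 0 : ℂ) • basisVec j :=
  diagOp_basisVec _ j

theorem halfProj_idem : halfProj * halfProj = halfProj := by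
  refine algB_ext fun j => ?_
  rw [mul_apply_eq_comp, halfProj_basisVec, map_smul, halfProj_basisVec]
  split_ifs <;> simp

theorem memLp_circle (p : C(Circle, ℂ)) :
    MemLp (fun x : UnitAddCircle => p (AddCircle.toCircle x)) ∞ AddCircle.haarAddCircle :=
  memLp_top_of_bound (C := ‖p‖)
    (p.continuous.comp AddCircle.continuous_toCircle).aestronglyMeasurable
    (Eventually.of_forall fun _ => p.norm_coe_le_norm _)

/-- The convolution operators on `ℓ²(ℤ)`: the conjugates of the multiplications by continuous
functions on the circle. -/
noncomputable def laurent : C(Circle, ℂ) →ₐ[ℂ] algB where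
  toFun p := fourierConj (mulOp _ _ (memLp_circle p))
  map_one' := by
    rw [← fourierConj_one]
    congr 1
    exact (mulOp_const 1 _).trans (one_smul _ _)
  map_mul' p q := by
    rw [← fourierConj_mul]
    congr 1
    exact (mulOp_mul _ _ _).symm
  map_zero' := by
    have : mulOp _ _ (memLp_circle 0) = (0 : ℂ) • 1 := mulOp_const 0 _
    rw [this, fourierConj_smul, zero_smul]
  map_add' p q := by
    rw [← fourierConj_add]
    congr 1
    exact (mulOp_add _ _ _).symm
  commutes' c := by
    have : mulOp _ _ (memLp_circle (algebraMap ℂ C(Circle, ℂ) c)) = c • 1 := mulOp_const c _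
    rw [this, fourierConj_smul, fourierConj_one, Algebra.algebraMap_eq_smul_one]

theorem norm_laurent_le (p : C(Circle, ℂ)) : ‖laurent p‖ ≤ ‖p‖ :=
  (norm_fourierConj_le _).trans (norm_mulOp_le _ (norm_nonneg _) fun _ => p.norm_coe_le_norm _)

theorem continuous_laurent : Continuous laurent :=
  AddMonoidHomClass.continuous_of_bound laurent 1 fun p => by
    rw [one_mul]
    exact norm_laurent_le p

theorem laurent_circlePow (k : ℤ) : laurent (circlePow k) = opY (-k) := by
  refine algB_ext fun j => ?_
  rw [opY_basisVec]
  change fourierConj (mulOp _ _ (memLp_circle (circlePow k))) (basisVec j) = _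
  rw [fourierConj_apply, discreteFourier_symm_basisVec, mulOp_fourierBasis _ k,
    discreteFourier_fourierBasis]
  exact fun _ => rfl

/-- A shift by k moves only finitely many indices across 0, so the commutator is a shift times a
diagonal operator supported in |j| ≤ |k|. -/
theorem opY_commutator_mem (k : ℤ) : opY (-k) * halfProj - halfProj * opY (-k) ∈ calkinIdeal := by
  have hb : ∀ j : ℤ, ‖(if 0 ≤ j then 1 else 0 : ℂ) - (if 0 ≤ j + k then 1 else 0 : ℂ)‖ ≤ 1 := by
    intro j
    split_ifs <;> simp
  have h : opY (-k) * halfProj - halfProj * opY (-k) = opY (-k) *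
      diagOp (fun j => (if 0 ≤ j then 1 else 0 : ℂ) - (if 0 ≤ j + k then 1 else 0 : ℂ)) 1 hb := by
    refine algB_ext fun j => ?_
    rw [sub_apply, mul_apply_eq_comp, mul_apply_eq_comp, mul_apply_eq_comp, halfProj_basisVec,
      opY_basisVec, halfProj_basisVec, map_smul, diagOp_basisVec, map_smul, opY_basisVec, sub_smul]
  rw [h]
  refine Ideal.mul_mem_left _ _ (isCompactOperator_diagOp hb ?_)
  refine tendsto_nhds_of_eventually_eq ?_
  refine (Set.finite_Icc (-|k|) |k|).subset fun j hj => ?_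
  by_contra hj'
  apply hj
  have h1 := neg_abs_le k
  have h2 := le_abs_self k
  simp only [Set.mem_Icc, not_and_or, not_le] at hj'
  change (if 0 ≤ j then 1 else 0 : ℂ) - (if 0 ≤ j + k then 1 else 0 : ℂ) = 0
  rcases hj' with h | h
  · rw [if_neg (by omega), if_neg (by omega), sub_self]
  · rw [if_pos (by omega), if_pos (by omega), sub_self]

theorem mul_commutator_mem {R : Type} [Ring R] {I : Ideal R} [I.IsTwoSided] {a b p : R}
    (ha : a * p - p * a ∈ I) (hb : b * p - p * b ∈ I) : a * b * p - p * (a * b) ∈ I := by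
  have h : a * b * p - p * (a * b) = a * (b * p - p * b) + (a * p - p * a) * b := by noncomm_ring
  rw [h]
  exact I.add_mem (I.mul_mem_left _ hb) (I.mul_mem_right _ ha)

/-- The commutation property is closed in p and stable under sums and products, and it holds for e_1
and e_{−1}. Stone–Weierstrass then gives all continuous functions. -/
theorem laurent_commutator_mem (p : C(Circle, ℂ)) :
    laurent p * halfProj - halfProj * laurent p ∈ calkinIdeal := by
  let S : StarSubalgebra ℂ C(Circle, ℂ) :=
    -- The condition is imposed on p and on its conjugate, since `laurent` is only set up as an
    -- algebra homomorphism.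
    { carrier := {p | laurent p * halfProj - halfProj * laurent p ∈ calkinIdeal ∧
        laurent (star p) * halfProj - halfProj * laurent (star p) ∈ calkinIdeal}
      mul_mem' := by
        rintro p q ⟨h1, h2⟩ ⟨h3, h4⟩
        refine ⟨?_, ?_⟩
        · rw [map_mul]
          exact mul_commutator_mem h1 h3
        · rw [star_mul, map_mul]
          exact mul_commutator_mem h4 h2
      add_mem' := by
        rintro p q ⟨h1, h2⟩ ⟨h3, h4⟩
        refine ⟨?_, ?_⟩
        · rw [map_add, add_mul, mul_add, add_sub_add_comm]
          exact Ideal.add_mem _ h1 h3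
        · rw [star_add, map_add, add_mul, mul_add, add_sub_add_comm]
          exact Ideal.add_mem _ h2 h4
      algebraMap_mem' := by
        intro c
        refine ⟨?_, ?_⟩
        · rw [AlgHomClass.commutes, Algebra.commutes, sub_self]
          exact zero_mem _
        · rw [← algebraMap_star_comm, AlgHomClass.commutes, Algebra.commutes, sub_self]
          exact zero_mem _
      star_mem' := by
        rintro p ⟨h1, h2⟩
        exact ⟨h2, by rwa [star_star]⟩ }
  have hS : IsClosed (S : Set C(Circle, ℂ)) := by
    have hc := continuous_laurent
    refine IsClosed.inter (isClosed_calkinIdeal.preimage (f := fun p : C(Circle, ℂ) =>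
      laurent p * halfProj - halfProj * laurent p) ?_) (isClosed_calkinIdeal.preimage
      (f := fun p : C(Circle, ℂ) => laurent (star p) * halfProj - halfProj * laurent (star p)) ?_)
    · exact (hc.mul continuous_const).sub (continuous_const.mul hc)
    · have hc' := hc.comp continuous_star
      exact (hc'.mul continuous_const).sub (continuous_const.mul hc')
  have h1 : (StarAlgebra.adjoin ℂ {circlePow 1}).topologicalClosure ≤ S := by
    refine StarSubalgebra.topologicalClosure_minimal (StarAlgebra.adjoin_le ?_) hS
    rintro _ rfl
    refine ⟨?_, ?_⟩
    · rw [laurent_circlePow]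
      exact opY_commutator_mem 1
    · rw [star_circlePow, laurent_circlePow]
      exact opY_commutator_mem (-1)
  rw [topologicalClosure_adjoin_circlePow] at h1
  exact (h1 (by trivial : p ∈ (⊤ : StarSubalgebra ℂ C(Circle, ℂ)))).1

end Calkin

/-! ### The boundary symbol modulo compacts is determined by the principal symbol. -/

section CompactOnKernel

theorem endpoint_mem_spaceX (s : ℤˣ) (w : Circle) : (endpoint s, w) ∈ spaceX := by
  rw [endpoint]
  split_ifs
  · exact Or.inl rfl
  · exact Or.inr (Or.inl rfl)

/-- The restriction of a principal symbol to the circle over the point `s∞`, at covariable `t∞`. -/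
noncomputable def symbolAt (s t : ℤˣ) : algA →⋆ₐ[ℂ] C(Circle, ℂ) :=
  (ContinuousMap.compStarAlgHom' ℂ ℂ ⟨fun w : Circle =>
    ((⟨(endpoint s, w), endpoint_mem_spaceX s w⟩ : spaceX), t), by fun_prop⟩).comp principalSymbol

theorem symbolAt_apply (s t : ℤˣ) (A : algA) (w : Circle) : symbolAt s t A w =
    principalSymbol A ((⟨(endpoint s, w), endpoint_mem_spaceX s w⟩ : spaceX), t) := rfl

/-- The boundary symbol at a point, as an algebra homomorphism. -/
noncomputable def boundarySymbolAt (v : Circle × ℤˣ) : algA →ₐ[ℂ] algB where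
  toFun A := boundarySymbol A v
  map_one' := by rw [map_one]; rfl
  map_mul' A B := by rw [map_mul]; rfl
  map_zero' := by rw [map_zero]; rfl
  map_add' A B := by rw [map_add]; rfl
  commutes' c := by rw [AlgHomClass.commutes]; rfl

/-- The operator `a P + b (1 - P)`, where `P` is the projection onto `ℓ²(ℕ)`. -/
noncomputable def splitOp (a b : algB) : algB := a * halfProj + b * (1 - halfProj)

theorem splitOp_add (a b c d : algB) :
    splitOp (a + c) (b + d) = splitOp a b + splitOp c d := by
  simp only [splitOp]
  noncomm_ring

theorem splitOp_same (a : algB) : splitOp a a = a := by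
  simp only [splitOp]
  noncomm_ring

/-- Modulo compacts the half-line projection commutes with the right-hand factors c and d, so the
two halves multiply separately. -/
theorem splitOp_mul_mem {a b c d : algB} (hc : c * halfProj - halfProj * c ∈ calkinIdeal)
    (hd : d * halfProj - halfProj * d ∈ calkinIdeal) :
    splitOp a b * splitOp c d - splitOp (a * c) (b * d) ∈ calkinIdeal := by
  have h : splitOp a b * splitOp c d - splitOp (a * c) (b * d) =
      -((a - b) * (c * halfProj - halfProj * c) * halfProj) -
        (a - b) * (d * halfProj - halfProj * d) * (1 - halfProj) := by
    have e := halfProj_idem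
    have e1 : ∀ x : algB, x * halfProj * halfProj = x * halfProj := fun x => by rw [mul_assoc, e]
    simp only [splitOp, mul_sub, sub_mul, mul_add, add_mul, mul_one, ← mul_assoc, e1]
    abel
  rw [h]
  exact sub_mem (neg_mem (Ideal.mul_mem_right _ _ (Ideal.mul_mem_left _ _ hc)))
    (Ideal.mul_mem_right _ _ (Ideal.mul_mem_left _ _ hd))

/-- The boundary symbol of an operator at `v`, conjugated by `Y_φ`. -/
noncomputable def conjBoundary (v : Circle × ℤˣ) : algA →ₐ[ℂ] algB where
  toFun A := opY (-phase v.1) * boundarySymbolAt v A * opY (phase v.1)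
  map_one' := by rw [map_one, mul_one, opY_neg_mul_opY]
  map_mul' A B := by
    rw [map_mul]
    calc _ = opY (-phase v.1) * boundarySymbolAt v A * 1 * boundarySymbolAt v B *
          opY (phase v.1) := by simp only [mul_assoc, one_mul]
      _ = _ := by rw [← opY_mul_opY_neg (phase v.1)]; simp only [mul_assoc]
  map_zero' := by simp
  map_add' A B := by rw [map_add, mul_add, add_mul]
  commutes' c := by
    rw [AlgHom.commutes, ← Algebra.commutes, mul_assoc, opY_neg_mul_opY, mul_one]

/-- The difference between the boundary symbol and the operator determined by the principal symbol
on the two circles over `s∞`. -/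
noncomputable def boundaryDefect (v : Circle × ℤˣ) (A : algA) : algB :=
  conjBoundary v A - splitOp (laurent (symbolAt v.2 1 A)) (laurent (symbolAt v.2 (-1) A))

theorem continuous_boundaryDefect (v : Circle × ℤˣ) : Continuous (boundaryDefect v) := by
  have h1 : Continuous boundarySymbol := AddMonoidHomClass.continuous_of_bound boundarySymbol 1
    fun a => by
      rw [one_mul]
      exact NonUnitalStarAlgHom.norm_apply_le boundarySymbol a
  have h2 : ∀ t, Continuous (symbolAt v.2 t) := fun t =>
    AddMonoidHomClass.continuous_of_bound (symbolAt v.2 t) 1 fun a => by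
      rw [one_mul]
      exact NonUnitalStarAlgHom.norm_apply_le (symbolAt v.2 t) a
  have h3 : Continuous fun A => boundarySymbol A v := (continuous_eval_const v).comp h1
  have h4 := fun t => continuous_laurent.comp (h2 t)
  exact ((continuous_const.mul h3).mul continuous_const).sub
    (((h4 1).mul continuous_const).add ((h4 (-1)).mul continuous_const))

theorem boundaryDefect_mul_mem {v : Circle × ℤˣ} {A B : algA}
    (hA : boundaryDefect v A ∈ calkinIdeal) (hB : boundaryDefect v B ∈ calkinIdeal) :
    boundaryDefect v (A * B) ∈ calkinIdeal := by
  -- With C the conjugated boundary symbol, written as a subscript, and s the split operator: C_A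
  -- C_B − s_A s_B = (C_A − s_A) C_B + s_A (C_B − s_B); the last summand measures the failure of s
  -- to be multiplicative.
  have h : boundaryDefect v (A * B) = boundaryDefect v A * conjBoundary v B +
      splitOp (laurent (symbolAt v.2 1 A)) (laurent (symbolAt v.2 (-1) A)) * boundaryDefect v B +
      (splitOp (laurent (symbolAt v.2 1 A)) (laurent (symbolAt v.2 (-1) A)) *
        splitOp (laurent (symbolAt v.2 1 B)) (laurent (symbolAt v.2 (-1) B)) -
        splitOp (laurent (symbolAt v.2 1 A) * laurent (symbolAt v.2 1 B))
          (laurent (symbolAt v.2 (-1) A) * laurent (symbolAt v.2 (-1) B))) := by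
    simp only [boundaryDefect, map_mul]
    noncomm_ring
  rw [h]
  exact add_mem (add_mem (Ideal.mul_mem_right _ _ hA) (Ideal.mul_mem_left _ _ hB))
    (splitOp_mul_mem (laurent_commutator_mem _) (laurent_commutator_mem _))

theorem boundaryDefect_add (v : Circle × ℤˣ) (A B : algA) :
    boundaryDefect v (A + B) = boundaryDefect v A + boundaryDefect v B := by
  simp only [boundaryDefect, map_add, splitOp_add]
  abel

theorem boundaryDefect_algebraMap (v : Circle × ℤˣ) (c : ℂ) :
    boundaryDefect v (algebraMap ℂ algA c) = 0 := by
  rw [boundaryDefect, AlgHom.commutes, AlgHomClass.commutes, AlgHomClass.commutes,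
    AlgHomClass.commutes, AlgHomClass.commutes, splitOp_same, sub_self]

theorem boundaryDefect_multOp (v : Circle × ℤˣ) (a : C(EReal, ℂ)) :
    boundaryDefect v ⟨multOp a, multOp_mem a⟩ = 0 := by
  have h : ∀ t, symbolAt v.2 t ⟨multOp a, multOp_mem a⟩ =
      algebraMap ℂ C(Circle, ℂ) (a (endpoint v.2)) := fun t => ContinuousMap.ext fun w =>
    isPrincipalSymbol_principalSymbol.mult a _ t
  have h2 : boundarySymbolAt v ⟨multOp a, multOp_mem a⟩ = a (endpoint v.2) • 1 :=
    isBoundarySymbol_boundarySymbol.mult a v.1 v.2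
  have h3 : conjBoundary v ⟨multOp a, multOp_mem a⟩ = a (endpoint v.2) • 1 := by
    change opY (-phase v.1) * boundarySymbolAt v _ * opY (phase v.1) = _
    rw [h2, mul_smul_comm, mul_one, smul_mul_assoc, opY_neg_mul_opY]
  rw [boundaryDefect, h, h, AlgHomClass.commutes, splitOp_same, h3,
    Algebra.algebraMap_eq_smul_one, sub_self]

theorem boundaryDefect_periodicOp (v : Circle × ℤˣ) (k : ℤ) :
    boundaryDefect v ⟨periodicOp (circlePow k), periodicOp_mem _⟩ = 0 := by
  have h : ∀ t, symbolAt v.2 t ⟨periodicOp (circlePow k), periodicOp_mem _⟩ = circlePow k :=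
    fun t => ContinuousMap.ext fun w => isPrincipalSymbol_principalSymbol.periodic _ _ t
  have h2 : boundarySymbolAt v ⟨periodicOp (circlePow k), periodicOp_mem _⟩ = opY (-k) :=
    isBoundarySymbol_boundarySymbol.periodic k v.1 v.2
  have h3 : conjBoundary v ⟨periodicOp (circlePow k), periodicOp_mem _⟩ = opY (-k) := by
    change opY (-phase v.1) * boundarySymbolAt v _ * opY (phase v.1) = _
    rw [h2, opY_comm, mul_assoc, opY_neg_mul_opY, mul_one]
  rw [boundaryDefect, h, h, splitOp_same, h3, laurent_circlePow, sub_self]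

/-- This is the one family of generators whose defect need not vanish. The entries b(j − φ) are
compared with b(+∞) for j ≥ 0 and with b(−∞) for j < 0; the differences tend to 0 at both ends, so
the diagonal operator is compact. -/
theorem boundaryDefect_fourierOp_mem (v : Circle × ℤˣ) (b : C(EReal, ℂ)) :
    boundaryDefect v ⟨fourierOp b, fourierOp_mem b⟩ ∈ calkinIdeal := by
  have h : ∀ t, symbolAt v.2 t ⟨fourierOp b, fourierOp_mem b⟩ =
      algebraMap ℂ C(Circle, ℂ) (b (endpoint t)) := fun t => ContinuousMap.ext fun w =>
    isPrincipalSymbol_principalSymbol.fourier b _ t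
  have h2 : boundarySymbolAt v ⟨fourierOp b, fourierOp_mem b⟩ =
      opY (phase v.1) * opM b (phase v.1) * opY (-phase v.1) := by
    have := isBoundarySymbol_boundarySymbol.fourier b (phase v.1) v.2
    rwa [exp_phase] at this
  have h3 : conjBoundary v ⟨fourierOp b, fourierOp_mem b⟩ = opM b (phase v.1) := by
    change opY (-phase v.1) * boundarySymbolAt v _ * opY (phase v.1) = _
    rw [h2]
    calc _ = (opY (-phase v.1) * opY (phase v.1)) * opM b (phase v.1) *
          (opY (-phase v.1) * opY (phase v.1)) := by simp only [mul_assoc]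
      _ = _ := by rw [opY_neg_mul_opY, one_mul, mul_one]
  set c : ℤ → ℂ := fun j => b (((j : ℝ) - phase v.1 : ℝ) : EReal) - if 0 ≤ j then b ⊤ else b ⊥
  have hc : ∀ j, ‖c j‖ ≤ ‖b‖ + ‖b‖ := fun j => by
    refine (norm_sub_le _ _).trans (add_le_add (b.norm_coe_le_norm _) ?_)
    split_ifs <;> exact b.norm_coe_le_norm _
  have h4 : boundaryDefect v ⟨fourierOp b, fourierOp_mem b⟩ = diagOp c _ hc := by
    rw [boundaryDefect, h3, h, h, AlgHomClass.commutes, AlgHomClass.commutes,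
      Algebra.algebraMap_eq_smul_one, Algebra.algebraMap_eq_smul_one]
    have e1 : endpoint 1 = ⊤ := if_pos rfl
    have e2 : endpoint (-1) = ⊥ := if_neg (by decide)
    rw [e1, e2]
    refine algB_ext fun j => ?_
    rw [diagOp_basisVec, splitOp, sub_apply, opM_basisVec, add_apply, smul_mul_assoc,
      smul_mul_assoc, one_mul, one_mul, smul_apply, smul_apply, sub_apply, halfProj_basisVec,
      one_apply_eq_self]
    simp only [c]
    split_ifs <;> simp [sub_smul]
  rw [h4]
  refine isCompactOperator_diagOp hc ?_
  rw [Int.cofinite_eq, tendsto_sup]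
  have hs : ∀ {l : Filter ℤ} {m : Filter ℝ} {x : EReal}, Tendsto (fun j : ℤ => (j : ℝ)) l m →
      Tendsto (fun t : ℝ => (t : EReal)) m (𝓝 x) → Tendsto (fun t : ℝ => t - phase v.1) m m →
      Tendsto (fun j : ℤ => b (((j : ℝ) - phase v.1 : ℝ) : EReal)) l (𝓝 (b x)) :=
    fun h1 h2 h3 => (b.continuous.tendsto _).comp (h2.comp (h3.comp h1))
  constructor
  · have := (hs (tendsto_intCast_atBot_iff.2 tendsto_id) EReal.tendsto_coe_atBot
      (tendsto_atBot_add_const_right _ (-phase v.1) tendsto_id)).sub_const (b ⊥)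
    rw [sub_self] at this
    refine this.congr' ?_
    filter_upwards [eventually_lt_atBot 0] with j hj
    simp only [c, if_neg (not_le.2 hj)]
  · have := (hs tendsto_intCast_atTop_atTop EReal.tendsto_coe_atTop
      (tendsto_atTop_add_const_right _ (-phase v.1) tendsto_id)).sub_const (b ⊤)
    rw [sub_self] at this
    refine this.congr' ?_
    filter_upwards [eventually_ge_atTop 0] with j hj
    simp only [c, if_pos hj]

/-- A closed star subalgebra of `𝔄` that contains the generators is equal to `𝔄`. -/
theorem mem_of_isClosed_of_generators {S : StarSubalgebra ℂ algA} (hS : IsClosed (S : Set algA))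
    (h1 : ∀ a, ⟨multOp a, multOp_mem a⟩ ∈ S)
    (h2 : ⟨periodicOp (circlePow 1), periodicOp_mem _⟩ ∈ S)
    (h3 : ∀ b, ⟨fourierOp b, fourierOp_mem b⟩ ∈ S) (A : algA) : A ∈ S := by
  have hc : IsClosed ((S.map algA.subtype : StarSubalgebra ℂ (L2R →L[ℂ] L2R)) :
      Set (L2R →L[ℂ] L2R)) :=
    isClosed_algA.isClosedEmbedding_subtypeVal.isClosedMap _ hS
  obtain ⟨B, hB, h⟩ := algA_le hc (fun a => ⟨_, h1 a, rfl⟩) ⟨_, h2, rfl⟩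
    (fun b => ⟨_, h3 b, rfl⟩) A.2
  rwa [← Subtype.ext h]

/-- A compact defect for both A and A* is a closed condition, stable under the star algebra
operations, so the generators suffice. -/
theorem boundaryDefect_mem (v : Circle × ℤˣ) (A : algA) : boundaryDefect v A ∈ calkinIdeal := by
  let S : StarSubalgebra ℂ algA :=
    { carrier := {A | boundaryDefect v A ∈ calkinIdeal ∧ boundaryDefect v (star A) ∈ calkinIdeal}
      mul_mem' := by
        rintro A B ⟨h1, h2⟩ ⟨h3, h4⟩
        refine ⟨boundaryDefect_mul_mem h1 h3, ?_⟩
        rw [star_mul]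
        exact boundaryDefect_mul_mem h4 h2
      add_mem' := by
        rintro A B ⟨h1, h2⟩ ⟨h3, h4⟩
        refine ⟨?_, ?_⟩
        · rw [boundaryDefect_add]
          exact add_mem h1 h3
        · rw [star_add, boundaryDefect_add]
          exact add_mem h2 h4
      algebraMap_mem' := by
        intro c
        refine ⟨?_, ?_⟩
        · rw [boundaryDefect_algebraMap]
          exact zero_mem _
        · rw [← algebraMap_star_comm, boundaryDefect_algebraMap]
          exact zero_mem _
      star_mem' := by
        rintro A ⟨h1, h2⟩
        exact ⟨h2, by rwa [star_star]⟩ }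
  have hc := continuous_boundaryDefect v
  have hS : IsClosed (S : Set algA) :=
    (isClosed_calkinIdeal.preimage hc).inter (isClosed_calkinIdeal.preimage (hc.comp continuous_star))
  refine (mem_of_isClosed_of_generators hS (fun a => ?_) ?_ (fun b => ?_) A).1
  · refine ⟨?_, ?_⟩
    · rw [boundaryDefect_multOp]
      exact zero_mem _
    · have : star (⟨multOp a, multOp_mem a⟩ : algA) = ⟨multOp (star a), multOp_mem _⟩ :=
        Subtype.ext (star_multOp a)
      rw [this, boundaryDefect_multOp]
      exact zero_mem _
  · refine ⟨?_, ?_⟩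
    · rw [boundaryDefect_periodicOp]
      exact zero_mem _
    · have : star (⟨periodicOp (circlePow 1), periodicOp_mem _⟩ : algA) =
          ⟨periodicOp (circlePow (-1)), periodicOp_mem _⟩ := by
        have := map_star periodicHom (circlePow 1)
        rw [star_circlePow] at this
        exact this.symm
      rw [this, boundaryDefect_periodicOp]
      exact zero_mem _
  · refine ⟨boundaryDefect_fourierOp_mem v b, ?_⟩
    have : star (⟨fourierOp b, fourierOp_mem b⟩ : algA) = ⟨fourierOp (star b), fourierOp_mem _⟩ :=
      Subtype.ext (star_fourierOp b)
    rw [this]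
    exact boundaryDefect_fourierOp_mem v _

/-- When σ_A = 0 both convolution terms vanish, and the compact defect is the conjugated boundary
symbol itself. -/
theorem isCompactOperator_boundarySymbol {A : algA} (hA : A ∈ idealE principalSymbol)
    (v : Circle × ℤˣ) : IsCompactOperator (boundarySymbol A v) := by
  have h0 : principalSymbol A = 0 := hA
  have h1 : ∀ t, symbolAt v.2 t A = 0 := fun t => ContinuousMap.ext fun w => by
    rw [symbolAt_apply, h0]
    rfl
  have h := boundaryDefect_mem v A
  rw [boundaryDefect, h1, h1, splitOp_same, map_zero, sub_zero] at h
  have h2 : boundarySymbol A v = opY (phase v.1) * conjBoundary v A * opY (-phase v.1) := by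
    change _ = opY (phase v.1) * (opY (-phase v.1) * boundarySymbol A v * opY (phase v.1)) *
      opY (-phase v.1)
    calc _ = (opY (phase v.1) * opY (-phase v.1)) * boundarySymbol A v *
          (opY (phase v.1) * opY (-phase v.1)) := by rw [opY_mul_opY_neg, one_mul, mul_one]
      _ = _ := by simp only [mul_assoc]
  rw [h2]
  exact Ideal.mul_mem_right _ _ (Ideal.mul_mem_left _ _ h)

end CompactOnKernel

/-! ### Fredholm operators, parametrices and generalized inverses. -/

section Fredholm

theorem hasNoetherianRange_trunc_mul (n : ℕ) (K : algB) :
    (trunc n * K : L2Z →ₗ[ℂ] L2Z).HasNoetherianRange := by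
  have h : (trunc n : L2Z →ₗ[ℂ] L2Z).HasNoetherianRange := by
    rw [LinearMap.HasNoetherianRange]
    infer_instance
  exact h.comp_right (K : L2Z →ₗ[ℂ] L2Z)

/-- A compact perturbation of the identity is a finite rank perturbation of an invertible
operator. -/
theorem exists_unit_add_finiteRange {K : algB} (hK : IsCompactOperator K) :
    ∃ (u : algBˣ) (F : algB), 1 + K = u + F ∧ (F : L2Z →ₗ[ℂ] L2Z).HasNoetherianRange := by
  have h := tendsto_comp_compact norm_trunc_le tendsto_trunc hK
  -- For large n the truncation P_n satisfies ‖P_n K − K‖ < 1. In 1 + K = (1 + K − P_n K) + P_n K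
  -- the first term is then invertible and the second has finite rank.
  obtain ⟨n, hn⟩ := ((Metric.tendsto_nhds.1 h) 1 one_pos).exists
  rw [dist_eq_norm] at hn
  refine ⟨Units.oneSub (trunc n ∘L K - K) hn, trunc n * K, ?_, hasNoetherianRange_trunc_mul n K⟩
  change 1 + K = 1 - (trunc n * K - K) + trunc n * K
  abel

/-- Atkinson's theorem: correcting S by the two invertible factors yields a left and a right inverse
of T modulo finite rank operators. -/
theorem isFredholm_of_parametrix {T S : algB} (h1 : IsCompactOperator (S * T - 1 : algB))
    (h2 : IsCompactOperator (T * S - 1 : algB)) : T.IsFredholm := by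
  obtain ⟨u, F, hu, hF⟩ := exists_unit_add_finiteRange h1
  obtain ⟨v, G, hv, hG⟩ := exists_unit_add_finiteRange h2
  rw [add_sub_cancel] at hu hv
  set L : algB := u⁻¹.val * S
  set R : algB := S * v⁻¹.val
  have e1 : L * T - 1 = u⁻¹.val * F := by
    rw [mul_assoc, hu, mul_add, Units.inv_mul, add_sub_cancel_left]
  have e2 : T * R - 1 = G * v⁻¹.val := by
    rw [← mul_assoc, hv, add_mul, Units.mul_inv, add_sub_cancel_left]
  have a1 : ((L * T - 1 : algB) : L2Z →ₗ[ℂ] L2Z).HasNoetherianRange := by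
    rw [e1]
    exact hF.comp_left ((u⁻¹.val : algB) : L2Z →ₗ[ℂ] L2Z)
  have a2 : ((T * R - 1 : algB) : L2Z →ₗ[ℂ] L2Z).HasNoetherianRange := by
    rw [e2]
    exact hG.comp_right ((v⁻¹.val : algB) : L2Z →ₗ[ℂ] L2Z)
  -- A left inverse agrees with a right inverse modulo finite rank; the identity expresses TL − 1
  -- through the defects of L and R, so L alone is two-sided.
  have e3 : T * L - 1 = (T * R - 1) + (T * ((L * T - 1) * R) - (T * L) * (T * R - 1)) := by
    noncomm_ring
  have a3 : ((T * L - 1 : algB) : L2Z →ₗ[ℂ] L2Z).HasNoetherianRange := by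
    rw [e3]
    exact a2.add (((a1.comp_right (R : L2Z →ₗ[ℂ] L2Z)).comp_left (T : L2Z →ₗ[ℂ] L2Z)).sub
      (a2.comp_left ((T * L : algB) : L2Z →ₗ[ℂ] L2Z)))
  refine ContinuousLinearMap.IsFredholm.of_isQuasiInverse (v := L) ⟨?_, ?_⟩
  · exact LinearMap.FiniteRangeSetoid.equiv_iff_hasNoetherianRange.2 a1
  · exact LinearMap.FiniteRangeSetoid.equiv_iff_hasNoetherianRange.2 a3

theorem exists_mul_sub_one_mem {R : Type} [Ring R] {I : Ideal R} [I.IsTwoSided] {a : R}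
    (h : IsUnit (Ideal.Quotient.mk I a)) : ∃ b, b * a - 1 ∈ I ∧ a * b - 1 ∈ I := by
  obtain ⟨b, hb⟩ := Ideal.Quotient.mk_surjective (h.unit⁻¹ : (R ⧸ I)ˣ).val
  refine ⟨b, ?_, ?_⟩
  · rw [← Ideal.Quotient.eq_zero_iff_mem, map_sub, map_mul, map_one, hb, h.val_inv_mul, sub_self]
  · rw [← Ideal.Quotient.eq_zero_iff_mem, map_sub, map_mul, map_one, hb, h.mul_val_inv, sub_self]

/-- An inverse modulo 𝔈 leaves defects in 𝔈, and γ sends these to compact operators. -/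
theorem isFredholm_boundarySymbol {A : algA}
    (hA : IsUnit (Ideal.Quotient.mk (idealE principalSymbol) A)) (v : Circle × ℤˣ) :
    (boundarySymbol A v).IsFredholm := by
  obtain ⟨B, h1, h2⟩ := exists_mul_sub_one_mem hA
  refine isFredholm_of_parametrix (S := boundarySymbol B v) ?_ ?_
  · have := isCompactOperator_boundarySymbol h1 v
    rwa [map_sub, map_mul, map_one] at this
  · have := isCompactOperator_boundarySymbol h2 v
    rwa [map_sub, map_mul, map_one] at this

/-- A Fredholm operator is an isomorphism between summands of its domain and codomain, preceded by
the projection onto the first. S projects onto the second and inverts the isomorphism. -/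
theorem exists_generalized_inverse {T : algB} (hT : T.IsFredholm) :
    ∃ S : algB, T * S * T = T ∧ S * T * S = S := by
  obtain ⟨pkg⟩ := hT.nonempty_fredholmPackage
  have hT : ∀ x, T x = pkg.equiv (pkg.decDom.proj x) := fun x => by
    conv_lhs => rw [pkg.eq_equiv]
    rfl
  have hS : ∀ x, pkg.quasiInverse x = pkg.equiv.symm (pkg.decCodom.proj x) := fun x => rfl
  have hp : ∀ (d : FredholmDecomposition ℂ L2Z) (y : d.X₁), d.proj (y : L2Z) = y :=
    fun d y => by simp
  refine ⟨pkg.quasiInverse, ?_, ?_⟩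
  · ext1 x
    rw [mul_apply_eq_comp, mul_apply_eq_comp, hT x, hS, hT, hp, hp,
      ContinuousLinearEquiv.symm_apply_apply]
  · ext1 x
    rw [mul_apply_eq_comp, mul_apply_eq_comp, hS x, hT, hS, hp, hp,
      ContinuousLinearEquiv.apply_symm_apply]

variable {T S : algB}

/-- The ranks of 1 − ST and 1 − TS will be the two terms of the Fredholm index: the first projects
onto the kernel of T, the second has kernel equal to the range of T. -/
theorem range_one_sub_mul_eq_ker (h : T * S * T = T) : (1 - S * T : algB).range = T.ker := by
  ext x
  constructor
  · rintro ⟨y, rfl⟩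
    have : (T * (1 - S * T)) y = 0 := by
      rw [mul_sub, mul_one, ← mul_assoc, h, sub_self]
      rfl
    exact this
  · intro hx
    have hx : T x = 0 := hx
    refine ⟨x, ?_⟩
    change x - S (T x) = x
    rw [hx, map_zero, sub_zero]

theorem ker_one_sub_mul_eq_range (h : T * S * T = T) : (1 - T * S : algB).ker = T.range := by
  ext x
  constructor
  · intro hx
    have hx : x - T (S x) = 0 := hx
    exact ⟨S x, (sub_eq_zero.1 hx).symm⟩
  · rintro ⟨y, rfl⟩
    have : ((1 - T * S) * T) y = 0 := by
      rw [sub_mul, one_mul, h, sub_self]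
      rfl
    exact this

theorem finrank_range_one_sub_mul (h : T * S * T = T) :
    Module.finrank ℂ (1 - T * S : algB).range = Module.finrank ℂ (L2Z ⧸ T.range) := by
  rw [← ker_one_sub_mul_eq_range h]
  exact ((1 - T * S : algB) : L2Z →ₗ[ℂ] L2Z).quotKerEquivRange.finrank_eq.symm

end Fredholm

end PsiDO

namespace KTheory

/-! ### Computations with classes of idempotents in K₀. -/

section KZeroLemmas

variable {R : Type} [Ring R]

theorem K₀.mk_eq_of_unique {ι κ : Type} [Fintype ι] [Fintype κ] [Unique ι] [Unique κ]
    {e : Matrix ι ι R} {f : Matrix κ κ R} (he : e * e = e) (hf : f * f = f)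
    (h : e default default = f default default) : K₀.mk e he = K₀.mk f hf := by
  refine congrArg _ (V.mk_eq_submatrix he hf (Equiv.ofUnique κ ι) (Matrix.ext fun i j => ?_))
  rw [Matrix.submatrix_apply, Subsingleton.elim i default, Subsingleton.elim j default, ← h]
  congr 1

theorem K₀.mk_congr {ι : Type} [Fintype ι] {e f : Matrix ι ι R} (he : e * e = e) (h : e = f) :
    K₀.mk e he = K₀.mk f (h ▸ he) := by
  subst h
  rfl

theorem idem_of_unique {ι : Type} [Fintype ι] [Unique ι] {p : R} (hp : p * p = p) :
    (Matrix.of fun _ _ : ι => p) * (Matrix.of fun _ _ : ι => p) = Matrix.of fun _ _ : ι => p := by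
  ext i j
  simp [Matrix.mul_apply, hp]

theorem diagonal_idem {ι : Type} [Fintype ι] [DecidableEq ι] {p : R} (hp : p * p = p) :
    (Matrix.diagonal fun _ : ι => p) * (Matrix.diagonal fun _ : ι => p) =
      Matrix.diagonal fun _ : ι => p := by
  rw [Matrix.diagonal_mul_diagonal, hp]

theorem K₀.mk_diagonal {p : R} (hp : p * p = p) (n : ℕ) :
    K₀.mk (Matrix.diagonal fun _ : Fin n => p) (diagonal_idem hp) =
      n • K₀.mk (Matrix.of fun _ _ : Unit => p) (idem_of_unique hp) := by
  induction n with
  | zero =>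
    have h : V.mk (Matrix.diagonal fun _ : Fin 0 => p) (diagonal_idem hp) = 0 :=
      V.mk_eq_submatrix _ _ (Equiv.refl _) (Subsingleton.elim _ _)
    rw [K₀.mk, h, zero_smul, map_zero]
  | succ n ih =>
    have h1 : K₀.mk (Matrix.diagonal fun _ : Fin 1 => p) (diagonal_idem hp) =
        K₀.mk (Matrix.of fun _ _ : Unit => p) (idem_of_unique hp) :=
      K₀.mk_eq_of_unique _ _ (by simp)
    rw [succ_nsmul, ← ih, ← h1, ← K₀.mk_fromBlocks]
    refine congrArg _ (V.mk_eq_submatrix _ _ finSumFinEquiv ?_)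
    rw [Matrix.fromBlocks_diagonal, Matrix.submatrix_diagonal_equiv]
    congr 1
    ext i
    rcases i with i | i <;> rfl

theorem K₀.mk_one_sub_add {p : R} (hp : p * p = p) :
    K₀.mk (Matrix.of fun _ _ : Unit => 1 - p)
        (idem_of_unique (IsIdempotentElem.one_sub (a := p) hp)) +
      K₀.mk (Matrix.of fun _ _ : Unit => p) (idem_of_unique hp) =
      K₀.mk (1 : Matrix Unit Unit R) (one_mul 1) := by
  have hq : (1 - p) * (1 - p) = 1 - p := IsIdempotentElem.one_sub (a := p) hp
  have h1 : (1 - p) * p = 0 := by rw [sub_mul, one_mul, hp, sub_self]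
  have h2 : p * (1 - p) = 0 := by rw [mul_sub, mul_one, hp, sub_self]
  rw [← K₀.mk_fromBlocks]
  -- The orthogonal idempotents 1 − p and p, as a column and as a row, implement the equivalence of
  -- diag(1 − p, p) with 1.
  refine K₀.mk_eq _ _ ⟨Matrix.of fun i _ => Sum.elim (fun _ => 1 - p) (fun _ => p) i,
    Matrix.of fun _ j => Sum.elim (fun _ => 1 - p) (fun _ => p) j, ?_, ?_⟩
  · ext i j
    rcases i with i | i <;> rcases j with j | j <;> simp [Matrix.mul_apply, hp, hq, h1, h2]
  · ext i j
    simp [Matrix.mul_apply, hp, hq]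

end KZeroLemmas

section KZeroMap

variable {J J' J'' : Type} [NonUnitalRing J] [Module ℂ J] [IsScalarTower ℂ J J]
  [SMulCommClass ℂ J J] [NonUnitalRing J'] [Module ℂ J'] [IsScalarTower ℂ J' J']
  [SMulCommClass ℂ J' J'] [NonUnitalRing J''] [Module ℂ J''] [IsScalarTower ℂ J'' J'']
  [SMulCommClass ℂ J'' J'']

theorem unitizationMap_inl_add_inr (φ : J →ₙₐ[ℂ] J') (r : ℂ) (a : J) :
    unitizationMap φ (Unitization.inl r + Unitization.inr a) =
      Unitization.inl r + Unitization.inr (φ a) := by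
  simp [unitizationMap, Unitization.algebraMap_eq_inl]

theorem KZero.coe_map (φ : J →ₙₐ[ℂ] J') (x : KZero J) : (KZero.map φ x : K₀ (Unitization ℂ J')) =
    K₀.map (unitizationMap φ : Unitization ℂ J →+* Unitization ℂ J') (x : K₀ (Unitization ℂ J)) :=
  rfl

theorem KZero.map_map (φ : J →ₙₐ[ℂ] J') (ψ : J' →ₙₐ[ℂ] J'') (x : KZero J) :
    KZero.map ψ (KZero.map φ x) = KZero.map (ψ.comp φ) x := by
  apply Subtype.ext
  change K₀.map _ (K₀.map _ x.1) = K₀.map _ x.1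
  rw [K₀.map_map]
  congr 1
  congr 1
  refine RingHom.ext fun y => ?_
  change unitizationMap ψ (unitizationMap φ y) = unitizationMap (ψ.comp φ) y
  induction y with
  | inl_add_inr r a => simp only [unitizationMap_inl_add_inr, NonUnitalAlgHom.comp_apply]

theorem KZero.map_mk (φ : J →ₙₐ[ℂ] J') (e : J) (he : e * e = e) :
    KZero.map φ (KZero.mk e he) = KZero.mk (φ e) (by rw [← map_mul, he]) := by
  apply Subtype.ext
  change K₀.map _ (K₀.mk _ _) = K₀.mk _ _
  rw [K₀.map_mk]
  refine K₀.mk_congr _ (Matrix.ext fun i j => ?_)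
  have := unitizationMap_inl_add_inr φ 0 e
  simpa using this

/-- The row x and the column y implement an equivalence of e with diag(p, …, p), taken inside the
unitization. -/
theorem KZero.mk_eq_nsmul {n : ℕ} {e p : J} (he : e * e = e) (hp : p * p = p) (x y : Fin n → J)
    (h1 : ∑ i, x i * y i = e) (h2 : ∀ i j, y i * x j = if i = j then p else 0) :
    KZero.mk e he = n • KZero.mk p hp := by
  apply Subtype.ext
  rw [AddSubgroup.coe_nsmul]
  have hp' : (p : Unitization ℂ J) * (p : Unitization ℂ J) = p := by rw [← Unitization.inr_mul, hp]
  refine Eq.trans ?_ (K₀.mk_diagonal hp' n)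
  refine K₀.mk_eq _ _ ⟨Matrix.of fun _ j => (x j : Unitization ℂ J),
    Matrix.of fun i _ => (y i : Unitization ℂ J), ?_, ?_⟩
  · ext1 i j
    simp only [Matrix.mul_apply, Matrix.of_apply, ← Unitization.inr_mul, ← h1]
    exact (map_sum (Unitization.inrNonUnitalAlgHom ℂ J) _ _).symm
  · ext1 i j
    simp only [Matrix.mul_apply, Matrix.of_apply, ← Unitization.inr_mul, h2, Matrix.diagonal_apply,
      Finset.univ_unique, Finset.sum_singleton]
    split_ifs <;> simp

end KZeroMap

/-! ### Naturality of the relative classes and of the index. -/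

section Naturality

variable {A B A' B' J : Type} [Ring A] [Ring B] [Algebra ℂ A] [Algebra ℂ B] [Ring A'] [Ring B']
  [Algebra ℂ A'] [Algebra ℂ B'] [NonUnitalRing J] [Module ℂ J] [IsScalarTower ℂ J J]
  [SMulCommClass ℂ J J]

theorem unitizationMat_map_unitizationMap {π : A →ₐ[ℂ] B} {π' : A' →ₐ[ℂ] B'}
    {φ : kerAlg π →ₙₐ[ℂ] J} {φ' : kerAlg π' →ₙₐ[ℂ] J} (ρ : A →ₐ[ℂ] A')
    (hφ : ∀ (a : kerAlg π) (b : kerAlg π'), (b : A') = ρ a → φ' b = φ a) {ι : Type}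
    {q : Matrix ι ι A} {s : Matrix ι ι ℂ} (h : q.map π = scalarMat B s)
    {q' : Matrix ι ι A'} (h' : q'.map π' = scalarMat B' s) (e : q' = q.map ρ) :
    (unitizationMat π q s h).map (unitizationMap φ) =
      (unitizationMat π' q' s h').map (unitizationMap φ') := by
  subst e
  refine Matrix.ext fun i j => ?_
  rw [Matrix.map_apply, Matrix.map_apply, unitizationMat, unitizationMat, Matrix.of_apply,
    Matrix.of_apply, unitizationMap_inl_add_inr, unitizationMap_inl_add_inr]
  congr 2
  refine (hφ _ _ ?_).symm
  exact ((map_sub ρ _ _).trans (by rw [AlgHom.commutes]; rfl)).symm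

theorem coe_relClass (π : A →ₐ[ℂ] B) {ι : Type} [Fintype ι]
    {q : Matrix ι ι A} {s : Matrix ι ι ℂ} (h : q.map π = scalarMat B s) (hq : q * q = q)
    (hs : s * s = s) : (relClass π q s h hq hs : K₀ (Unitization ℂ (kerAlg π))) =
      K₀.mk (unitizationMat π q s h) (unitizationMat_idem π h hq hs) -
      K₀.mk (scalarMat (Unitization ℂ (kerAlg π)) s) (idem_map hs (algebraMap ℂ _)) :=
  rfl

theorem coe_map_relClass {π : A →ₐ[ℂ] B} (φ : kerAlg π →ₙₐ[ℂ] J) {ι : Type} [Fintype ι]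
    {q : Matrix ι ι A} {s : Matrix ι ι ℂ} (h : q.map π = scalarMat B s) (hq : q * q = q)
    (hs : s * s = s) : (KZero.map φ (relClass π q s h hq hs) : K₀ (Unitization ℂ J)) =
      K₀.mk ((unitizationMat π q s h).map (unitizationMap φ : _ →+* Unitization ℂ J))
        (idem_map (unitizationMat_idem π h hq hs) _) -
      K₀.mk (scalarMat (Unitization ℂ J) s) (idem_map hs (algebraMap ℂ _)) := by
  rw [KZero.coe_map, coe_relClass, AddMonoidHom.map_sub, K₀.map_mk, K₀.map_mk]
  congr 1
  exact K₀.mk_congr _ (map_scalarMat (unitizationMap φ) s)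

/-- Both kernels are compared through maps into a common J. The condition `hφ` replaces an explicit
map between the kernels. -/
theorem map_relClass {π : A →ₐ[ℂ] B} {π' : A' →ₐ[ℂ] B'} {φ : kerAlg π →ₙₐ[ℂ] J}
    {φ' : kerAlg π' →ₙₐ[ℂ] J} (ρ : A →ₐ[ℂ] A')
    (hφ : ∀ (a : kerAlg π) (b : kerAlg π'), (b : A') = ρ a → φ' b = φ a) {ι : Type} [Fintype ι]
    {q : Matrix ι ι A} {s : Matrix ι ι ℂ} (h : q.map π = scalarMat B s) (hq : q * q = q)
    (hs : s * s = s) {q' : Matrix ι ι A'} (h' : q'.map π' = scalarMat B' s) (hq' : q' * q' = q')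
    (e : q' = q.map ρ) :
    KZero.map φ (relClass π q s h hq hs) = KZero.map φ' (relClass π' q' s h' hq' hs) := by
  apply Subtype.ext
  rw [coe_map_relClass, coe_map_relClass]
  congr 1
  exact K₀.mk_congr _ (unitizationMat_map_unitizationMap ρ hφ h h' e)

/-- The image of a lift under ρ is a lift of the image, and `liftClass_eq` makes the choice of lift
irrelevant; what remains is naturality of a relative class. -/
theorem map_liftClass {π : A →ₐ[ℂ] B} {π' : A' →ₐ[ℂ] B'} {φ : kerAlg π →ₙₐ[ℂ] J}
    {φ' : kerAlg π' →ₙₐ[ℂ] J} (ρ : A →ₐ[ℂ] A')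
    (hφ : ∀ (a : kerAlg π) (b : kerAlg π'), (b : A') = ρ a → φ' b = φ a) (ρ' : B →ₐ[ℂ] B')
    (hρ : ∀ a, π' (ρ a) = ρ' (π a)) {ι : Type} [Fintype ι] [DecidableEq ι]
    {w : (Matrix (ι ⊕ ι) (ι ⊕ ι) A)ˣ} {u x : (Matrix ι ι B)ˣ} (h : mapUnit π w = blockUnit u x)
    {w' : (Matrix (ι ⊕ ι) (ι ⊕ ι) A')ˣ} {u' x' : (Matrix ι ι B')ˣ}
    (h' : mapUnit π' w' = blockUnit u' x') (hu : mapUnit ρ' u = u') :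
    KZero.map φ (liftClass π w u x h) = KZero.map φ' (liftClass π' w' u' x' h') := by
  have h1 : mapUnit π' (mapUnit ρ w) = blockUnit (mapUnit ρ' u) (mapUnit ρ' x) := by
    ext1
    have h2 : w.val.map π = Matrix.fromBlocks u.val 0 0 x.val := by
      rw [← mapUnit_val, h]
      rfl
    have h3 : (w.val.map ρ).map π' = (w.val.map π).map ρ' := Matrix.ext fun i j => hρ _
    rw [mapUnit_val, mapUnit_val, h3, h2, Matrix.fromBlocks_map]
    simp only [Matrix.map_zero _ (map_zero ρ')]
    rfl
  rw [← liftClass_eq π' h1 h' 1 (by rw [hu, map_one, inv_mul_cancel])]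
  refine map_relClass ρ hφ _ _ _ _ _ ?_
  rw [map_mul₀, map_mul₀, map_scalarMat, mapUnit_val, ← map_inv, mapUnit_val]

end Naturality

/-! ### The index of an element that has a generalized inverse. -/

section GeneralizedInverse

variable {A B : Type} [Ring A] [Ring B] [Algebra ℂ A] [Algebra ℂ B]

theorem relClass_idem (π : A →ₐ[ℂ] B) (e : kerAlg π) (he : e * e = e)
    (h : (Matrix.scalar (Fin 1) (e : A)).map π = scalarMat B 0)
    (hq : Matrix.scalar (Fin 1) (e : A) * Matrix.scalar (Fin 1) (e : A) =
      Matrix.scalar (Fin 1) (e : A)) :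
    relClass π (Matrix.scalar (Fin 1) (e : A)) 0 h hq (mul_zero 0) = KZero.mk e he := by
  apply Subtype.ext
  change K₀.mk _ _ - K₀.mk _ _ = K₀.mk _ _
  have h0 : K₀.mk (scalarMat (Unitization ℂ (kerAlg π)) (0 : Matrix (Fin 1) (Fin 1) ℂ))
      (idem_map (mul_zero 0) (algebraMap ℂ _)) = 0 := by
    have h1 := K₀.mk_diagonal (R := Unitization ℂ (kerAlg π)) (p := 0) (mul_zero 0) 1
    have h2 := K₀.mk_diagonal (R := Unitization ℂ (kerAlg π)) (p := 0) (mul_zero 0) 0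
    have h3 := K₀.mk_eq (diagonal_idem (ι := Fin 1) (R := Unitization ℂ (kerAlg π)) (p := 0)
      (mul_zero 0)) (diagonal_idem (ι := Fin 0) (p := 0) (mul_zero 0)) ⟨0, 0, by simp,
        Subsingleton.elim _ _⟩
    rw [h2, zero_smul] at h3
    rw [← h3]
    exact K₀.mk_congr _ (by ext1 i j; simp)
  rw [h0, sub_zero]
  refine K₀.mk_eq_of_unique _ _ ?_
  simp [unitizationMat]

theorem relClass_one_sub_idem (π : A →ₐ[ℂ] B) (f : kerAlg π) (hf : f * f = f)
    (h : (Matrix.scalar (Fin 1) (1 - f : A)).map π = scalarMat B 1)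
    (hq : Matrix.scalar (Fin 1) (1 - f : A) * Matrix.scalar (Fin 1) (1 - f : A) =
      Matrix.scalar (Fin 1) (1 - f : A)) :
    relClass π (Matrix.scalar (Fin 1) (1 - f : A)) 1 h hq (mul_one 1) = -KZero.mk f hf := by
  apply Subtype.ext
  change K₀.mk _ _ - K₀.mk _ _ = -K₀.mk _ _
  have hf' : (f : Unitization ℂ (kerAlg π)) * (f : Unitization ℂ (kerAlg π)) = f := by
    rw [← Unitization.inr_mul, hf]
  -- The claim takes the form [1 − f]₀ + [f]₀ = [1]₀.
  rw [sub_eq_iff_eq_add, neg_add_eq_sub, eq_sub_iff_add_eq]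
  refine Eq.trans ?_ ((K₀.mk_one_sub_add hf').trans ?_)
  · congr 1
    refine K₀.mk_eq_of_unique _ _ ?_
    simp only [unitizationMat, Matrix.of_apply, Matrix.scalar_apply, Matrix.diagonal_apply_eq,
      Matrix.one_apply_eq, map_one, Unitization.inl_one, sub_eq_add_neg]
    congr 1
    rw [← Unitization.inr_neg]
    congr 1
    ext1
    simp
  · exact K₀.mk_eq_of_unique _ _ (by simp)

/-- The invertible matrix determined by an element and a generalized inverse. -/
def generalizedInverseUnit {T S : A} (h1 : T * S * T = T) (h2 : S * T * S = S) :
    (Matrix (Fin 1 ⊕ Fin 1) (Fin 1 ⊕ Fin 1) A)ˣ where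
  val := Matrix.fromBlocks (Matrix.scalar _ T) (Matrix.scalar _ (1 - T * S))
    (Matrix.scalar _ (1 - S * T)) (Matrix.scalar _ S)
  inv := Matrix.fromBlocks (Matrix.scalar _ S) (Matrix.scalar _ (1 - S * T))
    (Matrix.scalar _ (1 - T * S)) (Matrix.scalar _ T)
  val_inv := by
    rw [Matrix.fromBlocks_multiply, ← Matrix.fromBlocks_one]
    simp only [← map_mul, ← map_add]
    have a1 : T * (S * T) = T := by rw [← mul_assoc, h1]
    have a2 : S * (T * S) = S := by rw [← mul_assoc, h2]
    congr 1 <;> simp [mul_sub, sub_mul, mul_assoc, a1, a2]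
  inv_val := by
    rw [Matrix.fromBlocks_multiply, ← Matrix.fromBlocks_one]
    simp only [← map_mul, ← map_add]
    have a1 : T * (S * T) = T := by rw [← mul_assoc, h1]
    have a2 : S * (T * S) = S := by rw [← mul_assoc, h2]
    congr 1 <;> simp [mul_sub, sub_mul, mul_assoc, a1, a2]

/-- Conjugating diag(1, 0) by this matrix gives diag(TS, 1 − ST), that is diag(1 − f, e). Relative
to diag(1, 0), the first block contributes −[f]₀ and the second [e]₀. -/
theorem liftClass_generalizedInverseUnit (π : A →ₐ[ℂ] B) {T S : A} (h1 : T * S * T = T)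
    (h2 : S * T * S = S) {e f : kerAlg π} (he : e * e = e) (hf : f * f = f)
    (e' : (e : A) = 1 - S * T) (f' : (f : A) = 1 - T * S) (u x : (Matrix (Fin 1) (Fin 1) B)ˣ)
    (h : mapUnit π (generalizedInverseUnit h1 h2) = blockUnit u x) :
    liftClass π (generalizedInverseUnit h1 h2) u x h = KZero.mk e he - KZero.mk f hf := by
  have eA : (e : A) * e = e := congrArg Subtype.val he
  have fA : (f : A) * f = f := congrArg Subtype.val hf
  have q1 : Matrix.scalar (Fin 1) (e : A) * Matrix.scalar (Fin 1) (e : A) =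
      Matrix.scalar (Fin 1) (e : A) := by rw [← map_mul, eA]
  have q2 : Matrix.scalar (Fin 1) (1 - f : A) * Matrix.scalar (Fin 1) (1 - f : A) =
      Matrix.scalar (Fin 1) (1 - f : A) := by
    rw [← map_mul, IsIdempotentElem.one_sub (a := (f : A)) fA]
  have m1 : (Matrix.scalar (Fin 1) (e : A)).map π = scalarMat B 0 := by
    have : π e = 0 := e.2
    ext i j
    simp [Matrix.diagonal_apply, apply_ite, this]
  have m2 : (Matrix.scalar (Fin 1) (1 - f : A)).map π = scalarMat B 1 := by
    have : π f = 0 := f.2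
    ext i j
    rw [Subsingleton.elim j i]
    simp [this]
  have key : (generalizedInverseUnit h1 h2).val * scalarMat A (corner (Fin 1)) *
      (generalizedInverseUnit h1 h2)⁻¹.val = Matrix.fromBlocks (Matrix.scalar (Fin 1) (1 - f : A)) 0
        0 (Matrix.scalar (Fin 1) (e : A)) := by
    rw [scalarMat_corner, e', f']
    change Matrix.fromBlocks (Matrix.scalar _ T) (Matrix.scalar _ (1 - T * S))
      (Matrix.scalar _ (1 - S * T)) (Matrix.scalar _ S) * _ *
      Matrix.fromBlocks (Matrix.scalar _ S) (Matrix.scalar _ (1 - S * T))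
      (Matrix.scalar _ (1 - T * S)) (Matrix.scalar _ T) = _
    rw [Matrix.fromBlocks_multiply, Matrix.fromBlocks_multiply]
    simp only [mul_one, mul_zero, zero_mul, add_zero, ← map_mul]
    have a1 : T * (S * T) = T := by rw [← mul_assoc, h1]
    have a2 : S * (T * S) = S := by rw [← mul_assoc, h2]
    congr 1 <;> simp [mul_sub, sub_mul, mul_assoc, a1, a2]
  have hc : corner (Fin 1) = Matrix.fromBlocks 1 0 0 0 := rfl
  rw [liftClass, relClass_congr π _ _ _ key hc, relClass_fromBlocks π m2 q2 (mul_one 1) m1 q1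
    (mul_zero 0), relClass_idem π e he, relClass_one_sub_idem π f hf, neg_add_eq_sub]

end GeneralizedInverse

/-- In the quotient the off-diagonal blocks vanish and the images of T and S become inverse to each
other. -/
theorem exists_mapUnit_generalizedInverseUnit {A B : Type} [Ring A] [Ring B] [Algebra ℂ A]
    [Algebra ℂ B] (π : A →ₐ[ℂ] B) {T S : A} (h1 : T * S * T = T) (h2 : S * T * S = S)
    (e : π (1 - S * T) = 0) (f : π (1 - T * S) = 0) :
    ∃ u x : (Matrix (Fin 1) (Fin 1) B)ˣ,
      mapUnit π (generalizedInverseUnit h1 h2) = blockUnit u x ∧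
      u.val = Matrix.scalar (Fin 1) (π T) := by
  have s1 : π S * π T = 1 := by
    rw [map_sub, map_one, map_mul, sub_eq_zero] at e
    exact e.symm
  have s2 : π T * π S = 1 := by
    rw [map_sub, map_one, map_mul, sub_eq_zero] at f
    exact f.symm
  let u : Bˣ := ⟨π T, π S, s2, s1⟩
  let sc : Bˣ →* (Matrix (Fin 1) (Fin 1) B)ˣ :=
    Units.map (Matrix.scalar (Fin 1) : B →+* _).toMonoidHom
  refine ⟨sc u, sc u⁻¹, ?_, rfl⟩
  have hm : ∀ x : A, (Matrix.scalar (Fin 1) x).map π = Matrix.scalar (Fin 1) (π x) := fun x => by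
    ext i j
    rw [Subsingleton.elim j i]
    simp
  ext1
  change (Matrix.fromBlocks (Matrix.scalar _ T) (Matrix.scalar _ (1 - T * S))
    (Matrix.scalar _ (1 - S * T)) (Matrix.scalar _ S)).map π =
    Matrix.fromBlocks (Matrix.scalar (Fin 1) (π T)) 0 0 (Matrix.scalar (Fin 1) (π S))
  rw [Matrix.fromBlocks_map, hm, hm, hm, hm, e, f, map_zero]

theorem map_liftClass_generalizedInverseUnit {A B J : Type} [Ring A] [Ring B] [Algebra ℂ A]
    [Algebra ℂ B] [NonUnitalRing J] [Module ℂ J] [IsScalarTower ℂ J J] [SMulCommClass ℂ J J]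
    (π : A →ₐ[ℂ] B) (φ : kerAlg π →ₙₐ[ℂ] J) {T S : A} (h1 : T * S * T = T) (h2 : S * T * S = S)
    {e f : kerAlg π} (e' : (e : A) = 1 - S * T) (f' : (f : A) = 1 - T * S)
    (u x : (Matrix (Fin 1) (Fin 1) B)ˣ)
    (h : mapUnit π (generalizedInverseUnit h1 h2) = blockUnit u x) {p q : J} (hp : p * p = p)
    (hq : q * q = q) (hep : φ e = p) (hfq : φ f = q) :
    KZero.map φ (liftClass π (generalizedInverseUnit h1 h2) u x h) =
      KZero.mk p hp - KZero.mk q hq := by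
  have he : e * e = e := by
    ext1
    change (e : A) * e = e
    rw [e']
    exact IsIdempotentElem.one_sub (show S * T * (S * T) = S * T by rw [← mul_assoc, h2])
  have hf : f * f = f := by
    ext1
    change (f : A) * f = f
    rw [f']
    exact IsIdempotentElem.one_sub (show T * S * (T * S) = T * S by rw [← mul_assoc, h1])
  subst hep hfq
  rw [liftClass_generalizedInverseUnit π h1 h2 he hf e' f', AddMonoidHom.map_sub, KZero.map_mk,
    KZero.map_mk]

/-- The index of an invertible element, computed with a generalized inverse of a lift. -/
theorem map_indexMap_ofUnit {A B A' B' J : Type} [Ring A] [Ring B] [Algebra ℂ A] [Algebra ℂ B]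
    [TopologicalSpace A] [TopologicalSpace B] [IsTopologicalRing A] [IsTopologicalRing B] [Ring A']
    [Ring B'] [Algebra ℂ A'] [Algebra ℂ B'] [NonUnitalRing J] [Module ℂ J] [IsScalarTower ℂ J J]
    [SMulCommClass ℂ J J] {π : A →ₐ[ℂ] B} (hπ : Function.Surjective π) (ho : IsOpenMap π)
    (hA : MatrixUnitsOpen A) {π' : A' →ₐ[ℂ] B'} {φ : kerAlg π →ₙₐ[ℂ] J} {φ' : kerAlg π' →ₙₐ[ℂ] J}
    (ρ : A →ₐ[ℂ] A') (hφ : ∀ (a : kerAlg π) (b : kerAlg π'), (b : A') = ρ a → φ' b = φ a)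
    (ρ' : B →ₐ[ℂ] B') (hρ : ∀ a, π' (ρ a) = ρ' (π a)) (U : Bˣ) {T S : A'} (hU : ρ' U = π' T)
    (h1 : T * S * T = T) (h2 : S * T * S = S) (he : 1 - S * T ∈ kerAlg π')
    (hf : 1 - T * S ∈ kerAlg π') {p q : J} (hp : p * p = p) (hq : q * q = q)
    (hep : φ' ⟨_, he⟩ = p) (hfq : φ' ⟨_, hf⟩ = q) :
    KZero.map φ (indexMap π hπ ho hA (KOne.ofUnit U)) = KZero.mk p hp - KZero.mk q hq := by
  -- An arbitrary lift computes the index map over `A`; naturality then permits the explicit lift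
  -- built from T and S over `A'`.
  obtain ⟨w, hw⟩ := exists_lift π hπ
    (Units.map (Matrix.scalar (Fin 1) : B →+* _).toMonoidHom U)
  obtain ⟨u, x, h, hu⟩ := exists_mapUnit_generalizedInverseUnit π' h1 h2 he hf
  have hu' : mapUnit ρ' (Units.map (Matrix.scalar (Fin 1) : B →+* _).toMonoidHom U) = u := by
    ext1
    rw [hu]
    refine Matrix.ext fun i j => ?_
    rw [Subsingleton.elim j i, Matrix.scalar_apply, Matrix.diagonal_apply_eq, ← hU]
    change ρ' (Matrix.scalar (Fin 1) (U : B) i i) = _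
    rw [Matrix.scalar_apply, Matrix.diagonal_apply_eq]
  rw [KOne.ofUnit, indexMap_mk π hπ ho hA _ _ w hw, map_liftClass ρ hφ ρ' hρ hw h hu']
  exact map_liftClass_generalizedInverseUnit π' φ' h1 h2 rfl rfl u x h hp hq hep hfq

theorem KZero.mk_sub_mk {J : Type} [NonUnitalRing J] [Module ℂ J] [IsScalarTower ℂ J J]
    [SMulCommClass ℂ J J] {p q e : J} (hp : p * p = p) (hq : q * q = q) (he : e * e = e) {m n : ℕ}
    {k : ℤ} (h1 : KZero.mk p hp = m • KZero.mk e he) (h2 : KZero.mk q hq = n • KZero.mk e he)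
    (hk : k = m - n) : KZero.mk p hp - KZero.mk q hq = k • KZero.mk e he := by
  rw [h1, h2, hk, sub_zsmul, natCast_zsmul, natCast_zsmul, sub_eq_add_neg]

end KTheory

namespace PsiDO

open MeasureTheory Filter Topology
open scoped ENNReal FourierTransform

/-! ### Classes of finite rank idempotents in K₀(𝔎_ℤ). -/

section FiniteRankClass

theorem isCompactOperator_smulRight (l : L2Z →L[ℂ] ℂ) (a : L2Z) :
    IsCompactOperator (l.smulRight a) := by
  have h1 : IsCompactOperator l := isCompactOperator_of_locallyCompactSpace_dom l
  exact h1.clm_comp (ContinuousLinearMap.toSpanSingleton ℂ a)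

/-- A rank-one operator as an element of `𝔎_ℤ`. -/
noncomputable def rankOne (l : L2Z →L[ℂ] ℂ) (a : L2Z) : algK :=
  ⟨l.smulRight a, isCompactOperator_smulRight l a⟩

theorem rankOne_mul_rankOne (l m : L2Z →L[ℂ] ℂ) (a b : L2Z) :
    rankOne l a * rankOne m b = rankOne m (l b • a) := by
  apply Subtype.ext
  refine ContinuousLinearMap.ext fun x => ?_
  change l (m x • b) • a = m x • l b • a
  rw [map_smul, smul_assoc]

/-- e is the identity on its range, so a basis b_i of the range and its coordinate functionals
composed with e are biorthogonal and decompose e. -/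
theorem exists_dual_families {e : algB} (he : e * e = e) [FiniteDimensional ℂ e.range] :
    ∃ (b : Fin (Module.finrank ℂ e.range) → L2Z) (l : Fin (Module.finrank ℂ e.range) → L2Z →L[ℂ] ℂ),
      (∀ i j, l i (b j) = if i = j then 1 else 0) ∧ ∀ x, ∑ i, l i x • b i = e x := by
  let B := Module.finBasis ℂ e.range
  let p : L2Z →L[ℂ] e.range := e.codRestrict e.range fun x => ⟨x, rfl⟩
  have hp : ∀ y : e.range, p y = y := by
    rintro ⟨_, x, rfl⟩
    apply Subtype.ext
    exact congrArg (fun T : algB => T x) he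
  refine ⟨fun i => B i, fun i => (LinearMap.toContinuousLinearMap (B.coord i)) ∘L p, ?_, ?_⟩
  · intro i j
    change B.coord i (p (B j)) = _
    rw [hp, Module.Basis.coord_apply, Module.Basis.repr_self, Finsupp.single_apply]
    simp only [eq_comm]
  · intro x
    have h := congrArg (fun y : e.range => (y : L2Z)) (B.sum_repr (p x))
    simp only [Submodule.coe_sum, Submodule.coe_smul] at h
    exact h

/-- The class of a finite rank idempotent is a multiple of the class of any rank-one idempotent. -/
theorem mk_eq_finrank_nsmul {e E : algK} (he : e * e = e) (hE : E * E = E)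
    [FiniteDimensional ℂ (e : algB).range] (h1 : Module.finrank ℂ (E : algB).range = 1) :
    KTheory.KZero.mk e he =
      Module.finrank ℂ (e : algB).range • KTheory.KZero.mk E hE := by
  have : FiniteDimensional ℂ (E : algB).range := FiniteDimensional.of_finrank_pos (by omega)
  obtain ⟨b, l, hbl, hsum⟩ := exists_dual_families (congrArg Subtype.val he : (e : algB) * e = e)
  obtain ⟨c, m, hcm, hsum'⟩ := exists_dual_families (congrArg Subtype.val hE : (E : algB) * E = E)
  let i₀ : Fin (Module.finrank ℂ (E : algB).range) := ⟨0, by omega⟩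
  have hss : Subsingleton (Fin (Module.finrank ℂ (E : algB).range)) := by
    rw [h1]
    infer_instance
  have hm : m i₀ (c i₀) = 1 := by rw [hcm, if_pos rfl]
  have hEr : rankOne (m i₀) (c i₀) = E := by
    apply Subtype.ext
    refine ContinuousLinearMap.ext fun x => ?_
    rw [← hsum' x, Fintype.sum_subsingleton _ i₀]
    rfl
  -- With E = c ⊗ m and e = Σ b_i ⊗ l_i, take x_i = b_i ⊗ m and y_i = c ⊗ l_i. As m(c) = 1 and
  -- l_i(b_j) = δ_ij, the sum of the x_i y_i is e, and y_i x_j = δ_ij E.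
  refine KTheory.KZero.mk_eq_nsmul he hE (fun i => rankOne (m i₀) (b i))
    (fun i => rankOne (l i) (c i₀)) ?_ ?_
  · apply Subtype.ext
    refine ContinuousLinearMap.ext fun x => ?_
    simp only [rankOne_mul_rankOne, hm, one_smul]
    rw [← hsum x, AddSubmonoidClass.coe_finsetSum, sum_apply]
    rfl
  · intro i j
    rw [rankOne_mul_rankOne, hbl]
    split_ifs
    · rw [one_smul, hEr]
    · apply Subtype.ext
      refine ContinuousLinearMap.ext fun x => ?_
      change m i₀ x • (0 : ℂ) • c i₀ = 0
      rw [zero_smul, smul_zero]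

end FiniteRankClass

/-! ### The index formula, by comparison with the Calkin extension. -/

section IndexFormula

/-- The projection onto the Calkin algebra. -/
noncomputable def calkinMap : algB →ₐ[ℂ] algB ⧸ calkinIdeal := Ideal.Quotient.mkₐ ℂ calkinIdeal

theorem calkinMap_eq_zero {T : algB} : calkinMap T = 0 ↔ IsCompactOperator T :=
  Ideal.Quotient.eq_zero_iff_mem

/-- The identification of the kernel of the projection onto the Calkin algebra with `𝔎_ℤ`. -/
noncomputable def kerCalkin : KTheory.kerAlg calkinMap →ₙₐ[ℂ] algK where
  toFun T := ⟨T, calkinMap_eq_zero.1 T.2⟩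
  map_smul' _ _ := rfl
  map_zero' := rfl
  map_add' _ _ := rfl
  map_mul' _ _ := rfl

/-- The homomorphism `𝔄/𝔎_ℝ → 𝔅` induced by the boundary symbol at `v`. -/
noncomputable def boundaryQuot (v : Circle × ℤˣ) : (algA ⧸ idealK) →ₐ[ℂ] algB :=
  Ideal.Quotient.liftₐ idealK (boundarySymbolAt v) fun _ ha =>
    DFunLike.congr_fun (idealK_le_ker_boundarySymbol ha) v

/-- The homomorphism from `𝔄/𝔈` to the Calkin algebra induced by the boundary symbol at `v`. -/
noncomputable def boundaryCalkin (v : Circle × ℤˣ) :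
    (algA ⧸ idealE principalSymbol) →ₐ[ℂ] algB ⧸ calkinIdeal :=
  Ideal.Quotient.liftₐ (idealE principalSymbol) (calkinMap.comp (boundarySymbolAt v)) fun _ ha =>
    calkinMap_eq_zero.2 (isCompactOperator_boundarySymbol ha v)

theorem calkinMap_boundaryQuot (v : Circle × ℤˣ) (hK : idealK ≤ idealE principalSymbol)
    (a : algA ⧸ idealK) :
    calkinMap (boundaryQuot v a) = boundaryCalkin v (quotMap principalSymbol hK a) := by
  obtain ⟨A, rfl⟩ := Ideal.Quotient.mk_surjective a
  rfl

theorem finiteDimensional_range_one_sub_mul {T S : algB} (hF : T.IsFredholm)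
    (h1 : T * S * T = T) : FiniteDimensional ℂ (1 - T * S : algB).range := by
  have := hF.finite_coker
  have : FiniteDimensional ℂ (L2Z ⧸ (1 - T * S : algB).ker) := by
    rw [ker_one_sub_mul_eq_range h1]
    infer_instance
  exact ((1 - T * S : algB) : L2Z →ₗ[ℂ] L2Z).quotKerEquivRange.finiteDimensional

theorem mk_sub_mk_eq_fredholmIndex {T S : algB} (hF : T.IsFredholm) (h1 : T * S * T = T)
    {p q : algK} (hp : (p : algB) = 1 - S * T) (hq : (q : algB) = 1 - T * S) (hpp : p * p = p)
    (hqq : q * q = q) {E : algK} (hEE : E * E = E)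
    (hE1 : Module.finrank ℂ (E : algB).range = 1) :
    KTheory.KZero.mk p hpp - KTheory.KZero.mk q hqq =
      fredholmIndex T • KTheory.KZero.mk E hEE := by
  have fe : FiniteDimensional ℂ (p : algB).range := by
    rw [hp, range_one_sub_mul_eq_ker h1]
    exact hF.finite_ker
  have ff : FiniteDimensional ℂ (q : algB).range := by
    rw [hq]
    exact finiteDimensional_range_one_sub_mul hF h1
  refine KTheory.KZero.mk_sub_mk hpp hqq hEE (mk_eq_finrank_nsmul hpp hEE hE1)
    (mk_eq_finrank_nsmul hqq hEE hE1) ?_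
  rw [hp, hq, range_one_sub_mul_eq_ker h1, finrank_range_one_sub_mul h1, fredholmIndex]

/-- This is the compatibility `hφ` needed for naturality: on 𝔈/𝔎_ℝ, evaluation at v after γ is the
boundary symbol at v, seen in 𝔎_ℤ. -/
theorem kerCalkin_eq (hK : idealK ≤ idealE principalSymbol)
    (hγ : idealK ≤ RingHom.ker boundarySymbol)
    (hE : ∀ A ∈ idealE principalSymbol, ∀ v, IsCompactOperator (boundarySymbol A v))
    (v : Circle × ℤˣ) (a : KTheory.kerAlg (quotMap principalSymbol hK))
    (b : KTheory.kerAlg calkinMap) (hb : (b : algB) = boundaryQuot v a) :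
    kerCalkin b = (evalAt v).comp (gammaE principalSymbol boundarySymbol hK hγ hE) a := by
  obtain ⟨a, ha⟩ := a
  apply Subtype.ext
  obtain ⟨C, rfl⟩ := Ideal.Quotient.mk_surjective a
  exact hb

/-- Naturality is applied to the boundary symbol at v, viewed as a map from the extension of 𝔄/𝔈 by
𝔈/𝔎_ℝ to the Calkin extension. -/
theorem map_indexMapE_eq_sub (hK : idealK ≤ idealE principalSymbol)
    (hγ : idealK ≤ RingHom.ker boundarySymbol)
    (hE : ∀ A ∈ idealE principalSymbol, ∀ v, IsCompactOperator (boundarySymbol A v))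
    {A : algA} (hA : IsUnit (Ideal.Quotient.mk (idealE principalSymbol) A)) (v : Circle × ℤˣ)
    {S : algB} (h1 : boundarySymbol A v * S * boundarySymbol A v = boundarySymbol A v)
    (h2 : S * boundarySymbol A v * S = S) {p q : algK}
    (hp : (p : algB) = 1 - S * boundarySymbol A v) (hq : (q : algB) = 1 - boundarySymbol A v * S)
    (hpp : p * p = p) (hqq : q * q = q) :
    KTheory.KZero.map ((evalAt v).comp (gammaE principalSymbol boundarySymbol hK hγ hE))
      (indexMapE principalSymbol hK (KTheory.KOne.ofUnit hA.unit)) =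
      KTheory.KZero.mk p hpp - KTheory.KZero.mk q hqq :=
  KTheory.map_indexMap_ofUnit (quotMap_surjective principalSymbol hK)
    (isOpenMap_quotMap principalSymbol hK) matrixUnitsOpen_quot (boundaryQuot v)
    (kerCalkin_eq hK hγ hE v) (boundaryCalkin v) (calkinMap_boundaryQuot v hK) hA.unit rfl h1 h2
    (calkinMap_eq_zero.2 (hp ▸ p.2)) (calkinMap_eq_zero.2 (hq ▸ q.2)) hpp hqq
    (Subtype.ext hp.symm) (Subtype.ext hq.symm)

theorem exists_algK_idempotents {T S : algB} (hF : T.IsFredholm) (h1 : T * S * T = T)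
    (h2 : S * T * S = S) : ∃ p q : algK, (p : algB) = 1 - S * T ∧ (q : algB) = 1 - T * S ∧
      p * p = p ∧ q * q = q := by
  have ke : IsCompactOperator (1 - S * T : algB) := by
    have : FiniteDimensional ℂ (1 - S * T : algB).range := by
      rw [range_one_sub_mul_eq_ker h1]
      exact hF.finite_ker
    exact isCompactOperator_of_finiteDimensional_range _
  have kf : IsCompactOperator (1 - T * S : algB) := by
    have := finiteDimensional_range_one_sub_mul hF h1
    exact isCompactOperator_of_finiteDimensional_range _
  exact ⟨⟨_, ke⟩, ⟨_, kf⟩, rfl, rfl,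
    Subtype.ext (IsIdempotentElem.one_sub
      (show S * T * (S * T) = S * T by rw [← mul_assoc, h2])),
    Subtype.ext (IsIdempotentElem.one_sub
      (show T * S * (T * S) = T * S by rw [← mul_assoc, h1]))⟩

theorem map_indexMapE (hK : idealK ≤ idealE principalSymbol)
    (hγ : idealK ≤ RingHom.ker boundarySymbol)
    (hE : ∀ A ∈ idealE principalSymbol, ∀ v, IsCompactOperator (boundarySymbol A v))
    {A : algA} (hA : IsUnit (Ideal.Quotient.mk (idealE principalSymbol) A)) (v : Circle × ℤˣ)
    {E : algK} (hEE : E * E = E) (hE1 : Module.finrank ℂ (E : algB).range = 1) :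
    KTheory.KZero.map ((evalAt v).comp (gammaE principalSymbol boundarySymbol hK hγ hE))
      (indexMapE principalSymbol hK (KTheory.KOne.ofUnit hA.unit)) =
      fredholmIndex (boundarySymbol A v) • KTheory.KZero.mk E hEE :=
  (exists_generalized_inverse (isFredholm_boundarySymbol hA v)).elim fun _ h =>
    (exists_algK_idempotents (isFredholm_boundarySymbol hA v) h.1 h.2).elim fun _ h' =>
      h'.elim fun _ h'' =>
        (map_indexMapE_eq_sub hK hγ hE hA v h.1 h.2 h''.1 h''.2.1 h''.2.2.1 h''.2.2.2).trans
          (mk_sub_mk_eq_fredholmIndex (isFredholm_boundarySymbol hA v) h.1 h''.1 h''.2.1 h''.2.2.1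
            h''.2.2.2 hEE hE1)

theorem map_evalAt_gammaE_indexMapE (hK : idealK ≤ idealE principalSymbol)
    (hγ : idealK ≤ RingHom.ker boundarySymbol)
    (hE : ∀ A ∈ idealE principalSymbol, ∀ v, IsCompactOperator (boundarySymbol A v))
    {A : algA} (hA : IsUnit (Ideal.Quotient.mk (idealE principalSymbol) A)) (v : Circle × ℤˣ)
    {E : algK} (hEE : E * E = E) (hE1 : Module.finrank ℂ (E : algB).range = 1) :
    KTheory.KZero.map (evalAt v) (KTheory.KZero.map (gammaE principalSymbol boundarySymbol hK hγ hE)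
      (indexMapE principalSymbol hK (KTheory.KOne.ofUnit hA.unit))) =
      fredholmIndex (boundarySymbol A v) • KTheory.KZero.mk E hEE :=
  (KTheory.KZero.map_map _ _ _).trans (map_indexMapE hK hγ hE hA v hEE hE1)

end IndexFormula

end PsiDO

theorem mainTheorem6 :
    ∃ (σ : PsiDO.algA →⋆ₐ[ℂ] C(PsiDO.spaceX × ℤˣ, ℂ))
      (γ : PsiDO.algA →⋆ₐ[ℂ] C(Circle × ℤˣ, PsiDO.algB)),
      (PsiDO.IsPrincipalSymbol σ ∧ ∀ σ', PsiDO.IsPrincipalSymbol σ' → σ' = σ) ∧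
      (PsiDO.IsBoundarySymbol γ ∧ ∀ γ', PsiDO.IsBoundarySymbol γ' → γ' = γ) ∧
      ∃ (hσK : PsiDO.idealK ≤ PsiDO.idealE σ) (hγK : PsiDO.idealK ≤ RingHom.ker γ)
        (hγE : ∀ A ∈ PsiDO.idealE σ, ∀ v, IsCompactOperator (γ A v)),
        ∀ (A : PsiDO.algA) (hA : IsUnit (Ideal.Quotient.mk (PsiDO.idealE σ) A)),
          (∀ (z : Circle) (s : ℤˣ), (γ A (z, s)).IsFredholm) ∧
          ∀ (E : PsiDO.algK) (hE : IsStarProjection (E : PsiDO.algB)),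
            Module.finrank ℂ (E : PsiDO.algB).range = 1 →
            PsiDO.delta₁ σ γ hσK hγK hγE (KTheory.KOne.ofUnit hA.unit) =
              (PsiDO.fredholmIndex (γ A (1, -1)) •
                  KTheory.KZero.mk E (Subtype.ext hE.isIdempotentElem),
                PsiDO.fredholmIndex (γ A (1, 1)) •
                  KTheory.KZero.mk E (Subtype.ext hE.isIdempotentElem)) := by
  refine ⟨PsiDO.principalSymbol, PsiDO.boundarySymbol,
    ⟨PsiDO.isPrincipalSymbol_principalSymbol,
      fun σ' h => h.unique PsiDO.isPrincipalSymbol_principalSymbol⟩,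
    ⟨PsiDO.isBoundarySymbol_boundarySymbol,
      fun γ' h => h.unique PsiDO.isBoundarySymbol_boundarySymbol⟩,
    PsiDO.idealK_le_idealE, PsiDO.idealK_le_ker_boundarySymbol,
    fun A hA v => PsiDO.isCompactOperator_boundarySymbol hA v, fun A hA =>
      ⟨fun z s => PsiDO.isFredholm_boundarySymbol hA (z, s), fun E hE h1 => ?_⟩⟩
  -- The components of ν are evaluations at (1, −1) and (1, 1), so both are the pointwise formula at
  -- a single v.
  exact Prod.ext
    (PsiDO.map_evalAt_gammaE_indexMapE _ _ _ hA _ _ h1)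
    (PsiDO.map_evalAt_gammaE_indexMapE _ _ _ hA _ _ h1)
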